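/- Let $A$ be a Lie algebroid of rank $n$ over a smooth manifold $M$ (finite-dimensional, Hausdorff, $\sigma$-compact, without boundary), with anchor $a$ and bracket $[\cdot,\cdot]$ on $\Gamma(A)$. For $\theta\in\Gamma(\wedge^l A^*)$ and $V\in\Gamma(\wedge^k A)$ let $\theta\lrcorner V$ be the contraction defined by $\langle\omega,\theta\lrcorner V\rangle=\langle\theta\wedge\omega,V\rangle$ for all $\omega\in\Gamma(\wedge^{k-l}A^*)$ (and $\theta\lrcorner V=0$ if $l>k$), where $\langle\alpha_1\wedge\dots\wedge\alpha_k,X_1\wedge\dots\wedge X_k\rangle=\det(\alpha_i(X_j))$. There is a unique $\mathbb R$-linear $d:\Gamma(\wedge^*A^*)\to\Gamma(\wedge^{*+1}A^*)$ with $$d\omega(X_1,\dots,X_{k+1})=\sum_i(-1)^{i+1}a(X_i)\,\omega(X_1,\dots,\widehat{X_i},\dots,X_{k+1})+\sum_{i<j}(-1)^{i+j}\omega([X_i,X_j],X_1,\dots,\widehat{X_i},\dots,\widehat{X_j},\dots,X_{k+1})$$ for all $\omega\in\Gamma(\wedge^kA^*)$ and $X_i\in\Gamma(A)$. There is also a unique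 Gerstenhaber bracket on $\Gamma(\wedge^*A)=\bigoplus_k\Gamma(\wedge^kA)$ (an $\mathbb R$-bilinear bracket that makes $\Gamma(\wedge^*A)$, with the degree $k$ part placed in degree $k-1$, a graded Lie algebra, and for which $[U,\cdot]$ is, for each $U\in\Gamma(\wedge^uA)$, a derivation of degree $u-1$ of the wedge product) that extends the bracket of $\Gamma(A)$ and satisfies $[X,f]=a(X)f$ for $X\in\Gamma(A)$, $f\in C^\infty(M)$; it is called the Schouten bracket. An $A$-connection on the line bundle $\wedge^nA$ is an $\mathbb R$-bilinear map $\nabla:\Gamma(A)\times\Gamma(\wedge^nA)\to\Gamma(\wedge^nA)$ with $\nabla_{fX}\Lambda=f\nabla_X\Lambda$ and $\nabla_X(f\Lambda)=(a(X)f)\Lambda+f\nabla_X\Lambda$. Its curvature is $R(X,Y)=\nabla_X\nabla_Y-\nabla_Y\nabla_X-\nabla_{[X,Y]}$, and it is flat if $R=0$. An $\mathbb R$-linear operator $D$ on $\Gamma(\wedge^*A)$ of degree $-1$ (so $D=0$ on $\Gamma(\wedge^0A)$) generates the Schouten bracket if for all $u$, all $U\in\Gamma(\wedge^uA)$ and all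 $V\in\Gamma(\wedge^*A)$ $$[U,V]=(-1)^u\bigl(D(U\wedge V)-DU\wedge V-(-1)^uU\wedge DV\bigr).$$ Then there is a bijection $\nabla\leftrightarrow D$ between the $A$-connections $\nabla$ on $\wedge^nA$ and the $\mathbb R$-linear operators $D$ of degree $-1$ on $\Gamma(\wedge^*A)$ that generate the Schouten bracket, with the following properties. 1. The operator $D$ corresponding to $\nabla$ is the unique $\mathbb R$-linear operator on $\Gamma(\wedge^*A)$ such that, whenever $U\in\Gamma(\wedge^kA)$, $\omega\in\Gamma(\wedge^{n-k}A^*)$ and $\Lambda\in\Gamma(\wedge^nA)$ satisfy $U=\omega\lrcorner\Lambda$ near a point $m\in M$, and $X_1,\dots,X_n\in\Gamma(A)$ restrict to a basis of $A|_m$ with dual basis $\alpha_1,\dots,\alpha_n$, $$DU|_m=-(-1)^{n-k}\Bigl(d\omega\lrcorner\Lambda+\sum_{i=1}^n(\alpha_i\wedge\omega)\lrcorner\nabla_{X_i}\Lambda\Bigr)\Big|_m .$$ 2. The connection corresponding to $D$ is given by $\nabla_X\Lambda=-X\wedge D\Lambda$ for $X\in\Gamma(A)$, $\Lambda\in\Gamma(\wedge^nA)$.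 3. The curvature of $\nabla$ is given by a unique form $R\in\Gamma(\wedge^2A^*)$, under the identification of $\mathrm{End}(\wedge^nA)$ with the trivial line bundle, and $D^2U=-R\lrcorner U$ for all $U\in\Gamma(\wedge^*A)$. 4. $\nabla$ is flat if and only if $D^2=0$. -/

import Mathlib

open Bundle Set Filter Topology
open scoped Manifold ContDiff

noncomputable section

/-! ### Contraction of multivectors with forms -/

section Pointwise

variable {W : Type*} [AddCommGroup W] [Module ℝ W]

/-- The contraction `θ ↦ (θ ⌟ ·)` as an algebra map from the exterior algebra of the dual to the
*opposite* of the endomorphisms of the exterior algebra. On a covector it is the usual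
antiderivation, and `(θ₁ ∧ θ₂) ⌟ v = θ₂ ⌟ (θ₁ ⌟ v)`. -/
def contractHom (W : Type*) [AddCommGroup W] [Module ℝ W] :
    ExteriorAlgebra ℝ (Module.Dual ℝ W) →ₐ[ℝ] (Module.End ℝ (ExteriorAlgebra ℝ W))ᵐᵒᵖ :=
  ExteriorAlgebra.lift ℝ
    ⟨(MulOpposite.opLinearEquiv ℝ).toLinearMap ∘ₗ
      (CliffordAlgebra.contractLeft (Q := (0 : QuadraticForm ℝ W))), fun α => by
        refine MulOpposite.unop_injective (LinearMap.ext fun v => ?_)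
        exact CliffordAlgebra.contractLeft_contractLeft (d := α) v⟩

/-- The contraction `θ ⌟ v` of a multivector `v` with a form `θ`, with the convention
`⟨η, θ ⌟ v⟩ = ⟨θ ∧ η, v⟩`. -/
def contract (θ : ExteriorAlgebra ℝ (Module.Dual ℝ W)) (v : ExteriorAlgebra ℝ W) :
    ExteriorAlgebra ℝ W :=
  (contractHom W θ).unop v

/-- The duality pairing between forms and multivectors (the degree zero part of `θ ⌟ v`);
`⟨α₁ ∧ ⋯ ∧ αₖ, v₁ ∧ ⋯ ∧ vₖ⟩ = det (αᵢ (vⱼ))`. -/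
def formPair (θ : ExteriorAlgebra ℝ (Module.Dual ℝ W)) (v : ExteriorAlgebra ℝ W) : ℝ :=
  ExteriorAlgebra.algebraMapInv (contract θ v)

theorem contract_mul (θ η : ExteriorAlgebra ℝ (Module.Dual ℝ W)) (v : ExteriorAlgebra ℝ W) :
    contract (θ * η) v = contract η (contract θ v) := by
  simp [contract]

theorem contract_ι (α : Module.Dual ℝ W) (v : ExteriorAlgebra ℝ W) :
    contract (ExteriorAlgebra.ι ℝ α) v =
      CliffordAlgebra.contractLeft (Q := (0 : QuadraticForm ℝ W)) α v := by
  simp [contract, contractHom]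

end Pointwise

/-! ### Smooth sections of exterior algebra bundles -/

section SmoothSections

variable (E : Type*) [NormedAddCommGroup E] [NormedSpace ℝ E]
  {M : Type*} [TopologicalSpace M] [ChartedSpace E M]
  {G : Type*} [AddCommGroup G] [Module ℝ G] [FiniteDimensional ℝ G]
  {W : M → Type*} [∀ x, AddCommGroup (W x)] [∀ x, Module ℝ (W x)]

/-- Let `W` be a bundle over `M` and, for each `x₀`, let `c x₀ x : W x → G` be the fibrewise
coordinate maps of a local trivialization around `x₀`. This is the algebra of smooth sections of
the exterior algebra bundle `∧ W`: those sections which, read in the trivialization around each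
point `x₀`, have smooth components at `x₀`. The product is the fibrewise wedge product. -/
def smoothExterior (c : M → ∀ x, W x →ₗ[ℝ] G) :
    Subalgebra ℝ (∀ x, ExteriorAlgebra ℝ (W x)) where
  carrier := {σ | ∀ (x₀ : M) (φ : ExteriorAlgebra ℝ G →ₗ[ℝ] ℝ),
    ContMDiffAt 𝓘(ℝ, E) 𝓘(ℝ, ℝ) ∞ (fun x => φ (ExteriorAlgebra.map (c x₀ x) (σ x))) x₀}
  algebraMap_mem' r x₀ φ := by
    simp only [Pi.algebraMap_apply, AlgHom.commutes]
    exact contMDiffAt_const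
  add_mem' {σ τ} hσ hτ x₀ φ := by
    simp only [Pi.add_apply, map_add]
    exact (hσ x₀ φ).add (hτ x₀ φ)
  mul_mem' {σ τ} hσ hτ x₀ φ := by
    classical
    let b := (Module.finBasis ℝ G).ExteriorAlgebra
    have key : ∀ p q : ExteriorAlgebra ℝ G,
        φ (p * q) = ∑ i, ∑ j, b.coord i p * b.coord j q * φ (b i * b j) := by
      intro p q
      conv_lhs => rw [← b.sum_repr p, ← b.sum_repr q]
      simp only [Finset.sum_mul_sum, map_sum, smul_mul_smul_comm, map_smul, smul_eq_mul,
        Module.Basis.coord_apply]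
    have h : (fun x => φ (ExteriorAlgebra.map (c x₀ x) ((σ * τ) x))) = fun x => ∑ i, ∑ j,
        b.coord i (ExteriorAlgebra.map (c x₀ x) (σ x)) *
          b.coord j (ExteriorAlgebra.map (c x₀ x) (τ x)) * φ (b i * b j) := by
      funext x
      rw [Pi.mul_apply, map_mul, key]
    rw [h]
    refine contMDiffAt_finsetSum fun i _ => contMDiffAt_finsetSum fun j _ => ?_
    exact ((hσ x₀ (b.coord i)).mul (hτ x₀ (b.coord j))).mul contMDiffAt_const

variable {E}
variable {c : M → ∀ x, W x →ₗ[ℝ] G}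

/-- Smooth functions as sections of degree zero. -/
def ofFun (c : M → ∀ x, W x →ₗ[ℝ] G) : C^∞⟮𝓘(ℝ, E), M; ℝ⟯ →+* smoothExterior E c where
  toFun f := ⟨fun x => algebraMap ℝ _ (f x), fun x₀ φ => by
    have h : ∀ x, φ (ExteriorAlgebra.map (c x₀ x) (algebraMap ℝ (ExteriorAlgebra ℝ (W x)) (f x)))
        = f x * φ 1 := fun x => by
      rw [AlgHom.commutes, Algebra.algebraMap_eq_smul_one, map_smul, smul_eq_mul]
    simp only [h]
    exact (f.contMDiff x₀).mul contMDiffAt_const⟩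
  map_one' := by ext x; simp
  map_mul' f g := by ext x; simp
  map_zero' := by ext x; simp
  map_add' f g := by ext x; simp

/-- The sections of `∧ W` form an algebra over the smooth functions, `(f • U) x = f x • U x`. -/
instance smoothExteriorAlgebra : Algebra C^∞⟮𝓘(ℝ, E), M; ℝ⟯ (smoothExterior E c) :=
  (ofFun c).toAlgebra' fun f U => by
    ext x
    exact Algebra.commutes (f x) (U.1 x)

theorem smoothExterior_smul_apply (f : C^∞⟮𝓘(ℝ, E), M; ℝ⟯) (U : smoothExterior E c) (x : M) :
    (f • U).1 x = f x • U.1 x := by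
  rw [Algebra.smul_def, Algebra.smul_def]
  rfl

instance smoothExteriorTower :
    IsScalarTower ℝ C^∞⟮𝓘(ℝ, E), M; ℝ⟯ (smoothExterior E c) where
  smul_assoc r f U := by
    ext x
    change ((r • f) • U).1 x = r • (f • U).1 x
    rw [smoothExterior_smul_apply, smoothExterior_smul_apply, ← smul_assoc]
    rfl

/-- The homogeneous sections of degree `k`, i.e. the smooth sections of `∧ᵏ W`. -/
def homogeneous (c : M → ∀ x, W x →ₗ[ℝ] G) (k : ℕ) :
    Submodule C^∞⟮𝓘(ℝ, E), M; ℝ⟯ (smoothExterior E c) where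
  carrier := {U | ∀ x, U.1 x ∈ ⋀[ℝ]^k (W x)}
  add_mem' hU hV x := Submodule.add_mem _ (hU x) (hV x)
  zero_mem' x := Submodule.zero_mem _
  smul_mem' f U hU x := by
    rw [smoothExterior_smul_apply]
    exact Submodule.smul_mem _ _ (hU x)

end SmoothSections

/-! ### Sections, multivectors and forms of a vector bundle -/

section Bundle

variable (E : Type*) [NormedAddCommGroup E] [NormedSpace ℝ E]
  {M : Type*} [TopologicalSpace M] [ChartedSpace E M]
  (F : Type*) [NormedAddCommGroup F] [NormedSpace ℝ F] [FiniteDimensional ℝ F]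
  (V : M → Type*) [TopologicalSpace (TotalSpace F V)]
  [∀ x, AddCommGroup (V x)] [∀ x, Module ℝ (V x)] [∀ x, TopologicalSpace (V x)]
  [FiberBundle F V] [VectorBundle ℝ F V]

/-- The fibre coordinates of `V` at `x` in the trivialization around `x₀`. -/
def vecCoord (x₀ x : M) : V x →ₗ[ℝ] F := (trivializationAt F V x₀).linearMapAt ℝ x

/-- The fibre coordinates of the dual bundle at `x` in the trivialization around `x₀`. -/
def covecCoord (x₀ x : M) : Module.Dual ℝ (V x) →ₗ[ℝ] Module.Dual ℝ F :=
  ((trivializationAt F V x₀).symmₗ ℝ x).dualMap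

/-- Smooth sections `Γ(∧* V)`. -/
abbrev Multivectors := smoothExterior E (vecCoord F V)

/-- Smooth sections `Γ(∧* V*)`. -/
abbrev Forms := smoothExterior E (covecCoord F V)

/-- Smooth sections `Γ(∧ᵏ V)`. -/
abbrev MultivectorsDeg (k : ℕ) :
    Submodule C^∞⟮𝓘(ℝ, E), M; ℝ⟯ (Multivectors E F V) := homogeneous (vecCoord F V) k

/-- Smooth sections `Γ(∧ᵏ V*)`. -/
abbrev FormsDeg (k : ℕ) :
    Submodule C^∞⟮𝓘(ℝ, E), M; ℝ⟯ (Forms E F V) := homogeneous (covecCoord F V) k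

variable {E F V}

/-- Smooth sections of a vector bundle form a module over the smooth functions. -/
instance sectionModule : Module C^∞⟮𝓘(ℝ, E), M; ℝ⟯ Cₛ^∞⟮𝓘(ℝ, E); F, V⟯ where
  smul f s := ⟨fun x => f x • s x, f.contMDiff.smul_section s.contMDiff⟩
  one_smul s := by ext x; exact one_smul ℝ (s x)
  mul_smul f g s := by ext x; exact mul_smul (f x) (g x) (s x)
  smul_zero f := by ext x; exact smul_zero (f x)
  smul_add f s t := by ext x; exact smul_add (f x) (s x) (t x)
  add_smul f g s := by ext x; exact add_smul (f x) (g x) (s x)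
  zero_smul s := by ext x; exact zero_smul ℝ (s x)

/-- Sections of `V` as multivectors of degree one. -/
def ofSec : Cₛ^∞⟮𝓘(ℝ, E); F, V⟯ →ₗ[ℝ] Multivectors E F V where
  toFun s := ⟨fun x => ExteriorAlgebra.ι ℝ (s x), fun x₀ φ => by
    have h1 := (contMDiffAt_section x₀).1 (s.contMDiff x₀)
    have h2 : ContMDiffAt 𝓘(ℝ, E) 𝓘(ℝ, ℝ) ∞ (fun x => (φ ∘ₗ ExteriorAlgebra.ι ℝ).toContinuousLinearMap
        ((trivializationAt F V x₀ (⟨x, s x⟩ : TotalSpace F V)).2)) x₀ :=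
      (ContinuousLinearMap.contMDiff _ _).comp x₀ h1
    refine h2.congr_of_eventuallyEq ?_
    filter_upwards [(trivializationAt F V x₀).open_baseSet.mem_nhds
      (mem_baseSet_trivializationAt F V x₀)] with x hx
    simp [vecCoord, Trivialization.linearMapAt_apply, hx]⟩
  map_add' s t := by ext x; simp
  map_smul' r s := by ext x; simp

/-- The wedge product, in increasing order, of those sections `X i` with `i ∉ s`. -/
def wedgeOmit {m : ℕ} (X : Fin m → Cₛ^∞⟮𝓘(ℝ, E); F, V⟯) (s : Finset (Fin m)) :
    Multivectors E F V :=
  (((List.finRange m).filter (fun i => i ∉ s)).map (fun i => ofSec (X i))).prod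

/-- The function `x ↦ ⟨η x, U x⟩`; for `U = X₁ ∧ ⋯ ∧ Xₖ` and `η` of degree `k` this is
`η (X₁, …, Xₖ)`. -/
def evalForm (η : Forms E F V) (U : Multivectors E F V) (x : M) : ℝ :=
  formPair (η.1 x) (U.1 x)

end Bundle

/-! ### Lie algebroids -/

section LieAlgebroid

/-- A Lie algebroid structure on a smooth vector bundle `V` over `M`. -/
structure LieAlgebroid (E : Type*) [NormedAddCommGroup E] [NormedSpace ℝ E]
    {M : Type*} [TopologicalSpace M] [ChartedSpace E M] [IsManifold 𝓘(ℝ, E) ∞ M]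
    (F : Type*) [NormedAddCommGroup F] [NormedSpace ℝ F]
    (V : M → Type*) [TopologicalSpace (TotalSpace F V)]
    [∀ x, AddCommGroup (V x)] [∀ x, Module ℝ (V x)] [∀ x, TopologicalSpace (V x)]
    [FiberBundle F V] [VectorBundle ℝ F V] where
  /-- the Lie bracket on sections -/
  bracket : Cₛ^∞⟮𝓘(ℝ, E); F, V⟯ →ₗ[ℝ] Cₛ^∞⟮𝓘(ℝ, E); F, V⟯ →ₗ[ℝ] Cₛ^∞⟮𝓘(ℝ, E); F, V⟯
  bracket_self : ∀ X, bracket X X = 0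
  jacobi : ∀ X Y Z, bracket X (bracket Y Z) = bracket (bracket X Y) Z + bracket Y (bracket X Z)
  /-- the anchor, a smooth bundle map to the tangent bundle -/
  anchor : ∀ x, V x →ₗ[ℝ] TangentSpace 𝓘(ℝ, E) x
  contMDiff_anchor : ContMDiff (𝓘(ℝ, E).prod 𝓘(ℝ, F)) 𝓘(ℝ, E).tangent ∞
    (fun v : TotalSpace F V => (⟨v.proj, anchor v.proj v.2⟩ : TangentBundle 𝓘(ℝ, E) M))
  anchor_bracket : ∀ X Y x, anchor x (bracket X Y x) =
    VectorField.mlieBracket 𝓘(ℝ, E) (fun y => anchor y (X y)) (fun y => anchor y (Y y)) x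
  leibniz : ∀ (X Y : Cₛ^∞⟮𝓘(ℝ, E); F, V⟯) (f : C^∞⟮𝓘(ℝ, E), M; ℝ⟯) (x : M),
    bracket X (f • Y) x = f x • bracket X Y x + mvfderiv 𝓘(ℝ, E) f x (anchor x (X x)) • Y x

variable {E : Type*} [NormedAddCommGroup E] [NormedSpace ℝ E]
  {M : Type*} [TopologicalSpace M] [ChartedSpace E M] [IsManifold 𝓘(ℝ, E) ∞ M]
  {F : Type*} [NormedAddCommGroup F] [NormedSpace ℝ F] [FiniteDimensional ℝ F]
  {V : M → Type*} [TopologicalSpace (TotalSpace F V)]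
  [∀ x, AddCommGroup (V x)] [∀ x, Module ℝ (V x)] [∀ x, TopologicalSpace (V x)]
  [FiberBundle F V] [VectorBundle ℝ F V]

namespace LieAlgebroid

/-- The derivative `a(X) g` of a function `g` along the anchor of `X`. -/
def deriv (A : LieAlgebroid E F V) (X : Cₛ^∞⟮𝓘(ℝ, E); F, V⟯) (g : M → ℝ) (x : M) : ℝ :=
  mvfderiv 𝓘(ℝ, E) g x (A.anchor x (X x))

theorem contMDiff_deriv (A : LieAlgebroid E F V) (X : Cₛ^∞⟮𝓘(ℝ, E); F, V⟯)
    (f : C^∞⟮𝓘(ℝ, E), M; ℝ⟯) : ContMDiff 𝓘(ℝ, E) 𝓘(ℝ, ℝ) ∞ (A.deriv X f) := by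
  have h1 : ContMDiff 𝓘(ℝ, E) 𝓘(ℝ, E).tangent ∞
      (fun x => (⟨x, A.anchor x (X x)⟩ : TangentBundle 𝓘(ℝ, E) M)) :=
    A.contMDiff_anchor.comp X.contMDiff
  have h2 := (f.contMDiff.contMDiff_tangentMap (m := ∞) (by simp)).comp h1
  intro x
  have h3 := (contMDiffAt_totalSpace.1 (h2 x)).2
  refine h3.congr_of_eventuallyEq (Eventually.of_forall fun y => ?_)
  simp [deriv, mvfderiv, tangentMap]
  rfl

/-- The derivative `a(X) f` as a smooth function. -/
def act (A : LieAlgebroid E F V) (X : Cₛ^∞⟮𝓘(ℝ, E); F, V⟯) (f : C^∞⟮𝓘(ℝ, E), M; ℝ⟯) :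
    C^∞⟮𝓘(ℝ, E), M; ℝ⟯ :=
  ⟨A.deriv X f, A.contMDiff_deriv X f⟩

/-- `d` is the Lie algebroid differential on `Γ(∧* A*)`: it raises degrees by one and
`dη (X₀, …, Xₖ) = ∑ᵢ (-1)ⁱ a(Xᵢ) (η (X₀, …, X̂ᵢ, …, Xₖ))
  + ∑_{i < j} (-1)^{i+j} η ([Xᵢ, Xⱼ], X₀, …, X̂ᵢ, …, X̂ⱼ, …, Xₖ)`. -/
structure IsDifferential (A : LieAlgebroid E F V) (d : Forms E F V →ₗ[ℝ] Forms E F V) :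
    Prop where
  degree : ∀ (k : ℕ), ∀ η ∈ FormsDeg E F V k, d η ∈ FormsDeg E F V (k + 1)
  cartan : ∀ (k : ℕ), ∀ η ∈ FormsDeg E F V k,
    ∀ (X : Fin (k + 1) → Cₛ^∞⟮𝓘(ℝ, E); F, V⟯) (x : M),
      evalForm (d η) (wedgeOmit X ∅) x =
        (∑ i : Fin (k + 1), (-1 : ℝ) ^ (i : ℕ) * A.deriv (X i) (evalForm η (wedgeOmit X {i})) x) +
        ∑ i : Fin (k + 1), ∑ j : Fin (k + 1), if i < j then (-1 : ℝ) ^ ((i : ℕ) + (j : ℕ)) *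
          evalForm η (ofSec (A.bracket (X i) (X j)) * wedgeOmit X {i, j}) x else 0

/-- `B` is a Gerstenhaber bracket on the graded commutative algebra `Γ(∧* A)` that extends the Lie
bracket of sections and the action of sections on functions. Signs `(-1)^{(u-1)(v-1)}` are written
`(-1)^{(u+1)(v+1)}`. -/
structure IsSchoutenBracket (A : LieAlgebroid E F V)
    (B : Multivectors E F V →ₗ[ℝ] Multivectors E F V →ₗ[ℝ] Multivectors E F V) : Prop where
  degree : ∀ (u v w : ℕ), u + v = w + 1 →
    ∀ U ∈ MultivectorsDeg E F V u, ∀ U' ∈ MultivectorsDeg E F V v,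
      B U U' ∈ MultivectorsDeg E F V w
  degree_zero : ∀ U ∈ MultivectorsDeg E F V 0, ∀ U' ∈ MultivectorsDeg E F V 0, B U U' = 0
  skew : ∀ (u v : ℕ), ∀ U ∈ MultivectorsDeg E F V u, ∀ U' ∈ MultivectorsDeg E F V v,
    B U U' = -((-1 : ℝ) ^ ((u + 1) * (v + 1)) • B U' U)
  jacobi : ∀ (u v : ℕ), ∀ U ∈ MultivectorsDeg E F V u, ∀ U' ∈ MultivectorsDeg E F V v,
    ∀ U'' : Multivectors E F V,
      B U (B U' U'') = B (B U U') U'' + (-1 : ℝ) ^ ((u + 1) * (v + 1)) • B U' (B U U'')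
  leibniz : ∀ (u v : ℕ), ∀ U ∈ MultivectorsDeg E F V u, ∀ U' ∈ MultivectorsDeg E F V v,
    ∀ U'' : Multivectors E F V,
      B U (U' * U'') = B U U' * U'' + (-1 : ℝ) ^ ((u + 1) * v) • (U' * B U U'')
  sections : ∀ X Y : Cₛ^∞⟮𝓘(ℝ, E); F, V⟯, B (ofSec X) (ofSec Y) = ofSec (A.bracket X Y)
  functions : ∀ (X : Cₛ^∞⟮𝓘(ℝ, E); F, V⟯) (f : C^∞⟮𝓘(ℝ, E), M; ℝ⟯),
    B (ofSec X) (ofFun _ f) = ofFun _ (A.act X f)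

/-- An `A`-connection on a vector bundle whose module of smooth sections is `S`. -/
structure Connection (A : LieAlgebroid E F V) (S : Type*) [AddCommGroup S] [Module ℝ S]
    [Module C^∞⟮𝓘(ℝ, E), M; ℝ⟯ S] where
  /-- the covariant derivative `∇_X s` -/
  nabla : Cₛ^∞⟮𝓘(ℝ, E); F, V⟯ →ₗ[ℝ] S →ₗ[ℝ] S
  smul_left : ∀ (f : C^∞⟮𝓘(ℝ, E), M; ℝ⟯) (X : Cₛ^∞⟮𝓘(ℝ, E); F, V⟯) (s : S),
    nabla (f • X) s = f • nabla X s
  leibniz : ∀ (f : C^∞⟮𝓘(ℝ, E), M; ℝ⟯) (X : Cₛ^∞⟮𝓘(ℝ, E); F, V⟯) (s : S),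
    nabla X (f • s) = A.act X f • s + f • nabla X s

section Connection

variable {A : LieAlgebroid E F V}

/-- The curvature `R(X, Y) s = ∇_X ∇_Y s - ∇_Y ∇_X s - ∇_{[X, Y]} s`. -/
def Connection.curvature {S : Type*} [AddCommGroup S] [Module ℝ S]
    [Module C^∞⟮𝓘(ℝ, E), M; ℝ⟯ S] (C : A.Connection S) (X Y : Cₛ^∞⟮𝓘(ℝ, E); F, V⟯) (s : S) : S :=
  C.nabla X (C.nabla Y s) - C.nabla Y (C.nabla X s) - C.nabla (A.bracket X Y) s

/-- The connection is flat if its curvature vanishes. -/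
def Connection.IsFlat {S : Type*} [AddCommGroup S] [Module ℝ S]
    [Module C^∞⟮𝓘(ℝ, E), M; ℝ⟯ S] (C : A.Connection S) : Prop :=
  ∀ X Y s, C.curvature X Y s = 0

/-- `R ∈ Γ(∧² A*)` is the curvature of the connection `C` on the line bundle `∧ⁿ A`, under the
identification of `End (∧ⁿ A)` with the trivial line bundle. -/
def Connection.IsCurvatureForm {n : ℕ} (C : A.Connection (MultivectorsDeg E F V n))
    (R : Forms E F V) : Prop :=
  R ∈ FormsDeg E F V 2 ∧
    ∀ (X Y : Cₛ^∞⟮𝓘(ℝ, E); F, V⟯) (s : MultivectorsDeg E F V n) (x : M),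
      (C.curvature X Y s).1.1 x = evalForm R (ofSec X * ofSec Y) x • s.1.1 x

/-- The operator `D` is given by the connection `C` on `∧ⁿ A` (and the differential `d`): whenever
`U = η ⌟ Λ` near a point `m`, with `η` of degree `p` and `Λ` of degree `n`,
`DU|ₘ = -(-1)ᵖ (dη ⌟ Λ + ∑ᵢ (αᵢ ∧ η) ⌟ ∇_{Xᵢ} Λ)|ₘ` for every basis `Xᵢ` of the fibre at `m`, with
dual basis `αᵢ`. -/
def Connection.IsOperatorOf {n : ℕ} (C : A.Connection (MultivectorsDeg E F V n))
    (d : Forms E F V →ₗ[ℝ] Forms E F V)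
    (D : Multivectors E F V →ₗ[ℝ] Multivectors E F V) : Prop :=
  ∀ (p k : ℕ), p + k = n → ∀ U ∈ MultivectorsDeg E F V k, ∀ η ∈ FormsDeg E F V p,
    ∀ (Λ : MultivectorsDeg E F V n) (m : M),
      (∀ᶠ x in 𝓝 m, U.1 x = contract (η.1 x) (Λ.1.1 x)) →
      ∀ (X : Fin n → Cₛ^∞⟮𝓘(ℝ, E); F, V⟯) (b : Module.Basis (Fin n) ℝ (V m)),
        (∀ i, X i m = b i) →
        (D U).1 m = -((-1 : ℝ) ^ p • (contract ((d η).1 m) (Λ.1.1 m) +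
          ∑ i, contract (ExteriorAlgebra.ι ℝ (b.coord i) * η.1 m) ((C.nabla (X i) Λ).1.1 m)))

end Connection

end LieAlgebroid

/-- The operator `D` on `Γ(∧* V)` has degree `-1`. -/
def IsDegreeNegOne (D : Multivectors E F V →ₗ[ℝ] Multivectors E F V) : Prop :=
  (∀ U ∈ MultivectorsDeg E F V 0, D U = 0) ∧
    ∀ (k : ℕ), ∀ U ∈ MultivectorsDeg E F V (k + 1), D U ∈ MultivectorsDeg E F V k

/-- The operator `D` generates the bracket `B`. -/
def GeneratesBracket (B : Multivectors E F V →ₗ[ℝ] Multivectors E F V →ₗ[ℝ] Multivectors E F V)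
    (D : Multivectors E F V →ₗ[ℝ] Multivectors E F V) : Prop :=
  ∀ (u : ℕ), ∀ U ∈ MultivectorsDeg E F V u, ∀ U' : Multivectors E F V,
    B U U' = (-1 : ℝ) ^ u • (D (U * U') - D U * U' - (-1 : ℝ) ^ u • (U * D U'))

end LieAlgebroid

end

/-!
The bijection between connections on `∧ⁿ A` and generating operators factors through a third kind
of object. A *divergence* is an `ℝ`-linear map `div` from sections to functions with
`div (f X) = f div X - a(X) f`.

* A divergence extends in exactly one way to an operator `D` of degree `-1` on multivectors with
  `D X = div X` and `α ⌟ DU = dα ⌟ U - D (α ⌟ U)` for one-forms `α`: the second rule determines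
  `DU` by induction on the degree, because a multivector of positive degree is determined by its
  contractions with one-forms (`ContractionPair.divOp`). By induction on the degree of `η` it gives
  `D (η ⌟ U) = (-1)ᵖ (η ⌟ DU - dη ⌟ U)` for all `p`-forms `η` (`ContractionPair.divOp_I`), which
  with `∇_X Λ = -X ∧ DΛ` is the local formula for `D`. The operator has order two
  (`ContractionPair.divOp_mul_mul`), so its failure to be a derivation is a biderivation, which is
  the Schouten bracket (`ContractionPair.genBracket_isSchouten`). Conversely, a generator is
  determined by its values on sections, and these form a divergence
  (`ContractionPair.IsGenerator.exists_divergence`).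
* A divergence yields the connection `∇_X Λ = -X ∧ DΛ`. In the top degree the Schouten bracket is
  `[X, Λ] = div X Λ - X ∧ DΛ`, so the connection determines the divergence
  (`ContractionPair.div_eq_of_connection_eq`). Two connections differ by a one-form, since
  endomorphisms of a line bundle are functions, and so do two divergences; hence every connection
  arises (`ContractionPair.exists_divergence_of_connection`) as soon as there is some divergence.
  One is glued from divergences with respect to local frames
  (`LieAlgebroid.nonempty_divergence`).

`D²` is linear over the functions and commutes with contractions, so it is the contraction with a
two-form `-R` (`ContractionPair.exists_divOp_divOp_eq`). The order two property of `D`, applied to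
`X ∧ Y ∧ DΛ = 0`, identifies `R` with the curvature
(`ContractionPair.curvature_eq_mul_divOp_divOp`).

All of this is algebra over the ring of smooth functions, and it is carried out for abstract graded
algebras with contractions (`ContractionAlgebra`, `ContractionPair`) over a Lie-Rinehart algebra
(`LieRinehart`). Of the geometry only two things enter: dual frames near each point, made global by
bump functions, and the possibility of checking identities and gluing elements near each point. The
last parts show that forms and multivectors of a vector bundle are an instance
(`LocalFrames.toContractionPair`).
-/

/-! ### Graded algebras with contractions -/

/-- The algebraic shadow of the sections of an exterior algebra bundle of rank `n` over `M`: a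
graded commutative algebra `Ω` over the ring `K` of functions, on which a `K`-module `P` (the
sections of the dual bundle) acts by antiderivations `con p` of degree `-1`.

Local triviality is encoded algebraically: `cut m` plays the role of a bump function at `m`, and
`frame` provides global sections which, multiplied by the bump function, are a pair of dual frames.
The axioms `faithful_pow` and `glue_pow` express that sections are determined by, and can be glued
from, their restrictions. -/
structure ContractionAlgebra (n : ℕ) (M K Ω P : Type*) [CommRing K] [Algebra ℝ K] [Ring Ω]
    [Algebra ℝ Ω] [Algebra K Ω] [AddCommGroup P] [Module K P] where
  /-- the homogeneous elements of degree `k` -/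
  gr : ℕ → Submodule K Ω
  /-- the homogeneous components -/
  proj : ℕ → Ω →ₗ[K] Ω
  /-- the component of degree zero, as a function -/
  aug : Ω →ₗ[K] K
  /-- the contraction -/
  con : P →ₗ[K] Ω →ₗ[K] Ω
  /-- bump functions -/
  cut : M → K
  proj_mem : ∀ k a, proj k a ∈ gr k
  proj_of_mem : ∀ {k : ℕ} {a : Ω}, a ∈ gr k → proj k a = a
  proj_of_ne : ∀ {k j : ℕ} {a : Ω}, a ∈ gr k → j ≠ k → proj j a = 0
  sum_proj : ∀ a, ∑ k ∈ Finset.range (n + 1), proj k a = a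
  mul_mem : ∀ {j k : ℕ} {a b : Ω}, a ∈ gr j → b ∈ gr k → a * b ∈ gr (j + k)
  mul_comm' : ∀ {j k : ℕ} {a b : Ω}, a ∈ gr j → b ∈ gr k → a * b = (-1 : ℝ) ^ (j * k) • (b * a)
  algebraMap_mem : ∀ f, algebraMap K Ω f ∈ gr 0
  algebraMap_aug : ∀ {a : Ω}, a ∈ gr 0 → algebraMap K Ω (aug a) = a
  aug_algebraMap : ∀ f, aug (algebraMap K Ω f) = f
  aug_of_pos : ∀ {k : ℕ} {a : Ω}, a ∈ gr (k + 1) → aug a = 0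
  con_mem : ∀ {k : ℕ} {a : Ω} p, a ∈ gr (k + 1) → con p a ∈ gr k
  con_zero : ∀ {a : Ω} p, a ∈ gr 0 → con p a = 0
  con_con : ∀ p a, con p (con p a) = 0
  con_mul : ∀ {k : ℕ} {a : Ω} p b, a ∈ gr k →
    con p (a * b) = con p a * b + (-1 : ℝ) ^ k • (a * con p b)
  frame : ∀ m, ∃ (e : Fin n → Ω) (p : Fin n → P), (∀ i, e i ∈ gr 1) ∧
    (∀ i j, con (p i) (e j) = if i = j then algebraMap K Ω (cut m) else 0) ∧
    (∀ q, cut m • q = ∑ i, aug (con q (e i)) • p i) ∧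
    ∀ k : ℕ, ∀ a ∈ gr k, ∑ i, e i * con (p i) a = (k : ℝ) • cut m • a
  faithful_pow : ∀ (r : ℕ) (a : Ω), (∀ m, cut m ^ r • a = 0) → a = 0
  glue_pow : ∀ (r : ℕ) (ζ : M → Ω), (∀ m m', cut m' ^ r • ζ m = cut m ^ r • ζ m') →
    ∃ a : Ω, ∀ m, ζ m = cut m ^ r • a

namespace ContractionAlgebra

variable {n : ℕ} {M K Ω P : Type*} [CommRing K] [Algebra ℝ K] [Ring Ω]
    [Algebra ℝ Ω] [Algebra K Ω] [AddCommGroup P] [Module K P]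
    (C : ContractionAlgebra n M K Ω P)

theorem faithful (a : Ω) (h : ∀ m, C.cut m • a = 0) : a = 0 :=
  C.faithful_pow 1 a (by simpa using h)

theorem glue (ζ : M → Ω) (h : ∀ m m', C.cut m' • ζ m = C.cut m • ζ m') :
    ∃ a : Ω, ∀ m, ζ m = C.cut m • a := by
  simpa using C.glue_pow 1 ζ (by simpa using h)

theorem induction_gr {Q : Ω → Prop} (hadd : ∀ a b, Q a → Q b → Q (a + b)) (h0 : Q 0)
    (h : ∀ k, ∀ a ∈ C.gr k, Q a) (a : Ω) : Q a := by
  rw [← C.sum_proj a]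
  exact Finset.sum_induction _ Q hadd h0 fun k _ => h k _ (C.proj_mem k a)

theorem eq_zero_of_lt {k : ℕ} (hk : n < k) {a : Ω} (ha : a ∈ C.gr k) : a = 0 := by
  rw [← C.sum_proj a]
  refine Finset.sum_eq_zero fun j hj => C.proj_of_ne ha ?_
  rw [Finset.mem_range] at hj
  omega

theorem mem_of_cut_smul_mem {k : ℕ} {a : Ω} (h : ∀ m, C.cut m • a ∈ C.gr k) : a ∈ C.gr k := by
  have : a = C.proj k a := by
    rw [← sub_eq_zero]
    refine C.faithful _ fun m => ?_
    rw [smul_sub, ← map_smul, C.proj_of_mem (h m), sub_self]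
  rw [this]
  exact C.proj_mem k a

/-- An element of positive degree all of whose contractions vanish is zero. -/
theorem eq_zero_of_con {k : ℕ} {a : Ω} (ha : a ∈ C.gr (k + 1)) (h : ∀ p, C.con p a = 0) :
    a = 0 := by
  refine C.faithful _ fun m => ?_
  obtain ⟨e, p, -, -, -, hE⟩ := C.frame m
  have := hE _ a ha
  simp only [h, mul_zero, Finset.sum_const_zero] at this
  exact ((smul_eq_zero (M := Ω)).1 this.symm).resolve_left (by positivity)

theorem eq_of_con {k : ℕ} {a b : Ω} (ha : a ∈ C.gr (k + 1)) (hb : b ∈ C.gr (k + 1))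
    (h : ∀ p, C.con p a = C.con p b) : a = b :=
  sub_eq_zero.1 <| C.eq_zero_of_con (Submodule.sub_mem _ ha hb) fun p => by
    rw [map_sub, h, sub_self]

theorem con_anticomm (p q : P) (a : Ω) : C.con p (C.con q a) = -C.con q (C.con p a) := by
  have := C.con_con (p + q) a
  simp only [map_add, LinearMap.add_apply, C.con_con, zero_add, add_zero] at this
  exact eq_neg_of_add_eq_zero_right (by rw [← this])

theorem con_mul_one {a : Ω} (ha : a ∈ C.gr 1) (p : P) (b : Ω) :
    C.con p (a * b) = C.con p a * b - a * C.con p b := by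
  rw [C.con_mul p b ha, pow_one, neg_smul, one_smul, sub_eq_add_neg]

theorem con_mem_zero {a : Ω} (ha : a ∈ C.gr 1) (p : P) :
    C.con p a = algebraMap K Ω (C.aug (C.con p a)) :=
  (C.algebraMap_aug (C.con_mem p ha)).symm

/-- Every homogeneous element is locally a sum of products of elements of degree one. Hence a
property which can be checked locally holds for all homogeneous elements as soon as it is inherited
by products with elements of degree one. -/
theorem local_induction {Q : ℕ → Ω → Prop} (h0 : ∀ f, Q 0 (algebraMap K Ω f))
    (hmul : ∀ k, ∀ α ∈ C.gr 1, ∀ a ∈ C.gr k, Q k a → Q (k + 1) (α * a))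
    (hzero : ∀ k, Q k 0) (hadd : ∀ k a b, Q k a → Q k b → Q k (a + b))
    (hsmul : ∀ k (r : ℝ) a, Q k a → Q k (r • a))
    (hcut : ∀ k, ∀ a ∈ C.gr k, (∀ m, Q k (C.cut m • a)) → Q k a) {k : ℕ} {a : Ω}
    (ha : a ∈ C.gr k) : Q k a := by
  induction k generalizing a with
  | zero =>
    rw [← C.algebraMap_aug ha]
    exact h0 _
  | succ k ih =>
    refine hcut _ a ha fun m => ?_
    obtain ⟨e, p, he, -, -, hE⟩ := C.frame m
    have h1 : C.cut m • a = ((k + 1 : ℕ) : ℝ)⁻¹ • ∑ i, e i * C.con (p i) a := by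
      rw [hE _ a ha, smul_smul, inv_mul_cancel₀ (by positivity), one_smul]
    rw [h1]
    exact hsmul _ _ _ (Finset.sum_induction _ _ (hadd _) (hzero _) fun i _ =>
      hmul _ _ (he i) _ (C.con_mem _ ha) (ih (C.con_mem _ ha)))

/-- An operator which commutes with all contractions up to a factor vanishes as soon as it does so
in the lowest degree. Here `T` maps degree `j + a` to degree `j + b`. -/
theorem eq_zero_of_con_comm (a b : ℕ) (c : ℝ) (T : Ω →ₗ[ℝ] Ω)
    (hT : ∀ j, ∀ x ∈ C.gr (j + a), T x ∈ C.gr (j + b))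
    (hlow : ∀ k < a, ∀ x ∈ C.gr k, T x = 0) (hbase : b = 0 → ∀ x ∈ C.gr a, T x = 0)
    (hcon : ∀ k, ∀ x ∈ C.gr k, ∀ p, C.con p (T x) = c • T (C.con p x)) (x : Ω) : T x = 0 := by
  have h0 : ∀ x ∈ C.gr a, T x = 0 := fun x hx => by
    rcases b with _ | b
    · exact hbase rfl x hx
    · refine C.eq_zero_of_con (k := b) (by simpa using hT 0 x (by simpa using hx)) fun p => ?_
      rw [hcon a x hx]
      rcases a with _ | a
      · rw [C.con_zero p hx, map_zero, smul_zero]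
      · rw [hlow a (Nat.lt_succ_self a) _ (C.con_mem p hx), smul_zero]
  have key : ∀ j, ∀ x ∈ C.gr (j + a), T x = 0 := fun j => by
    induction j with
    | zero => simpa using h0
    | succ j ih =>
      intro x hx
      have hx' : x ∈ C.gr (j + a + 1) := by rwa [Nat.add_right_comm] at hx
      refine C.eq_zero_of_con (k := j + b) ?_ fun p => ?_
      · rw [Nat.add_right_comm]
        exact hT _ x hx
      · rw [hcon _ x hx', ih _ (C.con_mem p hx'), smul_zero]
  refine C.induction_gr (Q := fun x => T x = 0)
    (fun a b ha hb => by rw [map_add, ha, hb, add_zero]) (map_zero T) (fun k x hx => ?_) x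
  rcases lt_or_ge k a with hk | hk
  · exact hlow k hk x hx
  · obtain ⟨j, rfl⟩ := Nat.exists_eq_add_of_le' hk
    exact key j x hx

/-- A graded derivation that vanishes on functions and in degree one is zero. -/
theorem eq_zero_of_derivation (t : ℕ) (T : Ω →ₗ[ℝ] Ω)
    (hT : ∀ k, ∀ a ∈ C.gr k, ∀ b, T (a * b) = T a * b + (-1 : ℝ) ^ (t * k) • (a * T b))
    (h0 : ∀ a ∈ C.gr 0, T a = 0) (h1 : ∀ a ∈ C.gr 1, T a = 0) (a : Ω) : T a = 0 := by
  have hsmul : ∀ (f : K) (x : Ω), T (f • x) = f • T x := fun f x => by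
    rw [Algebra.smul_def, hT 0 _ (C.algebraMap_mem f), h0 _ (C.algebraMap_mem f), zero_mul,
      zero_add, mul_zero, pow_zero, one_smul, Algebra.smul_def]
  have key : ∀ k, ∀ a ∈ C.gr k, T a = 0 := fun k => by
    induction k with
    | zero => exact h0
    | succ k ih =>
      intro a ha
      refine C.faithful _ fun m => ?_
      obtain ⟨e, p, he, -, -, hE⟩ := C.frame m
      have := congrArg T (hE _ a ha)
      simp only [map_sum, hT 1 _ (he _), h1 _ (he _), ih _ (C.con_mem _ ha), zero_mul, mul_zero,
        smul_zero, add_zero, Finset.sum_const_zero, map_smul, hsmul] at this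
      exact ((smul_eq_zero (M := Ω)).1 this.symm).resolve_left (by positivity)
  exact C.induction_gr (Q := fun x => T x = 0)
    (fun x y hx hy => by rw [map_add, hx, hy, add_zero]) (map_zero T) key a

variable [IsScalarTower ℝ K Ω]

theorem smul_comm_real (r : ℝ) (f : K) (a : Ω) : f • r • a = r • f • a := smul_comm _ _ _

/-- A `K`-linear family `φ p` of elements of degree `k` with `con p (φ p) = 0` is of the form
`φ p = con p ζ`. By the Euler identity, `ζ` is `(k + 1)⁻¹ ∑ᵢ eᵢ φ (pᵢ)` in local dual frames
`eᵢ`, `pᵢ`. -/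
theorem exists_con_eq {k : ℕ} (φ : P →ₗ[K] Ω) (hφ : ∀ p, φ p ∈ C.gr k)
    (h : ∀ p, C.con p (φ p) = 0) : ∃ ζ ∈ C.gr (k + 1), ∀ p, C.con p ζ = φ p := by
  choose e p he _ hp hE using C.frame
  have hanti : ∀ q r, C.con q (φ r) = -C.con r (φ q) := fun q r => by
    have := h (q + r)
    simp only [map_add, LinearMap.add_apply, h, zero_add, add_zero] at this
    exact eq_neg_of_add_eq_zero_right (by rw [← this])
  set ζ : M → Ω := fun m => ((k : ℝ) + 1)⁻¹ • ∑ i, e m i * φ (p m i) with hζ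
  have hmem : ∀ m, ζ m ∈ C.gr (k + 1) := fun m => by
    rw [hζ]
    refine Submodule.smul_of_tower_mem _ _ (Submodule.sum_mem _ fun i _ => ?_)
    have := C.mul_mem (he m i) (hφ (p m i))
    rwa [add_comm] at this
  have hcon : ∀ m q, C.con q (ζ m) = C.cut m • φ q := fun m q => by
    have h1 : C.con q (∑ i, e m i * φ (p m i)) = ((k : ℝ) + 1) • C.cut m • φ q := by
      have h2 : ∀ i, C.con q (e m i * φ (p m i)) =
          C.aug (C.con q (e m i)) • φ (p m i) + e m i * C.con (p m i) (φ q) := fun i => by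
        rw [C.con_mul_one (he m i), C.con_mem_zero (he m i), ← Algebra.smul_def, hanti q,
          mul_neg, sub_neg_eq_add]
        simp only [C.aug_algebraMap]
      simp only [map_sum, h2, Finset.sum_add_distrib]
      rw [hE m k _ (hφ q), ← map_smul φ (C.cut m) q, hp m q, map_sum]
      simp only [map_smul]
      rw [add_smul, one_smul, add_comm]
    simp only [hζ]
    rw [LinearMap.map_smul_of_tower, h1, smul_smul, inv_mul_cancel₀ (by positivity), one_smul]
  obtain ⟨a, ha⟩ := C.glue ζ fun m m' => by
    refine C.eq_of_con (k := k) (Submodule.smul_mem _ _ (hmem m)) (Submodule.smul_mem _ _ (hmem m'))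
      fun q => ?_
    rw [(C.con q).map_smul, (C.con q).map_smul, hcon, hcon, smul_comm]
  refine ⟨a, C.mem_of_cut_smul_mem fun m => ha m ▸ hmem m, fun q => ?_⟩
  rw [← sub_eq_zero]
  refine C.faithful _ fun m => ?_
  rw [smul_sub, ← map_smul, ← ha, hcon, sub_self]

/-- The solutions of `con p ζ = Φ a p` depend linearly on `a`. -/
theorem exists_linear_con_eq {k : ℕ} {A : Type*} [AddCommGroup A] [Module ℝ A]
    (Φ : P → A →ₗ[ℝ] Ω) (h : ∀ a, ∃ ζ ∈ C.gr (k + 1), ∀ p, C.con p ζ = Φ p a) :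
    ∃ S : A →ₗ[ℝ] Ω, ∀ a, S a ∈ C.gr (k + 1) ∧ ∀ p, C.con p (S a) = Φ p a := by
  choose S hS hcon using h
  refine ⟨⟨⟨S, fun a b => ?_⟩, fun r a => ?_⟩, fun a => ⟨hS a, hcon a⟩⟩
  · refine C.eq_of_con (hS _) (Submodule.add_mem _ (hS _) (hS _)) fun p => ?_
    rw [hcon, map_add, map_add, hcon, hcon]
  · refine C.eq_of_con (hS _) (Submodule.smul_of_tower_mem _ _ (hS _)) fun p => ?_
    dsimp only [RingHom.id_apply]
    rw [hcon, LinearMap.map_smul, (C.con p).map_smul_of_tower, hcon]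

/-- Construction of an operator `T` from its commutators `Q p` with the contractions, by recursion
on the degree: `T` maps degree `j + a` to degree `j + b`, is given by `T₀` on degree `a`, and
satisfies `con p ∘ T + σ T ∘ con p = Q p`. The operators `c f` are the commutators of `T` with the
functions. -/
theorem exists_operator (a b : ℕ) (σ : ℝ) (T₀ : Ω →ₗ[ℝ] Ω) (Q : P → Ω →ₗ[ℝ] Ω)
    (c : K → Ω →ₗ[ℝ] Ω)
    (hT₀ : ∀ x ∈ C.gr a, T₀ x ∈ C.gr b) (hT₀Q : ∀ p, ∀ x ∈ C.gr a, C.con p (T₀ x) = Q p x)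
    (hT₀c : ∀ f, ∀ x ∈ C.gr a, T₀ (f • x) = f • T₀ x + c f x)
    (hQadd : ∀ p q x, Q (p + q) x = Q p x + Q q x)
    (hQsmul : ∀ (f : K) p x, Q (f • p) x = f • Q p x + σ • c f (C.con p x))
    (hQmem : ∀ j p, ∀ x ∈ C.gr (j + 1 + a), Q p x ∈ C.gr (j + b))
    (hQlow : ∀ k < a, ∀ p, ∀ x ∈ C.gr k, Q p x = 0)
    (hclow : ∀ k < a, ∀ f, ∀ x ∈ C.gr k, c f x = 0)
    (hcmem : ∀ j f, ∀ x ∈ C.gr (j + a), c f x ∈ C.gr (j + b))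
    (hQQ : ∀ p x, C.con p (Q p x) = σ • Q p (C.con p x))
    (hcQ : ∀ f p x, C.con p (c f x) + σ • c f (C.con p x) = Q p (f • x) - f • Q p x) :
    ∃ T : Ω →ₗ[ℝ] Ω, (∀ j, ∀ x ∈ C.gr (j + a), T x ∈ C.gr (j + b)) ∧
      (∀ k < a, ∀ x ∈ C.gr k, T x = 0) ∧ (∀ x ∈ C.gr a, T x = T₀ x) ∧
      (∀ p x, C.con p (T x) + σ • T (C.con p x) = Q p x) ∧
      ∀ (f : K) x, T (f • x) = f • T x + c f x := by
  -- the recursion: `T` is correct up to degree `i + a`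
  have key : ∀ i : ℕ, ∃ T : Ω →ₗ[ℝ] Ω, (∀ j ≤ i, ∀ x ∈ C.gr (j + a), T x ∈ C.gr (j + b)) ∧
      (∀ k < a, ∀ x ∈ C.gr k, T x = 0) ∧ (∀ x ∈ C.gr a, T x = T₀ x) ∧
      (∀ k ≤ i + a, ∀ p, ∀ x ∈ C.gr k, C.con p (T x) + σ • T (C.con p x) = Q p x) ∧
      ∀ k ≤ i + a, ∀ (f : K), ∀ x ∈ C.gr k, T (f • x) = f • T x + c f x := by
    intro i
    induction i with
    | zero =>
      have hT : ∀ x ∈ C.gr a, (T₀ ∘ₗ (C.proj a).restrictScalars ℝ) x = T₀ x := fun x hx => by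
        simp [C.proj_of_mem hx]
      have hT' : ∀ k < a, ∀ x ∈ C.gr k, (T₀ ∘ₗ (C.proj a).restrictScalars ℝ) x = 0 :=
        fun k hk x hx => by simp [C.proj_of_ne hx hk.ne']
      have hTc : ∀ k ≤ a, ∀ p, ∀ x ∈ C.gr k,
          (T₀ ∘ₗ (C.proj a).restrictScalars ℝ) (C.con p x) = 0 := fun k hk p x hx => by
        rcases k with _ | k
        · rw [C.con_zero p hx, map_zero]
        · exact hT' k (by omega) _ (C.con_mem p hx)
      refine ⟨T₀ ∘ₗ (C.proj a).restrictScalars ℝ, fun j hj x hx => ?_, hT', hT, fun k hk p x hx => ?_,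
        fun k hk f x hx => ?_⟩
      · obtain rfl : j = 0 := by omega
        rw [zero_add] at hx ⊢
        rw [hT x hx]
        exact hT₀ x hx
      · rw [zero_add] at hk
        rw [hTc k hk p x hx, smul_zero, add_zero]
        rcases hk.eq_or_lt with rfl | hk
        · rw [hT x hx, hT₀Q p x hx]
        · rw [hT' k hk x hx, map_zero, hQlow k hk p x hx]
      · rw [zero_add] at hk
        rcases hk.eq_or_lt with rfl | hk
        · rw [hT x hx, hT _ (Submodule.smul_mem _ f hx), hT₀c f x hx]
        · rw [hT' k hk x hx, hT' k hk _ (Submodule.smul_mem _ f hx), hclow k hk f x hx]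
          simp
    | succ i ih =>
      obtain ⟨T, hmem, hlow, hzero, hcon, hf⟩ := ih
      -- `S x` solves `con p (S x) = Q p x - σ T (con p x)` in degree `i + a + 1`
      obtain ⟨S, hS⟩ := C.exists_linear_con_eq (k := i + b)
        (fun p => (Q p - σ • (T ∘ₗ (C.con p).restrictScalars ℝ)) ∘ₗ
          (C.proj (i + a + 1)).restrictScalars ℝ) fun x => by
        set y := C.proj (i + a + 1) x with hy
        have hy' : y ∈ C.gr (i + a + 1) := C.proj_mem _ _
        have hcy : ∀ p, C.con p y ∈ C.gr (i + a) := fun p => C.con_mem p hy'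
        obtain ⟨ζ, hζ, hζ'⟩ := C.exists_con_eq (k := i + b)
          { toFun := fun p => Q p y - σ • T (C.con p y)
            map_add' := fun p q => by
              rw [hQadd, map_add, LinearMap.add_apply, map_add, smul_add]
              abel
            map_smul' := fun f p => by
              rw [hQsmul, map_smul, LinearMap.smul_apply, hf _ le_rfl f _ (hcy p),
                RingHom.id_apply, smul_add, smul_sub, smul_comm_real]
              abel }
          (fun p => Submodule.sub_mem _
            (hQmem i p y (by rwa [Nat.add_right_comm]))
            (Submodule.smul_of_tower_mem _ _ (hmem i le_rfl _ (hcy p))))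
          (fun p => by
            have h1 := hcon _ le_rfl p _ (hcy p)
            rw [C.con_con, map_zero, smul_zero, add_zero] at h1
            change C.con p (Q p y - σ • T (C.con p y)) = 0
            rw [map_sub, hQQ, LinearMap.map_smul_of_tower, h1, sub_self])
        exact ⟨ζ, hζ, hζ'⟩
      let T' : Ω →ₗ[ℝ] Ω := T + (S - T) ∘ₗ (C.proj (i + a + 1)).restrictScalars ℝ
      have hT'ne : ∀ k ≤ i + a, ∀ x ∈ C.gr k, T' x = T x := fun k hk x hx => by
        simp [T', C.proj_of_ne hx (show i + a + 1 ≠ k by omega)]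
      have hT'eq : ∀ x ∈ C.gr (i + a + 1), T' x = S x := fun x hx => by
        simp [T', C.proj_of_mem hx]
      have hScon : ∀ x ∈ C.gr (i + a + 1), ∀ p,
          C.con p (S x) = Q p x - σ • T (C.con p x) := fun x hx p => by
        rw [(hS x).2 p]
        simp [C.proj_of_mem hx]
      have hSmem : ∀ x, S x ∈ C.gr (i + b + 1) := fun x => (hS x).1
      refine ⟨T', fun j hj x hx => ?_, fun k hk x hx => ?_, fun x hx => ?_, fun k hk p x hx => ?_,
        fun k hk f x hx => ?_⟩
      · rcases hj.eq_or_lt with rfl | hj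
        · rw [Nat.add_right_comm] at hx ⊢
          rw [hT'eq x hx]
          exact hSmem x
        · rw [hT'ne _ (by omega) x hx]
          exact hmem j (by omega) x hx
      · rw [hT'ne k (by omega) x hx, hlow k hk x hx]
      · rw [hT'ne a (by omega) x hx, hzero x hx]
      · rcases hk.eq_or_lt with rfl | hk
        · rw [Nat.add_right_comm] at hx
          rw [hT'eq x hx, hScon x hx, hT'ne _ le_rfl _ (C.con_mem p hx)]
          abel
        · have hk' : k ≤ i + a := by omega
          rw [hT'ne k hk' x hx]
          rcases k with _ | k
          · have := hcon 0 hk' p x hx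
            rwa [C.con_zero p hx, map_zero] at this ⊢
          · rw [hT'ne k (by omega) _ (C.con_mem p hx), hcon _ hk' p x hx]
      · rcases hk.eq_or_lt with rfl | hk
        · rw [Nat.add_right_comm] at hx
          have hfx := Submodule.smul_mem _ f hx
          rw [hT'eq x hx, hT'eq _ hfx]
          refine C.eq_of_con (k := i + b) (hSmem _)
            (Submodule.add_mem _ (Submodule.smul_mem _ f (hSmem _)) ?_) fun p => ?_
          · have := hcmem (i + 1) f x (by rwa [Nat.add_right_comm])
            rwa [Nat.add_right_comm] at this
          · have h1 := hcQ f p x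
            rw [hScon _ hfx, map_add, (C.con p).map_smul f (S x), hScon x hx, (C.con p).map_smul,
              hf _ le_rfl f _ (C.con_mem p hx), eq_sub_of_add_eq h1, smul_add, smul_sub,
              smul_comm_real]
            abel
        · have hk' : k ≤ i + a := by omega
          rw [hT'ne k hk' x hx, hT'ne k hk' _ (Submodule.smul_mem _ f hx), hf k hk' f x hx]
  obtain ⟨T, hmem, hlow, hzero, hcon, hf⟩ := key n
  refine ⟨T, fun j x hx => ?_, hlow, hzero, fun p => ?_, fun f => ?_⟩
  · rcases le_or_gt j n with hj | hj
    · exact hmem j hj x hx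
    · rw [C.eq_zero_of_lt (by omega) hx, map_zero]
      exact Submodule.zero_mem _
  · refine C.induction_gr (fun x y hx hy => ?_) (by simp) fun k x hx => ?_
    · simp only [map_add, ← hx, ← hy, smul_add]
      abel
    · rcases le_or_gt k n with hk | hk
      · exact hcon k (by omega) p x hx
      · rw [C.eq_zero_of_lt hk hx]
        simp
  · refine C.induction_gr (fun x y hx hy => ?_) (by simp) fun k x hx => ?_
    · simp only [map_add, smul_add, hx, hy]
      abel
    · rcases le_or_gt k n with hk | hk
      · exact hf k (by omega) f x hx
      · rw [C.eq_zero_of_lt hk hx]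
        simp

end ContractionAlgebra

/-! ### Cartan calculus of a Lie-Rinehart algebra -/

/-- A Lie-Rinehart algebra: a Lie algebra `L` over `ℝ` which is a module over `K` and acts on `K`
by derivations. The sections of a Lie algebroid form one over the smooth functions. -/
structure LieRinehart (K L : Type*) [CommRing K] [Algebra ℝ K] [AddCommGroup L] [Module ℝ L]
    [Module K L] where
  /-- the Lie bracket -/
  bracket : L →ₗ[ℝ] L →ₗ[ℝ] L
  /-- the action of `L` on functions -/
  act : L → K →ₗ[ℝ] K
  bracket_self : ∀ X, bracket X X = 0
  jacobi : ∀ X Y Z, bracket X (bracket Y Z) = bracket (bracket X Y) Z + bracket Y (bracket X Z)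
  bracket_smul : ∀ X (f : K) Y, bracket X (f • Y) = f • bracket X Y + act X f • Y
  act_add : ∀ X Y f, act (X + Y) f = act X f + act Y f
  act_smul : ∀ (f : K) X g, act (f • X) g = f * act X g
  act_mul : ∀ X f g, act X (f * g) = act X f * g + f * act X g
  act_bracket : ∀ X Y f, act (bracket X Y) f = act X (act Y f) - act Y (act X f)

namespace LieRinehart

variable {K L : Type*} [CommRing K] [Algebra ℝ K] [AddCommGroup L] [Module ℝ L]
    [Module K L] (A : LieRinehart K L)

theorem bracket_skew (X Y : L) : A.bracket X Y = -A.bracket Y X := by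
  have := A.bracket_self (X + Y)
  simp only [map_add, LinearMap.add_apply, A.bracket_self, zero_add, add_zero] at this
  exact eq_neg_of_add_eq_zero_right this

theorem smul_bracket (f : K) (X Y : L) :
    A.bracket (f • X) Y = f • A.bracket X Y - A.act Y f • X := by
  rw [A.bracket_skew, A.bracket_smul, A.bracket_skew Y X, smul_neg]
  abel

variable {n : ℕ} {M Ω : Type*} [Ring Ω] [Algebra ℝ Ω] [Algebra K Ω] [IsScalarTower ℝ K Ω]
  (C : ContractionAlgebra n M K Ω L)

theorem exists_dFun (f : K) : ∃ ζ ∈ C.gr 1, ∀ X, C.con X ζ = algebraMap K Ω (A.act X f) :=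
  C.exists_con_eq (k := 0)
    { toFun := fun X => algebraMap K Ω (A.act X f)
      map_add' := fun X Y => by rw [A.act_add, map_add]
      map_smul' := fun g X => by
        rw [A.act_smul, map_mul, RingHom.id_apply, ← Algebra.smul_def] }
    (fun X => C.algebraMap_mem _) (fun X => C.con_zero X (C.algebraMap_mem _))

/-- The differential `df` of a function. -/
noncomputable def dFun (f : K) : Ω := (A.exists_dFun C f).choose

theorem dFun_mem (f : K) : A.dFun C f ∈ C.gr 1 := (A.exists_dFun C f).choose_spec.1

theorem con_dFun (X : L) (f : K) : C.con X (A.dFun C f) = algebraMap K Ω (A.act X f) :=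
  (A.exists_dFun C f).choose_spec.2 X

theorem dFun_add (f g : K) : A.dFun C (f + g) = A.dFun C f + A.dFun C g :=
  C.eq_of_con (A.dFun_mem C _) (Submodule.add_mem _ (A.dFun_mem C _) (A.dFun_mem C _)) fun X => by
    simp only [map_add, con_dFun]

theorem dFun_smul (r : ℝ) (f : K) : A.dFun C (r • f) = r • A.dFun C f :=
  C.eq_of_con (A.dFun_mem C _) (Submodule.smul_of_tower_mem _ _ (A.dFun_mem C _)) fun X => by
    rw [con_dFun, (C.con X).map_smul_of_tower, con_dFun, map_smul]
    exact (IsScalarTower.toAlgHom ℝ K Ω).map_smul_of_tower r (A.act X f)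

theorem dFun_mul (f g : K) : A.dFun C (f * g) = f • A.dFun C g + g • A.dFun C f :=
  C.eq_of_con (A.dFun_mem C _) (Submodule.add_mem _ (Submodule.smul_mem _ _ (A.dFun_mem C _))
    (Submodule.smul_mem _ _ (A.dFun_mem C _))) fun X => by
    rw [map_add, map_smul, map_smul, con_dFun, con_dFun, con_dFun, A.act_mul, map_add, map_mul,
      map_mul, Algebra.smul_def, Algebra.smul_def, add_comm, ← map_mul (algebraMap K Ω) g,
      ← map_mul (algebraMap K Ω) (A.act X f), mul_comm g]

/-- The Lie derivative is determined by `L_X f = X f` and by its commutator `[i_p, L_X] = -i_[X, p]`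
with contractions. -/
theorem exists_lie (X : L) : ∃ T : Ω →ₗ[ℝ] Ω, (∀ j, ∀ x ∈ C.gr j, T x ∈ C.gr j) ∧
    (∀ f, T (algebraMap K Ω f) = algebraMap K Ω (A.act X f)) ∧
    (∀ p x, C.con p (T x) = T (C.con p x) - C.con (A.bracket X p) x) ∧
    ∀ (f : K) x, T (f • x) = f • T x + A.act X f • x := by
  obtain ⟨T, h1, -, h2, h3, h4⟩ := C.exists_operator 0 0 (-1)
    ((IsScalarTower.toAlgHom ℝ K Ω).toLinearMap ∘ₗ A.act X ∘ₗ C.aug.restrictScalars ℝ)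
    (fun p => -(C.con (A.bracket X p)).restrictScalars ℝ)
    (fun f => ((Algebra.lsmul ℝ ℝ Ω (A.act X f) : Ω →ₗ[ℝ] Ω)))
    (fun x _ => C.algebraMap_mem _)
    (fun p x hx => by
      have h := C.con_zero p (C.algebraMap_mem (A.act X (C.aug x)))
      have h' := C.con_zero (A.bracket X p) hx
      simp [h, h'])
    (fun f x hx => by
      have h : A.act X f • x = algebraMap K Ω (A.act X f * C.aug x) := by
        rw [map_mul, C.algebraMap_aug hx, Algebra.smul_def]
      have h1 : C.aug (f • x) = f * C.aug x := C.aug.map_smul f x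
      have h2 (g : K) : f • algebraMap K Ω g = algebraMap K Ω (f * g) := by
        rw [map_mul, Algebra.smul_def]
      simp only [LinearMap.comp_apply, LinearMap.restrictScalars_apply, h1, A.act_mul,
        AlgHom.toLinearMap_apply, map_add, IsScalarTower.coe_toAlgHom', Algebra.lsmul_coe, h, h2,
        add_comm])
    (fun p q x => by simp [add_comm])
    (fun f p x => by
      simp only [A.bracket_smul, LinearMap.neg_apply, LinearMap.restrictScalars_apply, map_add,
        LinearMap.add_apply, map_smul, LinearMap.smul_apply, Algebra.lsmul_coe, neg_smul, one_smul,
        smul_neg]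
      abel)
    (fun j p x hx => Submodule.neg_mem _ (C.con_mem _ hx))
    (fun k hk => absurd hk (Nat.not_lt_zero k)) (fun k hk => absurd hk (Nat.not_lt_zero k))
    (fun j f x hx => Submodule.smul_mem _ _ hx)
    (fun p x => by
      simp only [LinearMap.neg_apply, LinearMap.restrictScalars_apply, map_neg, neg_smul, one_smul,
        C.con_anticomm p])
    (fun f p x => by
      simp only [LinearMap.neg_apply, LinearMap.restrictScalars_apply, map_smul, neg_smul, one_smul,
        Algebra.lsmul_coe, smul_neg]
      abel)
  refine ⟨T, h1, fun f => ?_, fun p x => ?_, h4⟩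
  · rw [h2 _ (C.algebraMap_mem f)]
    simp [C.aug_algebraMap]
  · have := h3 p x
    simp only [neg_smul, one_smul, LinearMap.neg_apply, LinearMap.restrictScalars_apply] at this
    rw [← sub_eq_zero] at this ⊢
    rw [← this]
    abel

/-- The Lie derivative `L_X` of forms. -/
noncomputable def lie (X : L) : Ω →ₗ[ℝ] Ω := (A.exists_lie C X).choose

theorem lie_mem (X : L) {j : ℕ} {x : Ω} (hx : x ∈ C.gr j) : A.lie C X x ∈ C.gr j :=
  (A.exists_lie C X).choose_spec.1 j x hx

theorem lie_algebraMap (X : L) (f : K) :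
    A.lie C X (algebraMap K Ω f) = algebraMap K Ω (A.act X f) :=
  (A.exists_lie C X).choose_spec.2.1 f

theorem con_lie (X p : L) (x : Ω) :
    C.con p (A.lie C X x) = A.lie C X (C.con p x) - C.con (A.bracket X p) x :=
  (A.exists_lie C X).choose_spec.2.2.1 p x

theorem lie_smul (X : L) (f : K) (x : Ω) :
    A.lie C X (f • x) = f • A.lie C X x + A.act X f • x :=
  (A.exists_lie C X).choose_spec.2.2.2 f x

theorem lie_of_mem_zero (X : L) {x : Ω} (hx : x ∈ C.gr 0) :
    A.lie C X x = algebraMap K Ω (A.act X (C.aug x)) := by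
  conv_lhs => rw [← C.algebraMap_aug hx]
  rw [lie_algebraMap]

theorem add_lie (X Y : L) (x : Ω) : A.lie C (X + Y) x = A.lie C X x + A.lie C Y x := by
  rw [← sub_eq_zero]
  refine C.eq_zero_of_con_comm 0 0 1 (A.lie C (X + Y) - (A.lie C X + A.lie C Y)) (fun j x hx => ?_)
    (fun k hk => absurd hk (Nat.not_lt_zero k)) (fun _ x hx => ?_) (fun k x hx p => ?_) x
  · exact Submodule.sub_mem _ (A.lie_mem C _ hx)
      (Submodule.add_mem _ (A.lie_mem C _ hx) (A.lie_mem C _ hx))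
  · simp [A.lie_of_mem_zero C _ hx, A.act_add]
  · simp only [LinearMap.sub_apply, LinearMap.add_apply, map_sub, map_add, con_lie, one_smul]
    abel

theorem smul_lie (f : K) (X : L) (x : Ω) :
    A.lie C (f • X) x = f • A.lie C X x + A.dFun C f * C.con X x := by
  rw [← sub_eq_zero]
  refine C.eq_zero_of_con_comm 0 0 1 (A.lie C (f • X) -
    (Algebra.lsmul ℝ ℝ Ω f ∘ₗ A.lie C X +
      LinearMap.mulLeft ℝ (A.dFun C f) ∘ₗ (C.con X).restrictScalars ℝ)) (fun j x hx => ?_)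
    (fun k hk => absurd hk (Nat.not_lt_zero k)) (fun _ x hx => ?_) (fun k x hx p => ?_) x
  · refine Submodule.sub_mem _ (A.lie_mem C _ hx)
      (Submodule.add_mem _ (Submodule.smul_mem _ _ (A.lie_mem C _ hx)) ?_)
    change A.dFun C f * C.con X x ∈ _
    rcases j with _ | j
    · rw [C.con_zero X hx, mul_zero]
      exact Submodule.zero_mem _
    · have := C.mul_mem (A.dFun_mem C f) (C.con_mem X hx)
      rwa [add_comm] at this
  · simp [A.lie_of_mem_zero C _ hx, A.act_smul, C.con_zero X hx, Algebra.smul_def]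
  · simp only [LinearMap.sub_apply, LinearMap.add_apply, map_sub, map_add, con_lie, one_smul,
      LinearMap.comp_apply, Algebra.lsmul_coe, LinearMap.mulLeft_apply, map_smul,
      LinearMap.restrictScalars_apply, A.smul_bracket, LinearMap.smul_apply,
      C.con_mul_one (A.dFun_mem C f), con_dFun, smul_sub, C.con_anticomm p X,
      ← Algebra.smul_def, mul_neg]
    abel

/-- The differential is determined on functions and by Cartan's formula. -/
theorem exists_d : ∃ T : Ω →ₗ[ℝ] Ω, (∀ j, ∀ x ∈ C.gr j, T x ∈ C.gr (j + 1)) ∧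
    (∀ f, T (algebraMap K Ω f) = A.dFun C f) ∧
    (∀ p x, C.con p (T x) = A.lie C p x - T (C.con p x)) ∧
    ∀ (f : K) x, T (f • x) = f • T x + A.dFun C f * x := by
  obtain ⟨T, h1, -, h2, h3, h4⟩ := C.exists_operator 0 1 1
    (⟨⟨A.dFun C, A.dFun_add C⟩, A.dFun_smul C⟩ ∘ₗ C.aug.restrictScalars ℝ)
    (fun p => A.lie C p) (fun f => LinearMap.mulLeft ℝ (A.dFun C f))
    (fun x _ => A.dFun_mem C _)
    (fun p x hx => by rw [A.lie_of_mem_zero C p hx]; exact A.con_dFun C p _)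
    (fun f x hx => by
      have h : ∀ x, (⟨⟨A.dFun C, A.dFun_add C⟩, A.dFun_smul C⟩ ∘ₗ C.aug.restrictScalars ℝ :
        Ω →ₗ[ℝ] Ω) x = A.dFun C (C.aug x) := fun _ => rfl
      rw [h, h, map_smul, smul_eq_mul, dFun_mul, LinearMap.mulLeft_apply]
      conv_rhs => rw [← C.algebraMap_aug hx, C.aug_algebraMap, ← Algebra.commutes,
        ← Algebra.smul_def])
    (fun p q x => A.add_lie C p q x)
    (fun f p x => by rw [smul_lie, one_smul, LinearMap.mulLeft_apply])
    (fun j p x hx => A.lie_mem C _ hx)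
    (fun k hk => absurd hk (Nat.not_lt_zero k)) (fun k hk => absurd hk (Nat.not_lt_zero k))
    (fun j f x hx => by
      have := C.mul_mem (A.dFun_mem C f) hx
      rwa [add_comm] at this)
    (fun p x => by rw [con_lie, A.bracket_self, map_zero, LinearMap.zero_apply, sub_zero, one_smul])
    (fun f p x => by
      rw [LinearMap.mulLeft_apply, LinearMap.mulLeft_apply, C.con_mul_one (A.dFun_mem C f),
        con_dFun, lie_smul, one_smul, Algebra.smul_def (A.act p f)]
      abel)
  refine ⟨T, h1, fun f => ?_, fun p x => ?_, h4⟩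
  · rw [h2 _ (C.algebraMap_mem f)]
    exact congrArg (A.dFun C) (C.aug_algebraMap f)
  · rw [← h3 p x, one_smul, add_sub_cancel_right]

/-- The differential on forms, characterized by Cartan's formula `i_X d + d i_X = L_X`. -/
noncomputable def d : Ω →ₗ[ℝ] Ω := (A.exists_d C).choose

theorem d_mem {j : ℕ} {x : Ω} (hx : x ∈ C.gr j) : A.d C x ∈ C.gr (j + 1) :=
  (A.exists_d C).choose_spec.1 j x hx

theorem d_algebraMap (f : K) : A.d C (algebraMap K Ω f) = A.dFun C f :=
  (A.exists_d C).choose_spec.2.1 f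

theorem con_d (p : L) (x : Ω) : C.con p (A.d C x) = A.lie C p x - A.d C (C.con p x) :=
  (A.exists_d C).choose_spec.2.2.1 p x

theorem d_smul (f : K) (x : Ω) : A.d C (f • x) = f • A.d C x + A.dFun C f * x :=
  (A.exists_d C).choose_spec.2.2.2 f x

theorem lie_one_mul (X : L) {α : Ω} (hα : α ∈ C.gr 1) (x : Ω) :
    A.lie C X (α * x) = A.lie C X α * x + α * A.lie C X x := by
  rw [← sub_eq_zero]
  refine C.eq_zero_of_con_comm 0 1 (-1) (A.lie C X ∘ₗ LinearMap.mulLeft ℝ α -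
    (LinearMap.mulLeft ℝ (A.lie C X α) + LinearMap.mulLeft ℝ α ∘ₗ A.lie C X)) (fun j x hx => ?_)
    (fun k hk => absurd hk (Nat.not_lt_zero k)) (fun h => absurd h one_ne_zero)
    (fun k x hx p => ?_) x
  · have h : ∀ {a b}, a ∈ C.gr 1 → b ∈ C.gr j → a * b ∈ C.gr (j + 1) := fun ha hb =>
      add_comm 1 j ▸ C.mul_mem ha hb
    exact Submodule.sub_mem _ (A.lie_mem C _ (h hα hx))
      (Submodule.add_mem _ (h (A.lie_mem C _ hα) hx) (h hα (A.lie_mem C _ hx)))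
  · have h1 : A.lie C X (C.con p α * x) = C.con p α * A.lie C X x + A.lie C X (C.con p α) * x := by
      rw [C.con_mem_zero hα, ← Algebra.smul_def, lie_smul, lie_algebraMap, Algebra.smul_def,
        Algebra.smul_def]
    simp only [LinearMap.sub_apply, LinearMap.add_apply, LinearMap.comp_apply,
      LinearMap.mulLeft_apply, map_sub, map_add, con_lie, C.con_mul_one hα,
      C.con_mul_one (A.lie_mem C X hα), h1, neg_smul, one_smul, mul_sub, sub_mul]
    abel

theorem d_one_mul {α : Ω} (hα : α ∈ C.gr 1) (x : Ω) :
    A.d C (α * x) = A.d C α * x - α * A.d C x := by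
  rw [← sub_eq_zero]
  refine C.eq_zero_of_con_comm 0 2 1 (A.d C ∘ₗ LinearMap.mulLeft ℝ α -
    (LinearMap.mulLeft ℝ (A.d C α) - LinearMap.mulLeft ℝ α ∘ₗ A.d C)) (fun j x hx => ?_)
    (fun k hk => absurd hk (Nat.not_lt_zero k)) (fun h => absurd h two_ne_zero)
    (fun k x hx p => ?_) x
  · rw [add_zero] at hx
    have h1 := A.d_mem C (C.mul_mem hα hx)
    have h2 := C.mul_mem (A.d_mem C hα) hx
    have h3 := C.mul_mem hα (A.d_mem C hx)
    rw [show 1 + j + 1 = j + 2 by ring] at h1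
    rw [show 1 + 1 + j = j + 2 by ring] at h2
    rw [show 1 + (j + 1) = j + 2 by ring] at h3
    exact Submodule.sub_mem _ h1 (Submodule.sub_mem _ h2 h3)
  · have h1 : A.d C (C.con p α * x) = C.con p α * A.d C x + A.d C (C.con p α) * x := by
      rw [C.con_mem_zero hα, ← Algebra.smul_def, d_smul, d_algebraMap, Algebra.smul_def]
    have h2 : C.con p (A.d C α * x) = C.con p (A.d C α) * x + A.d C α * C.con p x := by
      rw [C.con_mul p x (A.d_mem C hα)]
      simp
    simp only [LinearMap.sub_apply, LinearMap.comp_apply, LinearMap.mulLeft_apply, map_sub, con_d,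
      lie_one_mul A C p hα, C.con_mul_one hα, h1, h2, one_smul, mul_sub, sub_mul]
    abel

theorem lie_lie (X Y : L) (x : Ω) :
    A.lie C (A.bracket X Y) x = A.lie C X (A.lie C Y x) - A.lie C Y (A.lie C X x) := by
  rw [← sub_eq_zero]
  refine C.eq_zero_of_con_comm 0 0 1 (A.lie C (A.bracket X Y) -
    (A.lie C X ∘ₗ A.lie C Y - A.lie C Y ∘ₗ A.lie C X)) (fun j x hx => ?_)
    (fun k hk => absurd hk (Nat.not_lt_zero k)) (fun _ x hx => ?_) (fun k x hx p => ?_) x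
  · exact Submodule.sub_mem _ (A.lie_mem C _ hx) (Submodule.sub_mem _
      (A.lie_mem C _ (A.lie_mem C _ hx)) (A.lie_mem C _ (A.lie_mem C _ hx)))
  · simp only [LinearMap.sub_apply, LinearMap.comp_apply, A.lie_of_mem_zero C _ hx,
      lie_algebraMap, A.act_bracket, map_sub, sub_self]
  · simp only [LinearMap.sub_apply, LinearMap.comp_apply, map_sub, con_lie, one_smul,
      A.jacobi X Y p, LinearMap.add_apply, map_add]
    abel

theorem lie_d (X : L) (x : Ω) : A.lie C X (A.d C x) = A.d C (A.lie C X x) := by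
  rw [← sub_eq_zero]
  refine C.eq_zero_of_con_comm 0 1 (-1) (A.lie C X ∘ₗ A.d C - A.d C ∘ₗ A.lie C X)
    (fun j x hx => ?_) (fun k hk => absurd hk (Nat.not_lt_zero k)) (fun h => absurd h one_ne_zero)
    (fun k x hx p => ?_) x
  · exact Submodule.sub_mem _ (A.lie_mem C _ (A.d_mem C hx)) (A.d_mem C (A.lie_mem C _ hx))
  · simp only [LinearMap.sub_apply, LinearMap.comp_apply, map_sub, con_lie, con_d, neg_smul,
      one_smul, lie_lie]
    abel

theorem d_d (x : Ω) : A.d C (A.d C x) = 0 := by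
  refine C.eq_zero_of_con_comm 0 2 1 (A.d C ∘ₗ A.d C)
    (fun j x hx => A.d_mem C (A.d_mem C hx)) (fun k hk => absurd hk (Nat.not_lt_zero k))
    (fun h => absurd h two_ne_zero) (fun k x hx p => ?_) x
  simp only [LinearMap.comp_apply, con_d, lie_d, one_smul, map_sub]
  abel

end LieRinehart

/-! ### Forms acting on multivectors -/

/-- The algebraic shadow of a vector bundle of rank `n`, with sections `L`, forms `Ω` and
multivectors `Ω'`: both are graded algebras with contractions, and the contractions of multivectors
with one-forms extend to contractions `I η` with arbitrary forms. -/
structure ContractionPair (n : ℕ) (M K L Ω Ω' : Type*) [CommRing K] [Algebra ℝ K]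
    [AddCommGroup L] [Module K L] [Ring Ω] [Algebra ℝ Ω] [Algebra K Ω]
    [Ring Ω'] [Algebra ℝ Ω'] [Algebra K Ω'] where
  /-- the algebra of forms, contracted with sections -/
  form : ContractionAlgebra n M K Ω L
  /-- the algebra of multivectors, contracted with one-forms -/
  vec : ContractionAlgebra n M K Ω' (form.gr 1)
  cut_eq : vec.cut = form.cut
  /-- the contraction of multivectors with forms -/
  I : Ω →ₗ[K] Ω' →ₗ[K] Ω'
  I_one : ∀ U, I 1 U = U
  I_mul : ∀ η ξ U, I (η * ξ) U = I ξ (I η U)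
  I_one_form : ∀ (α : form.gr 1) U, I α U = vec.con α U
  /-- sections as multivectors of degree one -/
  ofL : L →ₗ[K] Ω'
  /-- the component of degree one of a multivector, as a section -/
  toL : Ω' →ₗ[K] L
  ofL_mem : ∀ X, ofL X ∈ vec.gr 1
  toL_ofL : ∀ X, toL (ofL X) = X
  ofL_toL : ∀ {U : Ω'}, U ∈ vec.gr 1 → ofL (toL U) = U
  I_ofL : ∀ α ∈ form.gr 1, ∀ X, I α (ofL X) = algebraMap K Ω' (form.aug (form.con X α))

namespace ContractionPair

variable {n : ℕ} {M K L Ω Ω' : Type*} [CommRing K] [Algebra ℝ K]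
    [AddCommGroup L] [Module K L] [Ring Ω] [Algebra ℝ Ω] [Algebra K Ω]
    [Ring Ω'] [Algebra ℝ Ω'] [Algebra K Ω'] (S : ContractionPair n M K L Ω Ω')

theorem I_algebraMap (f : K) (U : Ω') : S.I (algebraMap K Ω f) U = f • U := by
  rw [Algebra.algebraMap_eq_smul_one, map_smul, LinearMap.smul_apply, I_one]

omit [Algebra ℝ K] [Algebra ℝ Ω'] in
theorem commute_algebraMap (f : K) (U : Ω') : U * algebraMap K Ω' f = f • U := by
  rw [← Algebra.commutes, Algebra.smul_def]

theorem I_one_mul {α : Ω} (hα : α ∈ S.form.gr 1) {k : ℕ} {U : Ω'} (hU : U ∈ S.vec.gr k) (V : Ω') :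
    S.I α (U * V) = S.I α U * V + (-1 : ℝ) ^ k • (U * S.I α V) := by
  simp only [S.I_one_form ⟨α, hα⟩]
  exact S.vec.con_mul _ _ hU

theorem I_one_ofL_mul {α : Ω} (hα : α ∈ S.form.gr 1) (X : L) (V : Ω') :
    S.I α (S.ofL X * V) = S.form.aug (S.form.con X α) • V - S.ofL X * S.I α V := by
  rw [S.I_one_mul hα (S.ofL_mem X), S.I_ofL α hα, ← Algebra.smul_def, pow_one, neg_smul, one_smul,
    sub_eq_add_neg]

theorem I_one_mem {α : Ω} (hα : α ∈ S.form.gr 1) {k : ℕ} {U : Ω'} (hU : U ∈ S.vec.gr (k + 1)) :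
    S.I α U ∈ S.vec.gr k := by
  rw [S.I_one_form ⟨α, hα⟩]
  exact S.vec.con_mem _ hU

theorem I_one_zero {α : Ω} (hα : α ∈ S.form.gr 1) {U : Ω'} (hU : U ∈ S.vec.gr 0) :
    S.I α U = 0 := by
  rw [S.I_one_form ⟨α, hα⟩]
  exact S.vec.con_zero _ hU

variable [IsScalarTower ℝ K Ω] [IsScalarTower ℝ K Ω']

theorem I_real_smul (r : ℝ) (η : Ω) (U : Ω') : S.I (r • η) U = r • S.I η U := by
  rw [S.I.map_smul_of_tower, LinearMap.smul_apply]

/-- The contraction with a `p`-form lowers degrees by `p`, and vanishes in degrees less than `p`. -/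
theorem I_mem_and_zero {p : ℕ} {η : Ω} (hη : η ∈ S.form.gr p) :
    (∀ k, ∀ U ∈ S.vec.gr (k + p), S.I η U ∈ S.vec.gr k) ∧
      ∀ k < p, ∀ U ∈ S.vec.gr k, S.I η U = 0 := by
  refine S.form.local_induction (Q := fun p η =>
    (∀ k, ∀ U ∈ S.vec.gr (k + p), S.I η U ∈ S.vec.gr k) ∧
      ∀ k < p, ∀ U ∈ S.vec.gr k, S.I η U = 0) (fun f => ⟨fun k U hU => ?_, fun k hk => ?_⟩)
    (fun p α hα η hη ih => ⟨fun k U hU => ?_, fun k hk U hU => ?_⟩) (fun p => ?_)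
    (fun p a b ha hb => ⟨fun k U hU => ?_, fun k hk U hU => ?_⟩)
    (fun p r a ha => ⟨fun k U hU => ?_, fun k hk U hU => ?_⟩)
    (fun p η hη ih => ⟨fun k U hU => ?_, fun k hk U hU => ?_⟩) hη
  · rw [I_algebraMap]
    exact Submodule.smul_mem _ _ hU
  · exact absurd hk (Nat.not_lt_zero k)
  · rw [I_mul]
    exact ih.1 k _ (S.I_one_mem hα hU)
  · rw [I_mul]
    rcases k with _ | k
    · rw [S.I_one_zero hα hU, map_zero]
    · exact ih.2 k (by omega) _ (S.I_one_mem hα hU)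
  · simp
  · rw [map_add, LinearMap.add_apply]
    exact Submodule.add_mem _ (ha.1 k U hU) (hb.1 k U hU)
  · rw [map_add, LinearMap.add_apply, ha.2 k hk U hU, hb.2 k hk U hU, add_zero]
  · rw [I_real_smul]
    exact Submodule.smul_of_tower_mem _ _ (ha.1 k U hU)
  · rw [I_real_smul, ha.2 k hk U hU, smul_zero]
  · refine S.vec.mem_of_cut_smul_mem fun m => ?_
    rw [S.cut_eq, ← LinearMap.smul_apply, ← map_smul]
    exact (ih m).1 k U hU
  · refine S.vec.faithful _ fun m => ?_
    rw [S.cut_eq, ← LinearMap.smul_apply, ← map_smul]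
    exact (ih m).2 k hk U hU

theorem I_mem {p k : ℕ} {η : Ω} (hη : η ∈ S.form.gr p) {U : Ω'} (hU : U ∈ S.vec.gr (k + p)) :
    S.I η U ∈ S.vec.gr k := (S.I_mem_and_zero hη).1 k U hU

theorem I_eq_zero {p k : ℕ} {η : Ω} (hη : η ∈ S.form.gr p) {U : Ω'} (hU : U ∈ S.vec.gr k)
    (hk : k < p) : S.I η U = 0 := (S.I_mem_and_zero hη).2 k hk U hU

theorem I_comm {p q : ℕ} {η ξ : Ω} (hη : η ∈ S.form.gr p) (hξ : ξ ∈ S.form.gr q) (U : Ω') :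
    S.I η (S.I ξ U) = (-1 : ℝ) ^ (p * q) • S.I ξ (S.I η U) := by
  rw [← I_mul, ← I_mul, S.form.mul_comm' hξ hη, I_real_smul, mul_comm q p]

/-- Forms of even degree commute with one-forms. -/
theorem I_two_comm {ξ α : Ω} (hξ : ξ ∈ S.form.gr 2) (hα : α ∈ S.form.gr 1) (U : Ω') :
    S.I α (S.I ξ U) = S.I ξ (S.I α U) := by
  rw [S.I_comm hα hξ]
  simp

/-- The contraction with a form and the product with a section are dual to each other. -/
theorem I_ofL_mul (X : L) {p : ℕ} {η : Ω} (hη : η ∈ S.form.gr p) (U : Ω') :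
    S.I η (S.ofL X * U) = S.I (S.form.con X η) U + (-1 : ℝ) ^ p • (S.ofL X * S.I η U) := by
  refine S.form.local_induction (Q := fun p η => ∀ U, S.I η (S.ofL X * U) =
    S.I (S.form.con X η) U + (-1 : ℝ) ^ p • (S.ofL X * S.I η U)) (fun f U => ?_)
    (fun p α hα η hη ih U => ?_) (fun p U => ?_) (fun p a b ha hb U => ?_) (fun p r a ha U => ?_)
    (fun p η hη ih U => ?_) hη U
  · rw [I_algebraMap, I_algebraMap, S.form.con_zero X (S.form.algebraMap_mem f)]
    simp
  · have h1 : S.I (S.form.con X α * η) U = S.form.aug (S.form.con X α) • S.I η U := by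
      rw [S.form.con_mem_zero hα, ← Algebra.smul_def, map_smul, LinearMap.smul_apply,
        S.form.aug_algebraMap]
    rw [I_mul, S.I_one_ofL_mul hα, map_sub, map_smul, ih, S.form.con_mul_one hα, map_sub,
      LinearMap.sub_apply, h1, I_mul, I_mul, pow_succ, mul_neg_one, neg_smul]
    abel
  · simp
  · simp only [map_add, LinearMap.add_apply, ha, hb, mul_add, smul_add]
    abel
  · rw [(S.form.con X).map_smul_of_tower]
    simp only [I_real_smul, ha, smul_add, mul_smul_comm, smul_comm r ((-1 : ℝ) ^ p)]
  · rw [← sub_eq_zero]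
    refine S.vec.faithful _ fun m => ?_
    have := ih m U
    simp only [map_smul, LinearMap.smul_apply, mul_smul_comm] at this
    rw [S.cut_eq, smul_sub, smul_add, this, smul_comm _ ((-1 : ℝ) ^ p), sub_self]

/-- Contractions with two-forms are differential operators of order two: the operator
`V ↦ ξ ⌟ (U ∧ V) - U ∧ (ξ ⌟ V) - (ξ ⌟ U) ∧ V` is a derivation. -/
theorem I_two_mul_mul {ξ : Ω} (hξ : ξ ∈ S.form.gr 2) {u v : ℕ} {U V : Ω'} (hU : U ∈ S.vec.gr u)
    (hV : V ∈ S.vec.gr v) (W : Ω') :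
    S.I ξ (U * V * W) = S.I ξ (U * V) * W + U * S.I ξ (V * W) - S.I ξ U * V * W
      - U * S.I ξ V * W - U * V * S.I ξ W + (-1 : ℝ) ^ (u * v) • (V * S.I ξ (U * W)) := by
  refine S.form.local_induction (Q := fun p ξ => p = 2 → S.I ξ (U * V * W) =
      S.I ξ (U * V) * W + U * S.I ξ (V * W) - S.I ξ U * V * W
      - U * S.I ξ V * W - U * V * S.I ξ W + (-1 : ℝ) ^ (u * v) • (V * S.I ξ (U * W))) (fun f h => ?_)
    (fun p α hα β hβ ih h => ?_) (fun p _ => ?_) (fun p a b ha hb h => ?_) (fun p r a ha h => ?_)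
    (fun p η hη ih h => ?_) hξ rfl
  · omega
  · obtain rfl : p = 1 := by omega
    have hc1 : ∀ Y, V * U * Y = (-1 : ℝ) ^ (v * u) • (U * V * Y) := fun Y => by
      rw [S.vec.mul_comm' hV hU, smul_mul_assoc]
    have hc2 : ∀ Y, V * (S.I α U * Y) = (-1 : ℝ) ^ (v * (u + 1)) • (S.I α U * V * Y) := fun Y => by
      rcases u with _ | u
      · rw [S.I_one_zero hα hU]
        simp
      · rw [← mul_assoc, S.vec.mul_comm' hV (S.I_one_mem hα hU), smul_mul_assoc,
          show v * (u + 1 + 1) = v * u + 2 * v by ring, pow_add, pow_mul _ 2 v, neg_one_sq, one_pow,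
          mul_one]
    have hc3 : ∀ Y, V * (S.I β U * Y) = (-1 : ℝ) ^ (v * (u + 1)) • (S.I β U * V * Y) := fun Y => by
      rcases u with _ | u
      · rw [S.I_one_zero hβ hU]
        simp
      · rw [← mul_assoc, S.vec.mul_comm' hV (S.I_one_mem hβ hU), smul_mul_assoc,
          show v * (u + 1 + 1) = v * u + 2 * v by ring, pow_add, pow_mul _ 2 v, neg_one_sq, one_pow,
          mul_one]
    have hc4 : ∀ Y, V * (S.I β (S.I α U) * Y) =
        (-1 : ℝ) ^ (v * u) • (S.I β (S.I α U) * V * Y) := fun Y => by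
      rcases u with _ | _ | u
      · rw [S.I_one_zero hα hU]
        simp
      · rw [S.I_one_zero hβ (S.I_one_mem hα hU)]
        simp
      · rw [← mul_assoc, S.vec.mul_comm' hV (S.I_one_mem hβ (S.I_one_mem hα hU)), smul_mul_assoc,
          show v * (u + 1 + 1) = v * u + 2 * v by ring, pow_add, pow_mul _ 2 v, neg_one_sq, one_pow,
          mul_one]
    have hI1 : ∀ (γ : Ω) (hγ : γ ∈ S.form.gr 1) (δ : Ω) (hδ : δ ∈ S.form.gr 1) (k : ℕ) (Y : Ω')
        (hY : Y ∈ S.vec.gr k) (Z : Ω'), S.I γ (S.I δ Y * Z) =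
          S.I γ (S.I δ Y) * Z - (-1 : ℝ) ^ k • (S.I δ Y * S.I γ Z) := fun γ hγ δ hδ k Y hY Z => by
      rcases k with _ | k
      · rw [S.I_one_zero hδ hY]
        simp
      · rw [S.I_one_mul hγ (S.I_one_mem hδ hY), pow_succ]
        simp
    have hsm : ∀ (γ : Ω) (k : ℕ) (Y : Ω'),
        S.I γ ((-1 : ℝ) ^ k • Y) = (-1 : ℝ) ^ k • S.I γ Y := fun γ k Y =>
      LinearMap.map_smul_of_tower _ _ _
    simp only [I_mul]
    simp only [S.I_one_mul hα hU, S.I_one_mul hα hV, S.I_one_mul hβ hU, S.I_one_mul hβ hV,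
      map_add, hsm, hI1 β hβ α hα u U hU, mul_assoc,
      hI1 β hβ α hα v V hV]
    simp only [← mul_assoc V U, hc1, hc2, hc3, hc4, mul_add, add_mul, mul_sub, sub_mul,
      mul_smul_comm, smul_mul_assoc, pow_add, pow_mul, mul_one]
    rcases neg_one_pow_eq_or ℝ u with hu | hu <;> rcases neg_one_pow_eq_or ℝ v with hv | hv <;>
    · simp only [hu, hv, one_pow, neg_smul, one_smul, mul_one, mul_neg, neg_neg, mul_assoc]
      abel
  · simp
  · simp only [map_add, LinearMap.add_apply, ha h, hb h, mul_add, add_mul, smul_add]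
    abel
  · have h' := congrArg (r • ·) (ha h)
    simp only [I_real_smul, smul_add, smul_sub, mul_smul_comm, smul_mul_assoc] at h' ⊢
    rw [h']
    simp only [smul_comm r ((-1 : ℝ) ^ (u * v))]
  · rw [← sub_eq_zero]
    refine S.vec.faithful _ fun m => ?_
    have h' := sub_eq_zero.2 (ih m h)
    rw [← h', S.cut_eq]
    simp only [map_smul, LinearMap.smul_apply, smul_add, smul_sub, mul_smul_comm, smul_mul_assoc,
      smul_comm _ ((-1 : ℝ) ^ (u * v))]

/-- Contraction of an element of top degree with a form of complementary degree. -/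
theorem mul_I_top {p : ℕ} {η : Ω} (hη : η ∈ S.form.gr p) {V Λ : Ω'} (hV : V ∈ S.vec.gr p)
    (hΛ : Λ ∈ S.vec.gr n) : V * S.I η Λ = S.I η V * Λ := by
  refine S.vec.local_induction (Q := fun p V => ∀ η ∈ S.form.gr p, V * S.I η Λ = S.I η V * Λ)
    (fun f η hη => ?_) (fun p X hX V hV ih η hη => ?_) (fun p η hη => ?_)
    (fun p a b ha hb η hη => ?_) (fun p r a ha η hη => ?_) (fun p V hV ih η hη => ?_) hV η hη
  · rw [← S.form.algebraMap_aug hη, I_algebraMap, I_algebraMap, smul_mul_assoc, mul_smul_comm]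
  · rw [S.vec.mul_comm' hX hV, smul_mul_assoc, mul_assoc, LinearMap.map_smul_of_tower,
      smul_mul_assoc]
    -- move the last factor of `V ∧ X` past the contraction
    have h1 := S.I_ofL_mul (S.toL X) hη Λ
    rw [S.ofL_toL hX, S.vec.eq_zero_of_lt (by omega : n < 1 + n) (S.vec.mul_mem hX hΛ), map_zero] at h1
    have h2 := S.I_ofL_mul (S.toL X) hη V
    rw [S.ofL_toL hX, S.I_eq_zero hη hV (Nat.lt_succ_self p), mul_zero, smul_zero, add_zero] at h2
    have h3 := ih _ (S.form.con_mem (S.toL X) hη)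
    have h4 : X * S.I η Λ = (-1 : ℝ) ^ p • S.I (S.form.con (S.toL X) η) Λ := by
      have := eq_neg_of_add_eq_zero_left h1.symm
      rw [this, smul_neg, smul_smul, ← pow_add, show p + (p + 1) = 2 * p + 1 by ring, pow_succ,
        pow_mul]
      simp
    have h5 : V * X = (-1 : ℝ) ^ (p * 1) • (X * V) := S.vec.mul_comm' hV hX
    rw [h4, h5, LinearMap.map_smul_of_tower, h2, mul_smul_comm, h3, mul_one, smul_mul_assoc]
  · simp
  · simp only [add_mul, map_add, ha η hη, hb η hη]
  · simp only [smul_mul_assoc, LinearMap.map_smul_of_tower, ha η hη]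
  · rw [← sub_eq_zero]
    refine S.vec.faithful _ fun m => ?_
    rw [smul_sub, sub_eq_zero, ← smul_mul_assoc, ← smul_mul_assoc, ← map_smul]
    exact ih m η hη

/-- Elements of top degree are proportional to each other. -/
theorem aug_smul_top {μ : Ω} (hμ : μ ∈ S.form.gr n) {Λ Λ' : Ω'} (hΛ : Λ ∈ S.vec.gr n)
    (hΛ' : Λ' ∈ S.vec.gr n) :
    S.vec.aug (S.I μ Λ) • Λ' = S.vec.aug (S.I μ Λ') • Λ := by
  have h : ∀ {Λ}, Λ ∈ S.vec.gr n → S.I μ Λ = algebraMap K Ω' (S.vec.aug (S.I μ Λ)) := fun hΛ =>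
    (S.vec.algebraMap_aug (S.I_mem hμ (by simpa using hΛ))).symm
  have := S.mul_I_top hμ hΛ' hΛ
  rw [h hΛ, h hΛ', commute_algebraMap, ← Algebra.smul_def] at this
  exact this

end ContractionPair

/-! ### The operator of a divergence -/

/-- A divergence on a Lie-Rinehart algebra: an `ℝ`-linear map `L → K` with
`div (f X) = f div X - X f`. -/
structure LieRinehart.Divergence {K L : Type*} [CommRing K] [Algebra ℝ K] [AddCommGroup L]
    [Module ℝ L] [Module K L] (A : LieRinehart K L) where
  /-- the underlying map -/
  div : L →ₗ[ℝ] K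
  div_smul : ∀ (f : K) X, div (f • X) = f * div X - A.act X f

namespace ContractionPair

variable {n : ℕ} {M K L Ω Ω' : Type*} [CommRing K] [Algebra ℝ K]
    [AddCommGroup L] [Module K L] [Module ℝ L] [IsScalarTower ℝ K L]
    [Ring Ω] [Algebra ℝ Ω] [Algebra K Ω] [Ring Ω'] [Algebra ℝ Ω'] [Algebra K Ω']
    [IsScalarTower ℝ K Ω] [IsScalarTower ℝ K Ω']
    (S : ContractionPair n M K L Ω Ω') {A : LieRinehart K L} (δ : A.Divergence)

/-- The operator is constructed by recursion on the degree. The recursion is consistent since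
`i_{dα}` commutes with `i_α`. -/
theorem exists_operator_of_divergence : ∃ D : Ω' →ₗ[ℝ] Ω',
    (∀ j, ∀ U ∈ S.vec.gr (j + 1), D U ∈ S.vec.gr j) ∧ (∀ U ∈ S.vec.gr 0, D U = 0) ∧
    (∀ X, D (S.ofL X) = algebraMap K Ω' (δ.div X)) ∧
    (∀ α ∈ S.form.gr 1, ∀ U, S.I α (D U) = S.I (A.d S.form α) U - D (S.I α U)) ∧
    ∀ (f : K) U, D (f • U) = f • D U - S.I (A.dFun S.form f) U := by
  have hd : ∀ α : S.form.gr 1, A.d S.form α ∈ S.form.gr 2 := fun α => A.d_mem _ α.2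
  have hdf : ∀ f, A.dFun S.form f ∈ S.form.gr 1 := A.dFun_mem S.form
  have hsq : ∀ (f : K) (α : S.form.gr 1) (x : Ω'), S.I (A.dFun S.form f) (S.I α x) =
      -S.I α (S.I (A.dFun S.form f) x) := fun f α x => by
    rw [S.I_comm (hdf f) α.2, mul_one, pow_one, neg_smul, one_smul]
  obtain ⟨D, h1, h2, h3, h4, h5⟩ := S.vec.exists_operator 1 0 1
    ((IsScalarTower.toAlgHom ℝ K Ω').toLinearMap ∘ₗ δ.div ∘ₗ S.toL.restrictScalars ℝ)
    (fun α => (S.I (A.d S.form α)).restrictScalars ℝ)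
    (fun f => -(S.I (A.dFun S.form f)).restrictScalars ℝ)
    (fun x _ => S.vec.algebraMap_mem _)
    (fun p x hx => (S.vec.con_zero p (S.vec.algebraMap_mem _)).trans
      (S.I_eq_zero (hd p) hx one_lt_two).symm)
    (fun f x hx => by
      have h := S.I_ofL _ (hdf f) (S.toL x)
      rw [S.ofL_toL hx, A.con_dFun, S.form.aug_algebraMap] at h
      have h' : δ.div (S.toL (f • x)) = f * δ.div (S.toL x) - A.act (S.toL x) f := by
        rw [map_smul, δ.div_smul]
      have h'' (g : K) : f • algebraMap K Ω' g = algebraMap K Ω' (f * g) := by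
        rw [map_mul, Algebra.smul_def]
      simp only [LinearMap.comp_apply, LinearMap.restrictScalars_apply, LinearMap.neg_apply, h, h',
        AlgHom.toLinearMap_apply, IsScalarTower.coe_toAlgHom', map_add, map_neg, h'',
        sub_eq_add_neg])
    (fun p q x => by simp)
    (fun f α x => by
      have h : S.I (A.dFun S.form f * α) x = -S.I (A.dFun S.form f) (S.I α x) := by
        rw [S.I_mul, hsq, neg_neg]
      simp only [Submodule.coe_smul, A.d_smul, map_add, map_smul, LinearMap.add_apply,
        LinearMap.smul_apply, LinearMap.restrictScalars_apply, LinearMap.neg_apply, one_smul,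
        ← S.I_one_form, h])
    (fun j α x hx => S.I_mem (hd α) hx)
    (fun k hk α x hx => S.I_eq_zero (hd α) hx (by omega))
    (fun k hk f x hx => by
      rw [LinearMap.neg_apply, LinearMap.restrictScalars_apply, S.I_eq_zero (hdf f) hx hk, neg_zero])
    (fun j f x hx => Submodule.neg_mem _ (S.I_mem (hdf f) hx))
    (fun α x => by
      simp only [LinearMap.restrictScalars_apply, one_smul, ← S.I_one_form]
      exact S.I_two_comm (hd α) α.2 x)
    (fun f α x => by
      simp only [LinearMap.neg_apply, LinearMap.restrictScalars_apply, map_neg, one_smul,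
        ← S.I_one_form, map_smul, sub_self, hsq, neg_neg, neg_add_cancel])
  refine ⟨D, h1, fun U hU => h2 0 one_pos U hU, fun X => ?_, fun α hα U => ?_, fun f U => ?_⟩
  · rw [h3 _ (S.ofL_mem X)]
    simp [S.toL_ofL]
  · have := h4 ⟨α, hα⟩ U
    rw [one_smul, ← S.I_one_form, ← S.I_one_form] at this
    exact eq_sub_of_add_eq this
  · rw [h5, LinearMap.neg_apply, LinearMap.restrictScalars_apply, sub_eq_add_neg]

/-- The operator of degree `-1` on multivectors defined by a divergence: it extends the divergence
and anticommutes with the contraction with a one-form `α` up to the contraction with `dα`. -/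
noncomputable def divOp : Ω' →ₗ[ℝ] Ω' := (S.exists_operator_of_divergence δ).choose

theorem divOp_mem {j : ℕ} {U : Ω'} (hU : U ∈ S.vec.gr (j + 1)) : S.divOp δ U ∈ S.vec.gr j :=
  (S.exists_operator_of_divergence δ).choose_spec.1 j U hU

theorem divOp_zero {U : Ω'} (hU : U ∈ S.vec.gr 0) : S.divOp δ U = 0 :=
  (S.exists_operator_of_divergence δ).choose_spec.2.1 U hU

theorem divOp_ofL (X : L) : S.divOp δ (S.ofL X) = algebraMap K Ω' (δ.div X) :=
  (S.exists_operator_of_divergence δ).choose_spec.2.2.1 X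

theorem I_one_divOp {α : Ω} (hα : α ∈ S.form.gr 1) (U : Ω') :
    S.I α (S.divOp δ U) = S.I (A.d S.form α) U - S.divOp δ (S.I α U) :=
  (S.exists_operator_of_divergence δ).choose_spec.2.2.2.1 α hα U

theorem divOp_smul (f : K) (U : Ω') :
    S.divOp δ (f • U) = f • S.divOp δ U - S.I (A.dFun S.form f) U :=
  (S.exists_operator_of_divergence δ).choose_spec.2.2.2.2 f U

/-- The operator of a divergence intertwines the contractions with a form and with its
differential. -/
theorem divOp_I {p : ℕ} {η : Ω} (hη : η ∈ S.form.gr p) (U : Ω') :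
    S.divOp δ (S.I η U) =
      (-1 : ℝ) ^ p • (S.I η (S.divOp δ U) - S.I (A.d S.form η) U) := by
  refine S.form.local_induction (Q := fun p η => ∀ U, S.divOp δ (S.I η U) =
      (-1 : ℝ) ^ p • (S.I η (S.divOp δ U) - S.I (A.d S.form η) U)) (fun f U => ?_)
    (fun p α hα η hη ih U => ?_) (fun p U => ?_) (fun p a b ha hb U => ?_) (fun p r a ha U => ?_)
    (fun p η hη ih U => ?_) hη U
  · rw [S.I_algebraMap, S.I_algebraMap, divOp_smul, A.d_algebraMap, pow_zero, one_smul]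
  · rw [S.I_mul, S.I_mul, ih, S.I_one_divOp δ hα, A.d_one_mul S.form hα, map_sub, map_sub,
      LinearMap.sub_apply, S.I_mul, S.I_mul, S.I_comm hη (A.d_mem _ hα)]
    rw [show p * (1 + 1) = 2 * p by ring, pow_mul, neg_one_sq, one_pow, one_smul, pow_succ,
      mul_neg_one, neg_smul, ← smul_neg]
    congr 1
    abel
  · simp
  · simp only [map_add, LinearMap.add_apply, ha, hb, smul_sub, smul_add]
    abel
  · simp only [map_smul, S.I_real_smul, ha, ← smul_sub, smul_comm r ((-1 : ℝ) ^ p)]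
  · rw [← sub_eq_zero]
    refine S.vec.faithful _ fun m => ?_
    have h := ih m U
    simp only [map_smul, LinearMap.smul_apply, divOp_smul, A.d_smul, map_add, LinearMap.add_apply,
      S.I_mul] at h
    rw [S.I_comm (A.dFun_mem _ _) hη, one_mul] at h
    rw [S.cut_eq, smul_sub, sub_eq_zero, smul_comm _ ((-1 : ℝ) ^ p), eq_add_of_sub_eq h]
    simp only [smul_sub, smul_add]
    abel

/-- The square of the operator of a divergence commutes with contractions. -/
theorem divOp_divOp_I {α : Ω} (hα : α ∈ S.form.gr 1) (U : Ω') :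
    S.divOp δ (S.divOp δ (S.I α U)) = S.I α (S.divOp δ (S.divOp δ U)) := by
  have h2 := A.d_mem S.form hα
  simp only [S.divOp_I δ hα, S.divOp_I δ h2, map_sub, A.d_d, pow_one, neg_smul, one_smul,
    map_neg, map_zero, LinearMap.zero_apply, sub_zero, Nat.reduceAdd, neg_one_sq]
  abel

theorem divOp_divOp_smul (f : K) (U : Ω') :
    S.divOp δ (S.divOp δ (f • U)) = f • S.divOp δ (S.divOp δ U) := by
  rw [S.divOp_smul, map_sub, S.divOp_smul, S.divOp_I δ (A.dFun_mem _ f), ← A.d_algebraMap,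
    A.d_d, map_zero, LinearMap.zero_apply, pow_one, neg_smul, one_smul]
  abel

/-- The operator of a divergence is a differential operator of order two. -/
theorem divOp_mul_mul {u v w : ℕ} {U V W : Ω'} (hU : U ∈ S.vec.gr u) (hV : V ∈ S.vec.gr v)
    (hW : W ∈ S.vec.gr w) :
    S.divOp δ (U * V * W) = S.divOp δ (U * V) * W + (-1 : ℝ) ^ u • (U * S.divOp δ (V * W))
      + (-1 : ℝ) ^ ((u + 1) * v) • (V * S.divOp δ (U * W)) - S.divOp δ U * V * W
      - (-1 : ℝ) ^ u • (U * S.divOp δ V * W)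
      - (-1 : ℝ) ^ (u + v) • (U * V * S.divOp δ W) := by
  set D := S.divOp δ with hD
  have h00 : ∀ {a b}, a ∈ S.vec.gr 0 → b ∈ S.vec.gr 0 → a * b ∈ S.vec.gr 0 := fun ha hb =>
    S.vec.mul_mem ha hb
  -- the case in which two of the three factors are functions
  have hfun : ∀ (f g : K) (X : Ω'), D ((f * g) • X) = f • D (g • X) + g • D (f • X)
      - (f * g) • D X := fun f g X => by
    simp only [hD, divOp_smul, map_smul, smul_sub, mul_smul, smul_comm g f]
    abel
  obtain ⟨N, hN⟩ : ∃ N, N = u + v + w := ⟨_, rfl⟩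
  induction N generalizing u v w U V W with
  | zero =>
    obtain ⟨rfl, rfl, rfl⟩ : u = 0 ∧ v = 0 ∧ w = 0 := by omega
    rw [S.divOp_zero δ (h00 (h00 hU hV) hW), S.divOp_zero δ (h00 hU hV),
      S.divOp_zero δ (h00 hV hW), S.divOp_zero δ (h00 hU hW), S.divOp_zero δ hU,
      S.divOp_zero δ hV, S.divOp_zero δ hW]
    simp
  | succ N ih =>
    rcases Nat.eq_zero_or_pos N with rfl | hNpos
    · have hcases : (u = 1 ∧ v = 0 ∧ w = 0) ∨ (u = 0 ∧ v = 1 ∧ w = 0) ∨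
        (u = 0 ∧ v = 0 ∧ w = 1) := by omega
      rcases hcases with ⟨rfl, rfl, rfl⟩ | ⟨rfl, rfl, rfl⟩ | ⟨rfl, rfl, rfl⟩
      · have h1 := S.divOp_zero δ hV
        have h2 : D W = 0 := S.divOp_zero δ hW
        have h3 : D (V * W) = 0 := S.divOp_zero δ (h00 hV hW)
        rw [← S.vec.algebraMap_aug hV, ← S.vec.algebraMap_aug hW] at *
        rw [h1, h2, h3]
        simp only [commute_algebraMap, ← Algebra.smul_def, hfun, smul_smul,
          mul_comm (S.vec.aug W), mul_zero, smul_zero, sub_zero, pow_zero, one_smul]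
        abel
      · have h1 := S.divOp_zero δ hU
        have h2 : D W = 0 := S.divOp_zero δ hW
        have h3 : D (U * W) = 0 := S.divOp_zero δ (h00 hU hW)
        rw [← S.vec.algebraMap_aug hU, ← S.vec.algebraMap_aug hW] at *
        rw [h1, h2, h3]
        simp only [commute_algebraMap, ← Algebra.smul_def, hfun, smul_smul,
          mul_comm (S.vec.aug W), mul_zero, zero_mul, smul_zero, sub_zero, pow_zero, one_smul]
        abel
      · have h1 := S.divOp_zero δ hU
        have h2 : D V = 0 := S.divOp_zero δ hV
        have h3 : D (U * V) = 0 := S.divOp_zero δ (h00 hU hV)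
        rw [← S.vec.algebraMap_aug hU, ← S.vec.algebraMap_aug hV] at *
        rw [h1, h2, h3, ← map_mul]
        simp only [commute_algebraMap, ← Algebra.smul_def, hfun,
          mul_zero, zero_mul, smul_zero, sub_zero, pow_zero, one_smul, zero_add]
    obtain ⟨N, rfl⟩ := Nat.exists_eq_add_of_lt hNpos
    rw [zero_add] at *
    have hDm : ∀ {a b : ℕ} {X Y : Ω'}, X ∈ S.vec.gr a → Y ∈ S.vec.gr b → a + b = N + 1 + 1 →
        D X * Y ∈ S.vec.gr (N + 1) := fun {a b X Y} hX hY h => by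
      rcases a with _ | a
      · rw [hD, S.divOp_zero δ hX, zero_mul]
        exact Submodule.zero_mem _
      · rw [show N + 1 = a + b by omega]
        exact S.vec.mul_mem (S.divOp_mem δ hX) hY
    have hmD : ∀ {a b : ℕ} {X Y : Ω'}, X ∈ S.vec.gr a → Y ∈ S.vec.gr b → a + b = N + 1 + 1 →
        X * D Y ∈ S.vec.gr (N + 1) := fun {a b X Y} hX hY h => by
      rcases b with _ | b
      · rw [hD, S.divOp_zero δ hY, mul_zero]
        exact Submodule.zero_mem _
      · rw [show N + 1 = a + b by omega]
        exact S.vec.mul_mem hX (S.divOp_mem δ hY)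
    have hsg : ∀ (k : ℕ) {X : Ω'}, X ∈ S.vec.gr (N + 1) → (-1 : ℝ) ^ k • X ∈ S.vec.gr (N + 1) :=
      fun k X hX => Submodule.smul_of_tower_mem _ _ hX
    refine S.vec.eq_of_con (k := N) ?_ ?_ fun α => ?_
    · exact S.divOp_mem δ (hN ▸ S.vec.mul_mem (S.vec.mul_mem hU hV) hW)
    · refine Submodule.sub_mem _ (Submodule.sub_mem _ (Submodule.sub_mem _ (Submodule.add_mem _
        (Submodule.add_mem _ (hDm (S.vec.mul_mem hU hV) hW hN.symm) (hsg _ ?_)) (hsg _ ?_)) ?_)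
        (hsg _ ?_)) (hsg _ ?_)
      · exact hmD hU (S.vec.mul_mem hV hW) (by omega)
      · exact hmD hV (S.vec.mul_mem hU hW) (by omega)
      · rw [mul_assoc]
        exact hDm hU (S.vec.mul_mem hV hW) (by omega)
      · rcases v with _ | v
        · rw [hD, S.divOp_zero δ hV, mul_zero, zero_mul]
          exact Submodule.zero_mem _
        · rw [show N + 1 = u + v + w by omega]
          exact S.vec.mul_mem (S.vec.mul_mem hU (S.divOp_mem δ hV)) hW
      · exact hmD (S.vec.mul_mem hU hV) hW hN.symm
    · have hα := α.2
      rw [← S.I_one_form, ← S.I_one_form]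
      generalize (α : Ω) = α at hα
      have hDi : ∀ Y, S.I α (D Y) = S.I (A.d S.form α) Y - D (S.I α Y) := S.I_one_divOp δ hα
      have hDmul : ∀ {k : ℕ} {Y : Ω'}, Y ∈ S.vec.gr k → ∀ Z, S.I α (D Y * Z) =
          S.I α (D Y) * Z - (-1 : ℝ) ^ k • (D Y * S.I α Z) := fun {k Y} hY Z => by
        rcases k with _ | k
        · rw [hD, S.divOp_zero δ hY]
          simp
        · rw [S.I_one_mul hα (S.divOp_mem δ hY : D Y ∈ _), pow_succ, mul_neg_one, neg_smul, sub_neg_eq_add]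
      have ih1 : D (S.I α U * V * W) = D (S.I α U * V) * W - (-1 : ℝ) ^ u • (S.I α U * D (V * W))
          + (-1 : ℝ) ^ (u * v) • (V * D (S.I α U * W)) - D (S.I α U) * V * W
          + (-1 : ℝ) ^ u • (S.I α U * D V * W) + (-1 : ℝ) ^ (u + v) • (S.I α U * V * D W) := by
        rcases u with _ | u
        · rw [S.I_one_zero hα hU]
          simp
        · rw [ih (S.I_one_mem hα hU) hV hW (by omega), add_right_comm u 1 v, pow_succ, pow_succ]
          simp only [mul_neg_one, neg_smul, neg_neg, sub_eq_add_neg]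
      have ih2 : D (U * S.I α V * W) = D (U * S.I α V) * W + (-1 : ℝ) ^ u • (U * D (S.I α V * W))
          + (-1 : ℝ) ^ ((u + 1) * (v + 1)) • (S.I α V * D (U * W)) - D U * S.I α V * W
          - (-1 : ℝ) ^ u • (U * D (S.I α V) * W) + (-1 : ℝ) ^ (u + v) • (U * S.I α V * D W) := by
        rcases v with _ | v
        · rw [S.I_one_zero hα hV]
          simp
        · rw [ih hU (S.I_one_mem hα hV) hW (by omega), ← add_assoc u, pow_succ _ (u + v),
            show (u + 1) * (v + 1 + 1) = (u + 1) * v + 2 * (u + 1) by ring, pow_add _ _ (2 * _),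
            pow_mul _ 2, neg_one_sq, one_pow, mul_one]
          simp only [mul_neg_one, neg_smul, sub_eq_add_neg]
      have ih3 : D (U * V * S.I α W) = D (U * V) * S.I α W + (-1 : ℝ) ^ u • (U * D (V * S.I α W))
          + (-1 : ℝ) ^ ((u + 1) * v) • (V * D (U * S.I α W)) - D U * V * S.I α W
          - (-1 : ℝ) ^ u • (U * D V * S.I α W)
          - (-1 : ℝ) ^ (u + v) • (U * V * D (S.I α W)) := by
        rcases w with _ | w
        · rw [S.I_one_zero hα hW]
          simp
        · exact ih hU hV (S.I_one_mem hα hW) (by omega)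
      have hJ := S.I_two_mul_mul (A.d_mem S.form hα) hU hV W
      have hsm : ∀ (T : Ω' →ₗ[K] Ω') (k : ℕ) (Y : Ω'), T ((-1 : ℝ) ^ k • Y) =
          (-1 : ℝ) ^ k • T Y := fun T k Y => LinearMap.map_smul_of_tower _ _ _
      simp only [map_add, map_sub, hsm, mul_assoc, hDmul hU, hDmul hV,
        hDmul (S.vec.mul_mem hU hV), S.I_one_mul hα hU, S.I_one_mul hα hV, hDi] at ih1 ih2 ih3 hJ ⊢
      simp only [mul_add, mul_smul_comm, map_add, LinearMap.map_smul]
      rw [ih1, ih2, ih3, hJ]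
      simp only [mul_add, add_mul, mul_sub, sub_mul,
        mul_smul_comm, smul_mul_assoc, pow_add, pow_mul, mul_one, mul_assoc]
      rcases neg_one_pow_eq_or ℝ u with hu | hu <;> rcases neg_one_pow_eq_or ℝ v with hv | hv <;>
      · simp only [hu, hv, one_pow, neg_smul, one_smul, mul_one, pow_one, mul_neg, neg_neg,
          smul_add, smul_sub, smul_neg]
        abel

end ContractionPair

/-! ### The curvature of a divergence -/

namespace ContractionPair

variable {n : ℕ} {M K L Ω Ω' : Type*} [CommRing K] [Algebra ℝ K]
    [AddCommGroup L] [Module K L] [Module ℝ L] [IsScalarTower ℝ K L]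
    [Ring Ω] [Algebra ℝ Ω] [Algebra K Ω] [Ring Ω'] [Algebra ℝ Ω'] [Algebra K Ω']
    [IsScalarTower ℝ K Ω] [IsScalarTower ℝ K Ω']
    (S : ContractionPair n M K L Ω Ω') {A : LieRinehart K L} (δ : A.Divergence)

omit [Module ℝ L] [IsScalarTower ℝ K L] [IsScalarTower ℝ K Ω] [IsScalarTower ℝ K Ω'] in
theorem mul_self_of_mem_one {x : Ω'} (hx : x ∈ S.vec.gr 1) : x * x = 0 := by
  have h := S.vec.mul_comm' hx hx
  rw [mul_one, pow_one, neg_smul, one_smul] at h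
  have h2 : (2 : ℝ) • (x * x) = 0 := by
    rw [two_smul]
    nth_rewrite 1 [h]
    exact neg_add_cancel _
  exact (smul_eq_zero.1 h2).resolve_left two_ne_zero

omit [Module ℝ L] [IsScalarTower ℝ K L] in
theorem I_ofL_mul_ofL {ξ : Ω} (hξ : ξ ∈ S.form.gr 2) (X Y : L) :
    S.I ξ (S.ofL X * S.ofL Y) =
      algebraMap K Ω' (S.form.aug (S.form.con Y (S.form.con X ξ))) := by
  rw [S.I_ofL_mul X hξ, S.I_eq_zero hξ (S.ofL_mem Y) one_lt_two, mul_zero, smul_zero, add_zero,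
    S.I_ofL _ (S.form.con_mem X hξ)]

/-- The square of the operator of a divergence is the contraction with a two-form. -/
theorem exists_divOp_divOp_eq :
    ∃ R ∈ S.form.gr 2, ∀ U, S.divOp δ (S.divOp δ U) = -S.I R U := by
  set D := S.divOp δ with hD
  have h1 : ∀ X, ∃ ζ ∈ S.form.gr 1, ∀ Y, S.form.con Y ζ =
      algebraMap K Ω (-S.vec.aug (D (D (S.ofL X * S.ofL Y)))) := fun X =>
    S.form.exists_con_eq (k := 0)
      { toFun := fun Y => algebraMap K Ω (-S.vec.aug (D (D (S.ofL X * S.ofL Y))))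
        map_add' := fun Y Z => by
          simp only [map_add, mul_add, neg_add]
        map_smul' := fun f Y => by
          rw [map_smul, mul_smul_comm, hD, S.divOp_divOp_smul, map_smul, smul_eq_mul, ← mul_neg,
            map_mul, ← Algebra.smul_def, RingHom.id_apply] }
      (fun Y => S.form.algebraMap_mem _) (fun Y => S.form.con_zero Y (S.form.algebraMap_mem _))
  choose φ hφ hφc using h1
  obtain ⟨R, hR, hRc⟩ := S.form.exists_con_eq (k := 1)
      { toFun := φ
        map_add' := fun X Y => S.form.eq_of_con (hφ _) (Submodule.add_mem _ (hφ _) (hφ _))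
          fun Z => by simp only [map_add, hφc, add_mul, neg_add]
        map_smul' := fun f X => S.form.eq_of_con (hφ _) (Submodule.smul_mem _ _ (hφ _)) fun Z => by
          rw [RingHom.id_apply, map_smul, hφc, hφc, map_smul, smul_mul_assoc, hD,
            S.divOp_divOp_smul, map_smul, smul_eq_mul, ← mul_neg, map_mul, ← Algebra.smul_def] }
      hφ (fun X => by
        change S.form.con X (φ X) = 0
        rw [hφc, S.mul_self_of_mem_one (S.ofL_mem X)]
        simp)
  replace hRc : ∀ X Y, S.form.con Y (S.form.con X R) =
      algebraMap K Ω (-S.vec.aug (D (D (S.ofL X * S.ofL Y)))) := fun X Y => by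
    rw [hRc]
    exact hφc X Y
  refine ⟨R, hR, fun U => ?_⟩
  rw [← sub_eq_zero, sub_neg_eq_add]
  have h2 : ∀ U ∈ S.vec.gr 2, D (D U) + S.I R U = 0 := fun U hU => by
    refine S.vec.local_induction (Q := fun k U => k = 2 → D (D U) + S.I R U = 0)
      (fun f h => ?_) (fun k X hX Y hY ih h => ?_) (fun k _ => ?_) (fun k a b ha hb h => ?_)
      (fun k r a ha h => ?_) (fun k a _ ha h => ?_) hU rfl
    · omega
    · obtain rfl : k = 1 := by omega
      rw [← S.ofL_toL hX, ← S.ofL_toL hY, S.I_ofL_mul_ofL hR, hRc, S.form.aug_algebraMap,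
        map_neg, S.vec.algebraMap_aug, add_neg_cancel]
      exact S.divOp_mem δ (S.divOp_mem δ (S.vec.mul_mem (S.ofL_mem _) (S.ofL_mem _)))
    · simp
    · rw [map_add, map_add, map_add, add_add_add_comm, ha h, hb h, add_zero]
    · rw [map_smul, map_smul, LinearMap.map_smul_of_tower, ← smul_add, ha h, smul_zero]
    · refine S.vec.faithful _ fun m => ?_
      have := ha m h
      rwa [hD, S.divOp_divOp_smul, map_smul, ← smul_add] at this
  refine S.vec.eq_zero_of_con_comm 2 0 1 (D ∘ₗ D + (S.I R).restrictScalars ℝ)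
    (fun j x hx => ?_) (fun k hk x hx => ?_) (fun _ x hx => h2 x hx) (fun k x hx α => ?_) U
  · exact Submodule.add_mem _ (S.divOp_mem δ (S.divOp_mem δ hx)) (S.I_mem hR hx)
  · have h0 : D (D x) = 0 := by
      rcases k with _ | k
      · rw [hD, S.divOp_zero δ hx, map_zero]
      · obtain rfl : k = 0 := by omega
        exact S.divOp_zero δ (S.divOp_mem δ hx)
    simp [h0, S.I_eq_zero hR hx hk]
  · simp only [LinearMap.add_apply, LinearMap.comp_apply, LinearMap.restrictScalars_apply, map_add,
      ← S.I_one_form, one_smul, hD, S.divOp_divOp_I δ α.2, S.I_two_comm hR α.2]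

/-! ### The bracket generated by the operator of a divergence -/

/-- The sign operator `(-1)^u` on multivectors of degree `u`. -/
noncomputable def sgn : Ω' →ₗ[ℝ] Ω' :=
  ∑ k ∈ Finset.range (n + 1), (-1 : ℝ) ^ k • (S.vec.proj k).restrictScalars ℝ

omit [Module ℝ L] [IsScalarTower ℝ K L] [IsScalarTower ℝ K Ω] in
theorem sgn_apply {u : ℕ} {U : Ω'} (hU : U ∈ S.vec.gr u) : S.sgn U = (-1 : ℝ) ^ u • U := by
  conv_rhs => rw [← S.vec.sum_proj U]
  simp only [sgn, LinearMap.sum_apply, LinearMap.smul_apply, LinearMap.restrictScalars_apply,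
    Finset.smul_sum]
  refine Finset.sum_congr rfl fun k _ => ?_
  rcases eq_or_ne k u with rfl | h
  · rfl
  · rw [S.vec.proj_of_ne hU h, smul_zero, smul_zero]

/-- The bracket generated by an operator `D`. -/
noncomputable def genBracket (D : Ω' →ₗ[ℝ] Ω') : Ω' →ₗ[ℝ] Ω' →ₗ[ℝ] Ω' :=
  LinearMap.mk₂ ℝ (fun U V => D (S.sgn U * V) - D (S.sgn U) * V - U * D V)
    (fun U U' V => by
      simp only [map_add, add_mul]
      abel)
    (fun r U V => by
      simp only [map_smul, smul_mul_assoc, smul_sub])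
    (fun U V V' => by
      simp only [map_add, mul_add]
      abel)
    (fun r U V => by
      simp only [map_smul, mul_smul_comm, smul_sub])

omit [Module ℝ L] [IsScalarTower ℝ K L] [IsScalarTower ℝ K Ω] in
theorem genBracket_apply (D : Ω' →ₗ[ℝ] Ω') {u : ℕ} {U : Ω'} (hU : U ∈ S.vec.gr u) (V : Ω') :
    S.genBracket D U V = (-1 : ℝ) ^ u • (D (U * V) - D U * V) - U * D V := by
  simp only [genBracket, LinearMap.mk₂_apply, S.sgn_apply hU, smul_mul_assoc, map_smul, smul_sub]

/-- The properties of the Schouten bracket: a Gerstenhaber bracket which extends the bracket of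
sections and the action of sections on functions. -/
structure IsSchouten (A : LieRinehart K L) (B : Ω' →ₗ[ℝ] Ω' →ₗ[ℝ] Ω') : Prop where
  degree : ∀ (u v w : ℕ), u + v = w + 1 → ∀ U ∈ S.vec.gr u, ∀ V ∈ S.vec.gr v, B U V ∈ S.vec.gr w
  degree_zero : ∀ U ∈ S.vec.gr 0, ∀ V ∈ S.vec.gr 0, B U V = 0
  skew : ∀ (u v : ℕ), ∀ U ∈ S.vec.gr u, ∀ V ∈ S.vec.gr v,
    B U V = -((-1 : ℝ) ^ ((u + 1) * (v + 1)) • B V U)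
  jacobi : ∀ (u v : ℕ), ∀ U ∈ S.vec.gr u, ∀ V ∈ S.vec.gr v, ∀ W,
    B U (B V W) = B (B U V) W + (-1 : ℝ) ^ ((u + 1) * (v + 1)) • B V (B U W)
  leibniz : ∀ (u v : ℕ), ∀ U ∈ S.vec.gr u, ∀ V ∈ S.vec.gr v, ∀ W,
    B U (V * W) = B U V * W + (-1 : ℝ) ^ ((u + 1) * v) • (V * B U W)
  sections : ∀ X Y, B (S.ofL X) (S.ofL Y) = S.ofL (A.bracket X Y)
  functions : ∀ X f, B (S.ofL X) (algebraMap K Ω' f) = algebraMap K Ω' (A.act X f)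

theorem genBracket_degree (u v w : ℕ) (h : u + v = w + 1) (U : Ω') (hU : U ∈ S.vec.gr u) (V : Ω')
    (hV : V ∈ S.vec.gr v) : S.genBracket (S.divOp δ) U V ∈ S.vec.gr w := by
  rw [S.genBracket_apply _ hU]
  refine Submodule.sub_mem _ (Submodule.smul_of_tower_mem _ _ (Submodule.sub_mem _ ?_ ?_)) ?_
  · exact S.divOp_mem δ (h ▸ S.vec.mul_mem hU hV)
  · rcases u with _ | u
    · rw [S.divOp_zero δ hU, zero_mul]
      exact Submodule.zero_mem _
    · rw [show w = u + v by omega]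
      exact S.vec.mul_mem (S.divOp_mem δ hU) hV
  · rcases v with _ | v
    · rw [S.divOp_zero δ hV, mul_zero]
      exact Submodule.zero_mem _
    · rw [show w = u + v by omega]
      exact S.vec.mul_mem hU (S.divOp_mem δ hV)

theorem divOp_mul_comm {u v : ℕ} {U V : Ω'} (hU : U ∈ S.vec.gr u) (hV : V ∈ S.vec.gr v) :
    V * S.divOp δ U = (-1 : ℝ) ^ (v * (u + 1)) • (S.divOp δ U * V) := by
  rcases u with _ | u
  · rw [S.divOp_zero δ hU, mul_zero, zero_mul, smul_zero]
  · rw [S.vec.mul_comm' hV (S.divOp_mem δ hU), show v * (u + 1 + 1) = v * u + 2 * v by ring,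
      pow_add _ _ (2 * _), pow_mul _ 2, neg_one_sq, one_pow, mul_one]

theorem genBracket_skew (u v : ℕ) (U : Ω') (hU : U ∈ S.vec.gr u) (V : Ω') (hV : V ∈ S.vec.gr v) :
    S.genBracket (S.divOp δ) U V =
      -((-1 : ℝ) ^ ((u + 1) * (v + 1)) • S.genBracket (S.divOp δ) V U) := by
  rw [S.genBracket_apply _ hU, S.genBracket_apply _ hV, S.divOp_mul_comm δ hU hV,
    S.divOp_mul_comm δ hV hU, S.vec.mul_comm' hU hV, map_smul]
  simp only [pow_add, pow_mul, smul_sub, pow_one]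
  rcases neg_one_pow_eq_or ℝ u with hu | hu <;> rcases neg_one_pow_eq_or ℝ v with hv | hv <;>
  · simp only [hu, hv, one_pow, neg_smul, one_smul, mul_one, mul_neg, neg_neg]
    abel

theorem genBracket_leibniz (u v : ℕ) (U : Ω') (hU : U ∈ S.vec.gr u) (V : Ω') (hV : V ∈ S.vec.gr v)
    (W : Ω') : S.genBracket (S.divOp δ) U (V * W) = S.genBracket (S.divOp δ) U V * W +
      (-1 : ℝ) ^ ((u + 1) * v) • (V * S.genBracket (S.divOp δ) U W) := by
  refine S.vec.induction_gr (Q := fun W => S.genBracket (S.divOp δ) U (V * W) =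
    S.genBracket (S.divOp δ) U V * W + (-1 : ℝ) ^ ((u + 1) * v) •
      (V * S.genBracket (S.divOp δ) U W)) (fun a b ha hb => ?_) ?_ (fun w W hW => ?_) W
  · simp only [mul_add, map_add, ha, hb, smul_add]
    abel
  · simp
  · have h := S.divOp_mul_mul δ hU hV hW
    have h1 : ∀ Y, V * (S.divOp δ U * Y) = (-1 : ℝ) ^ (v * (u + 1)) • (S.divOp δ U * (V * Y)) :=
      fun Y => by rw [← mul_assoc, S.divOp_mul_comm δ hU hV, smul_mul_assoc, mul_assoc]
    have h2 : ∀ Y, V * (U * Y) = (-1 : ℝ) ^ (v * u) • (U * (V * Y)) :=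
      fun Y => by rw [← mul_assoc, S.vec.mul_comm' hV hU, smul_mul_assoc, mul_assoc]
    simp only [S.genBracket_apply _ hU]
    rw [← mul_assoc U, h]
    simp only [mul_add, add_mul, mul_sub, sub_mul, mul_assoc, mul_smul_comm, smul_mul_assoc,
      h1, h2, pow_add, pow_mul, smul_sub, smul_add]
    rcases neg_one_pow_eq_or ℝ u with hu | hu <;> rcases neg_one_pow_eq_or ℝ v with hv | hv <;>
    · simp only [hu, hv, one_pow, neg_smul, one_smul, mul_one, pow_one, mul_neg, neg_neg]
      abel

theorem genBracket_functions (X : L) (f : K) :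
    S.genBracket (S.divOp δ) (S.ofL X) (algebraMap K Ω' f) = algebraMap K Ω' (A.act X f) := by
  rw [S.genBracket_apply _ (S.ofL_mem X), S.divOp_zero δ (S.vec.algebraMap_mem f),
    commute_algebraMap, commute_algebraMap, S.divOp_smul, S.I_ofL _ (A.dFun_mem _ f), A.con_dFun,
    S.form.aug_algebraMap]
  simp

theorem genBracket_sections (X Y : L) :
    S.genBracket (S.divOp δ) (S.ofL X) (S.ofL Y) = S.ofL (A.bracket X Y) := by
  refine S.vec.eq_of_con (k := 0) (S.genBracket_degree δ 1 1 1 rfl _ (S.ofL_mem X) _ (S.ofL_mem Y))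
    (S.ofL_mem _) fun α => ?_
  obtain ⟨α, hα⟩ := α
  rw [← S.I_one_form, ← S.I_one_form]
  have e : ∀ Z, S.form.con Z α = algebraMap K Ω (S.form.aug (S.form.con Z α)) :=
    S.form.con_mem_zero hα
  have h1 : S.I α (S.ofL X * S.ofL Y) =
      S.form.aug (S.form.con X α) • S.ofL Y - S.form.aug (S.form.con Y α) • S.ofL X := by
    rw [S.I_one_ofL_mul hα, S.I_ofL α hα, commute_algebraMap]
  have h2 : S.form.aug (S.form.con Y (S.form.con X (A.d S.form α))) =
      A.act X (S.form.aug (S.form.con Y α)) - S.form.aug (S.form.con (A.bracket X Y) α)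
        - A.act Y (S.form.aug (S.form.con X α)) := by
    rw [A.con_d, map_sub, A.con_lie, e X, A.d_algebraMap, A.con_dFun, map_sub, map_sub,
      A.lie_of_mem_zero _ _ (S.form.con_mem Y hα), S.form.aug_algebraMap, S.form.aug_algebraMap,
      S.form.aug_algebraMap]
  rw [S.genBracket_apply _ (S.ofL_mem X), S.divOp_ofL, S.divOp_ofL, commute_algebraMap,
    ← Algebra.smul_def, map_sub, LinearMap.map_smul_of_tower, map_sub, S.I_one_divOp δ hα,
    h1, S.I_ofL_mul_ofL (A.d_mem _ hα), h2, map_smul, map_smul, S.I_ofL α hα, S.I_ofL α hα,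
    S.I_ofL α hα, map_sub (S.divOp δ), S.divOp_smul, S.divOp_smul, S.divOp_ofL, S.divOp_ofL,
    S.I_ofL _ (A.dFun_mem _ _), S.I_ofL _ (A.dFun_mem _ _), A.con_dFun, A.con_dFun,
    S.form.aug_algebraMap, S.form.aug_algebraMap]
  rw [pow_one, neg_smul, one_smul]
  simp only [Algebra.smul_def, ← map_mul, ← map_sub, ← map_neg]
  congr 1
  ring

/-- The Jacobi identity says that `x ↦ [U, x]` is a derivation of the bracket. As it is a derivation
of the product, it suffices to compute its commutator with `D`. Up to sign this is `[DU, x]` plus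
`G x = D² (U x) - (D² U) x - U D² x`. Contractions with two-forms have order two, so `G` is a
derivation of the product, as is `[DU, ·]`, and neither contributes. -/
theorem genBracket_jacobi (u v : ℕ) (U : Ω') (hU : U ∈ S.vec.gr u) (V : Ω') (hV : V ∈ S.vec.gr v)
    (W : Ω') : S.genBracket (S.divOp δ) U (S.genBracket (S.divOp δ) V W) =
      S.genBracket (S.divOp δ) (S.genBracket (S.divOp δ) U V) W +
      (-1 : ℝ) ^ ((u + 1) * (v + 1)) •
        S.genBracket (S.divOp δ) V (S.genBracket (S.divOp δ) U W) := by
  obtain ⟨R, hR, hDD⟩ := S.exists_divOp_divOp_eq δ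
  have hleib := S.genBracket_leibniz δ
  set D := S.divOp δ with hD
  set B := S.genBracket D with hB
  -- the failure of `D ^ 2` to be a derivation, itself a derivation by `hGmul`
  set G : Ω' → Ω' := fun x => D (D (U * x)) - D (D U) * x - U * D (D x) with hG
  have hBU : ∀ x, B U x = (-1 : ℝ) ^ u • (D (U * x) - D U * x) - U * D x :=
    S.genBracket_apply D hU
  have hBDU : ∀ x, B (D U) x = -((-1 : ℝ) ^ u • (D (D U * x) - D (D U) * x)) - D U * D x := by
    intro x
    rcases u with _ | u
    · rw [hD, S.divOp_zero δ hU]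
      simp
    · rw [S.genBracket_apply D (S.divOp_mem δ hU : D U ∈ _), pow_succ, mul_neg_one, neg_smul,
        neg_neg]
  have hBDU_mul : ∀ x, B (D U) (V * x) = B (D U) V * x + (-1 : ℝ) ^ (u * v) • (V * B (D U) x) := by
    intro x
    rcases u with _ | u
    · rw [hD, S.divOp_zero δ hU]
      simp
    · exact hleib u v _ (S.divOp_mem δ hU) V hV x
  have hBDV : ∀ x, B U (D V * x) = B U (D V) * x +
      (-1 : ℝ) ^ ((u + 1) * (v + 1)) • (D V * B U x) := by
    intro x
    rcases v with _ | v
    · rw [hD, S.divOp_zero δ hV]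
      simp
    · rw [hleib u v _ hU _ (S.divOp_mem δ hV), show (u + 1) * (v + 1 + 1) = (u + 1) * v + 2 * (u + 1)
        by ring, pow_add _ _ (2 * _), pow_mul _ 2, neg_one_sq, one_pow, mul_one]
  have hBB : ∀ x, B (B U V) x =
      -((-1 : ℝ) ^ (u + v) • (D (B U V * x) - D (B U V) * x)) - B U V * D x := by
    intro x
    obtain h | ⟨w, h⟩ : u + v = 0 ∨ ∃ w, u + v = w + 1 := by
      rcases u + v with _ | w
      · exact Or.inl rfl
      · exact Or.inr ⟨w, rfl⟩
    · obtain ⟨rfl, rfl⟩ : u = 0 ∧ v = 0 := by omega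
      have : B U V = 0 := by
        rw [hBU, hD, S.divOp_zero δ (S.vec.mul_mem hU hV), S.divOp_zero δ hU, S.divOp_zero δ hV]
        simp
      simp [this]
    · rw [S.genBracket_apply D (S.genBracket_degree δ u v w h U hU V hV : B U V ∈ _), h, pow_succ,
        mul_neg_one, neg_smul, neg_neg]
  have hK : ∀ x, B U (D x) = -((-1 : ℝ) ^ u • D (B U x)) + (-1 : ℝ) ^ u • B (D U) x + G x := by
    intro x
    rw [hBDU, hBU, hBU, hG]
    simp only [map_sub, map_smul, smul_sub, smul_neg]
    rcases neg_one_pow_eq_or ℝ u with hu | hu <;>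
    · simp only [hu, neg_smul, one_smul, neg_neg]
      abel
  have hGmul : ∀ x, G (V * x) = G V * x + (-1 : ℝ) ^ (u * v) • (V * G x) := by
    intro x
    have h1 : ∀ Y, V * (S.I R U * Y) = (-1 : ℝ) ^ (u * v) • (S.I R U * (V * Y)) := fun Y => by
      obtain h | ⟨w, rfl⟩ : u < 2 ∨ ∃ w, u = w + 2 := by
        rcases u with _ | _ | w
        · exact Or.inl two_pos
        · exact Or.inl one_lt_two
        · exact Or.inr ⟨w, rfl⟩
      · rw [S.I_eq_zero hR hU h]
        simp
      · rw [← mul_assoc, S.vec.mul_comm' hV (S.I_mem hR hU), smul_mul_assoc, mul_assoc,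
          show (w + 2) * v = v * w + 2 * v by ring, pow_add _ _ (2 * _), pow_mul _ 2, neg_one_sq,
          one_pow, mul_one]
    have h2 : ∀ Y, V * (U * Y) = (-1 : ℝ) ^ (v * u) • (U * (V * Y)) :=
      fun Y => by rw [← mul_assoc, S.vec.mul_comm' hV hU, smul_mul_assoc, mul_assoc]
    simp only [hG, hDD]
    rw [← mul_assoc U, S.I_two_mul_mul hR hU hV]
    simp only [mul_sub, sub_mul, mul_assoc, mul_neg, neg_mul, h1, h2, pow_mul, smul_sub, smul_neg]
    rcases neg_one_pow_eq_or ℝ u with hu | hu <;> rcases neg_one_pow_eq_or ℝ v with hv | hv <;>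
    · simp only [hu, hv, one_pow, neg_smul, one_smul, neg_neg]
      abel
  have hBV : ∀ x, B V x = (-1 : ℝ) ^ v • (D (V * x) - D V * x) - V * D x :=
    S.genBracket_apply D hV
  have hBUV := hleib u v U hU V hV
  clear_value G B
  rw [hBV W, hBV (B U W), hBB W]
  simp only [map_sub, map_smul, hK (V * W), hBUV, hBDU_mul, hBDV, hGmul, hK W, hK V, map_add,
    mul_add, add_mul, mul_assoc, mul_smul_comm, smul_mul_assoc, mul_neg,
    neg_mul, pow_mul, pow_add, smul_sub, smul_add, smul_neg]
  rcases neg_one_pow_eq_or ℝ u with hu | hu <;> rcases neg_one_pow_eq_or ℝ v with hv | hv <;>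
  · simp only [hu, hv, one_pow, neg_smul, one_smul, neg_neg, mul_one, pow_one, mul_neg]
    abel

theorem genBracket_isSchouten : S.IsSchouten A (S.genBracket (S.divOp δ)) where
  degree := S.genBracket_degree δ
  degree_zero U hU V hV := by
    rw [S.genBracket_apply _ hU, S.divOp_zero δ (S.vec.mul_mem hU hV), S.divOp_zero δ hU,
      S.divOp_zero δ hV]
    simp
  skew := S.genBracket_skew δ
  jacobi := S.genBracket_jacobi δ
  leibniz := S.genBracket_leibniz δ
  sections := S.genBracket_sections δ
  functions := S.genBracket_functions δ

end ContractionPair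

theorem ContractionAlgebra.eq_of_con_con {n : ℕ} {M K Ω P : Type*} [CommRing K] [Algebra ℝ K]
    [Ring Ω] [Algebra ℝ Ω] [Algebra K Ω] [AddCommGroup P] [Module K P]
    (C : ContractionAlgebra n M K Ω P) {a b : Ω} (ha : a ∈ C.gr 2) (hb : b ∈ C.gr 2)
    (h : ∀ p q, C.aug (C.con q (C.con p a)) = C.aug (C.con q (C.con p b))) : a = b :=
  C.eq_of_con ha hb fun p => C.eq_of_con (C.con_mem p ha) (C.con_mem p hb) fun q => by
    rw [C.con_mem_zero (C.con_mem p ha), h, ← C.con_mem_zero (C.con_mem p hb)]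

namespace ContractionPair

variable {n : ℕ} {M K L Ω Ω' : Type*} [CommRing K] [Algebra ℝ K]
    [AddCommGroup L] [Module K L] [Module ℝ L] [IsScalarTower ℝ K L]
    [Ring Ω] [Algebra ℝ Ω] [Algebra K Ω] [Ring Ω'] [Algebra ℝ Ω'] [Algebra K Ω']
    [IsScalarTower ℝ K Ω] [IsScalarTower ℝ K Ω']
    (S : ContractionPair n M K L Ω Ω') {A : LieRinehart K L} (δ : A.Divergence)

/-! ### Uniqueness of the Schouten bracket and of its generators -/

omit [IsScalarTower ℝ K L] [IsScalarTower ℝ K Ω] [IsScalarTower ℝ K Ω'] in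
variable {S} in
/-- The bracket with a fixed element is a derivation, and derivations are determined by their values
in degrees zero and one. -/
theorem IsSchouten.unique {B B' : Ω' →ₗ[ℝ] Ω' →ₗ[ℝ] Ω'} (h : S.IsSchouten A B)
    (h' : S.IsSchouten A B') : B = B' := by
  have key : ∀ u, ∀ U ∈ S.vec.gr u, (∀ V ∈ S.vec.gr 0, B U V = B' U V) →
      (∀ V ∈ S.vec.gr 1, B U V = B' U V) → ∀ V, B U V = B' U V := fun u U hU h0 h1 V => by
    have := S.vec.eq_zero_of_derivation (u + 1) (B U - B' U) (fun k a ha b => ?_)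
      (fun a ha => ?_) (fun a ha => ?_) V
    · exact sub_eq_zero.1 this
    · simp only [LinearMap.sub_apply, h.leibniz u k U hU a ha, h'.leibniz u k U hU a ha, sub_mul,
        mul_sub, smul_sub]
      abel
    · rw [LinearMap.sub_apply, h0 a ha, sub_self]
    · rw [LinearMap.sub_apply, h1 a ha, sub_self]
  have hone : ∀ U ∈ S.vec.gr 1, ∀ V, B U V = B' U V := fun U hU =>
    key 1 U hU (fun V hV => by
      rw [← S.ofL_toL hU, ← S.vec.algebraMap_aug hV, h.functions, h'.functions]) (fun V hV => by
      rw [← S.ofL_toL hU, ← S.ofL_toL hV, h.sections, h'.sections])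
  have hzero : ∀ U ∈ S.vec.gr 0, ∀ V, B U V = B' U V := fun U hU =>
    key 0 U hU (fun V hV => by rw [h.degree_zero U hU V hV, h'.degree_zero U hU V hV])
      (fun V hV => by rw [h.skew 0 1 U hU V hV, h'.skew 0 1 U hU V hV, hone V hV])
  refine LinearMap.ext fun U => S.vec.induction_gr (Q := fun U => B U = B' U)
    (fun a b ha hb => by rw [map_add, map_add, ha, hb]) (by rw [map_zero, map_zero])
    (fun u U hU => LinearMap.ext (key u U hU (fun V hV => ?_) (fun V hV => ?_))) U
  · rw [h.skew u 0 U hU V hV, h'.skew u 0 U hU V hV, hzero V hV]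
  · rw [h.skew u 1 U hU V hV, h'.skew u 1 U hU V hV, hone V hV]

/-- An operator of degree `-1` which generates the bracket `B`. -/
structure IsGenerator (B : Ω' →ₗ[ℝ] Ω' →ₗ[ℝ] Ω') (D : Ω' →ₗ[ℝ] Ω') : Prop where
  zero : ∀ U ∈ S.vec.gr 0, D U = 0
  succ : ∀ k, ∀ U ∈ S.vec.gr (k + 1), D U ∈ S.vec.gr k
  generates : ∀ u, ∀ U ∈ S.vec.gr u, ∀ V,
    B U V = (-1 : ℝ) ^ u • (D (U * V) - D U * V - (-1 : ℝ) ^ u • (U * D V))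

omit [Module ℝ L] [IsScalarTower ℝ K L] [IsScalarTower ℝ K Ω] [IsScalarTower ℝ K Ω'] in
variable {S} in
/-- The difference of two generators is a derivation which vanishes on functions. -/
theorem IsGenerator.unique {B : Ω' →ₗ[ℝ] Ω' →ₗ[ℝ] Ω'} {D D' : Ω' →ₗ[ℝ] Ω'}
    (h : S.IsGenerator B D) (h' : S.IsGenerator B D') (h1 : ∀ X, D (S.ofL X) = D' (S.ofL X)) :
    D = D' := by
  refine LinearMap.ext fun U => sub_eq_zero.1 ?_
  refine S.vec.eq_zero_of_derivation 1 (D - D') (fun u U hU V => ?_) (fun a ha => ?_)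
    (fun a ha => ?_) U
  · have e := (h.generates u U hU V).symm.trans (h'.generates u U hU V)
    have e' := smul_right_injective Ω' (pow_ne_zero u (by norm_num : (-1 : ℝ) ≠ 0)) e
    rw [one_mul]
    simp only [LinearMap.sub_apply, sub_mul, mul_sub, smul_sub]
    rw [← sub_eq_zero] at e' ⊢
    rw [← e']
    abel
  · rw [LinearMap.sub_apply, h.zero a ha, h'.zero a ha, sub_zero]
  · rw [LinearMap.sub_apply, ← S.ofL_toL ha, h1, sub_self]

/-- The operator of a divergence generates the Schouten bracket. -/
theorem divOp_isGenerator {B : Ω' →ₗ[ℝ] Ω' →ₗ[ℝ] Ω'} (hB : S.IsSchouten A B) :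
    S.IsGenerator B (S.divOp δ) where
  zero _ hU := S.divOp_zero δ hU
  succ _ _ hU := S.divOp_mem δ hU
  generates u U hU V := by
    rw [hB.unique (S.genBracket_isSchouten δ), S.genBracket_apply _ hU, smul_sub _ (_ - _),
      smul_smul, ← mul_pow, neg_one_mul, neg_neg, one_pow, one_smul]

/-- Every generator of the Schouten bracket is the operator of a divergence. -/
theorem IsGenerator.exists_divergence {B : Ω' →ₗ[ℝ] Ω' →ₗ[ℝ] Ω'} {D : Ω' →ₗ[ℝ] Ω'}
    (hB : S.IsSchouten A B) (h : S.IsGenerator B D) : ∃ δ : A.Divergence, D = S.divOp δ := by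
  refine ⟨⟨S.vec.aug.restrictScalars ℝ ∘ₗ D ∘ₗ S.ofL.restrictScalars ℝ, fun f X => ?_⟩,
    h.unique (S.divOp_isGenerator _ hB) fun X => ?_⟩
  · have h1 := h.generates 0 _ (S.vec.algebraMap_mem f) (S.ofL X)
    rw [hB.skew 0 1 _ (S.vec.algebraMap_mem f) _ (S.ofL_mem X), hB.functions,
      h.zero _ (S.vec.algebraMap_mem f)] at h1
    have h2 := congrArg S.vec.aug h1
    simp only [pow_zero, one_smul, zero_mul, sub_zero, zero_add, one_mul, Nat.reduceAdd,
      neg_one_sq, map_neg, S.vec.aug_algebraMap, map_sub, ← Algebra.smul_def, map_smul,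
      smul_eq_mul] at h2
    simp only [LinearMap.comp_apply, LinearMap.restrictScalars_apply, map_smul]
    rw [eq_add_of_sub_eq' h2.symm, sub_eq_add_neg]
  · rw [S.divOp_ofL]
    exact (S.vec.algebraMap_aug (h.succ 0 _ (S.ofL_mem X))).symm

/-! ### Endomorphisms of the top degree -/

omit [Module ℝ L] [IsScalarTower ℝ K L] [IsScalarTower ℝ K Ω] [IsScalarTower ℝ K Ω'] in
/-- There are local sections of top degree of the multivectors and of the forms which are dual to
each other. -/
theorem exists_top (m : M) : ∃ Λ ∈ S.vec.gr n, ∃ μ ∈ S.form.gr n,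
    S.I μ Λ = algebraMap K Ω' (S.vec.cut m ^ n) := by
  obtain ⟨e, p, he, hep, -, -⟩ := S.vec.frame m
  have key : ∀ l : List (Fin n), l.Nodup → (l.map e).prod ∈ S.vec.gr l.length ∧
      (l.map fun i => (p i : Ω)).prod ∈ S.form.gr l.length ∧
      (∀ j ∉ l, S.vec.con (p j) (l.map e).prod = 0) ∧
      S.I (l.map fun i => (p i : Ω)).prod (l.map e).prod =
        algebraMap K Ω' (S.vec.cut m ^ l.length) := by
    intro l
    induction l with
    | nil =>
      refine fun _ => ⟨?_, ?_, fun j _ => ?_, ?_⟩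
      · simpa using S.vec.algebraMap_mem 1
      · simpa using S.form.algebraMap_mem 1
      · simpa using S.vec.con_zero (p j) (S.vec.algebraMap_mem 1)
      · simp [S.I_one]
    | cons i l ih =>
      intro hl
      rw [List.nodup_cons] at hl
      obtain ⟨h1, h2, h3, h4⟩ := ih hl.2
      simp only [List.map_cons, List.prod_cons, List.length_cons, add_comm _ 1]
      refine ⟨S.vec.mul_mem (he i) h1, S.form.mul_mem (p i).2 h2, fun j hj => ?_, ?_⟩
      · rw [List.mem_cons, not_or] at hj
        rw [S.vec.con_mul_one (he i), h3 j hj.2, hep, if_neg hj.1]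
        simp
      · rw [S.I_mul, S.I_one_form, S.vec.con_mul_one (he i), h3 i hl.1, hep, if_pos rfl, mul_zero,
          sub_zero, ← Algebra.smul_def, map_smul, h4, Algebra.smul_def, ← map_mul, pow_add, pow_one]
  obtain ⟨h1, h2, -, h4⟩ := key _ (List.nodup_finRange n)
  rw [List.length_finRange] at h1 h2 h4
  exact ⟨_, h1, _, h2, h4⟩

omit [Module ℝ L] [IsScalarTower ℝ K L] [IsScalarTower ℝ K Ω] [IsScalarTower ℝ K Ω'] in
theorem eq_zero_of_smul_top {f : K} (h : ∀ Λ ∈ S.vec.gr n, f • Λ = 0) : f = 0 := by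
  rw [← S.vec.aug_algebraMap f, S.vec.faithful_pow n (algebraMap K Ω' f) fun m => ?_, map_zero]
  obtain ⟨Λ, hΛ, μ, -, hμ⟩ := S.exists_top m
  rw [Algebra.smul_def, ← Algebra.commutes, ← Algebra.smul_def, ← hμ, ← map_smul, h Λ hΛ, map_zero]

omit [Module ℝ L] [IsScalarTower ℝ K L] in
/-- Endomorphisms of the top degree are multiplications by functions. -/
theorem exists_smul_top (T : S.vec.gr n →ₗ[K] S.vec.gr n) : ∃ f : K, ∀ Λ, T Λ = f • Λ := by
  choose Λ hΛ μ hμ hμΛ using S.exists_top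
  set g : M → K := fun m => S.vec.aug (S.I (μ m) (T ⟨Λ m, hΛ m⟩)) with hg
  have h1 : ∀ m, S.vec.aug (S.I (μ m) (Λ m)) = S.vec.cut m ^ n := fun m => by
    rw [hμΛ, S.vec.aug_algebraMap]
  have h2 : ∀ m Λ', g m • Λ' = S.vec.cut m ^ n • T Λ' := fun m Λ' => by
    have e : S.vec.aug (S.I (μ m) Λ') • (⟨Λ m, hΛ m⟩ : S.vec.gr n) = S.vec.cut m ^ n • Λ' :=
      Subtype.ext (by
        rw [← h1]
        exact (S.aug_smul_top (hμ m) (hΛ m) Λ'.2).symm)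
    rw [← map_smul, ← e, map_smul]
    exact Subtype.ext (S.aug_smul_top (hμ m) (T _).2 Λ'.2)
  obtain ⟨a, ha⟩ := S.vec.glue_pow n (fun m => algebraMap K Ω' (g m)) fun m m' => by
    have := congrArg (fun x : S.vec.gr n => S.vec.aug (S.I (μ m) x)) (h2 m' ⟨Λ m, hΛ m⟩)
    simp only [Submodule.coe_smul, map_smul, h1, smul_eq_mul] at this
    rw [Algebra.smul_def, Algebra.smul_def, ← map_mul, ← map_mul, ← this, mul_comm]
  refine ⟨S.vec.aug a, fun Λ' => Subtype.ext (sub_eq_zero.1 (S.vec.faithful_pow n _ fun m => ?_))⟩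
  have h3 : g m = S.vec.cut m ^ n * S.vec.aug a := by
    rw [← S.vec.aug_algebraMap (g m), ha, map_smul, smul_eq_mul]
  rw [smul_sub, ← Submodule.coe_smul, ← Submodule.coe_smul, ← h2, h3, mul_smul, sub_self]

/-! ### Connections on the top degree -/

/-- The operator of a divergence defines a connection on the top degree. -/
theorem ofL_mul_divOp_smul (f : K) (X : L) {Λ : Ω'} (hΛ : Λ ∈ S.vec.gr n) :
    -(S.ofL X * S.divOp δ (f • Λ)) = A.act X f • Λ + f • -(S.ofL X * S.divOp δ Λ) := by
  rw [S.divOp_smul, mul_sub, S.mul_I_top (A.dFun_mem _ f) (S.ofL_mem X) hΛ,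
    S.I_ofL _ (A.dFun_mem _ f), A.con_dFun, S.form.aug_algebraMap, ← Algebra.smul_def,
    mul_smul_comm, smul_neg]
  abel

theorem ofL_mul_divOp_mem (X : L) {Λ : Ω'} (hΛ : Λ ∈ S.vec.gr n) :
    -(S.ofL X * S.divOp δ Λ) ∈ S.vec.gr n := by
  refine Submodule.neg_mem _ ?_
  rcases n with _ | n
  · rw [S.divOp_zero δ hΛ, mul_zero]
    exact Submodule.zero_mem _
  · have h := S.vec.mul_mem (S.ofL_mem X) (S.divOp_mem δ hΛ)
    rwa [add_comm 1 n] at h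

theorem IsSchouten.ofL_top {B : Ω' →ₗ[ℝ] Ω' →ₗ[ℝ] Ω'} (hB : S.IsSchouten A B) (X : L) {Λ : Ω'}
    (hΛ : Λ ∈ S.vec.gr n) :
    B (S.ofL X) Λ = δ.div X • Λ - S.ofL X * S.divOp δ Λ := by
  rw [hB.unique (S.genBracket_isSchouten δ), S.genBracket_apply _ (S.ofL_mem X),
    S.vec.eq_zero_of_lt (by omega : n < 1 + n) (S.vec.mul_mem (S.ofL_mem X) hΛ), S.divOp_ofL,
    map_zero, ← Algebra.smul_def]
  simp

/-- Two divergences which define the same connection are equal. -/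
theorem div_eq_of_connection_eq {δ δ' : A.Divergence}
    (h : ∀ X, ∀ Λ ∈ S.vec.gr n, S.ofL X * S.divOp δ Λ = S.ofL X * S.divOp δ' Λ) : δ = δ' := by
  have : δ.div = δ'.div := LinearMap.ext fun X => sub_eq_zero.1 <|
    S.eq_zero_of_smul_top fun Λ hΛ => by
      have h1 := (S.genBracket_isSchouten δ).ofL_top S δ X hΛ
      rw [(S.genBracket_isSchouten δ).ofL_top S δ' X hΛ, h X Λ hΛ] at h1
      rw [sub_smul, sub_eq_zero]
      exact (sub_left_injective h1).symm
  cases δ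
  cases δ'
  simpa using this

/-- If there is a divergence at all, then every connection on the top degree comes from a
divergence. -/
theorem exists_divergence_of_connection (δ : A.Divergence)
    (nabla : L →ₗ[ℝ] S.vec.gr n →ₗ[ℝ] S.vec.gr n)
    (hs : ∀ (f : K) X Λ, nabla (f • X) Λ = f • nabla X Λ)
    (hl : ∀ (f : K) X Λ, nabla X (f • Λ) = A.act X f • Λ + f • nabla X Λ) :
    ∃ δ' : A.Divergence, ∀ X Λ, (nabla X Λ : Ω') = -(S.ofL X * S.divOp δ' Λ) := by
  have h1 : ∀ X, ∃ f : K, ∀ Λ : S.vec.gr n,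
      -(S.ofL X * S.divOp δ Λ) - nabla X Λ = f • (Λ : Ω') := fun X => by
    obtain ⟨f, hf⟩ := S.exists_smul_top
      { toFun := fun Λ => ⟨-(S.ofL X * S.divOp δ Λ) - nabla X Λ,
          Submodule.sub_mem _ (S.ofL_mul_divOp_mem δ X Λ.2) (nabla X Λ).2⟩
        map_add' := fun Λ Λ' => Subtype.ext (by
          simp only [map_add, Submodule.coe_add, mul_add, neg_add]
          abel)
        map_smul' := fun f Λ => Subtype.ext (by
          simp only [Submodule.coe_smul, S.ofL_mul_divOp_smul δ f X Λ.2, hl, Submodule.coe_add,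
            RingHom.id_apply, smul_sub]
          abel) }
    exact ⟨f, fun Λ => congrArg Subtype.val (hf Λ)⟩
  choose θ hθ using h1
  have huniq : ∀ {a b : K}, (∀ Λ : S.vec.gr n, a • (Λ : Ω') = b • (Λ : Ω')) → a = b := fun h =>
    sub_eq_zero.1 (S.eq_zero_of_smul_top fun Λ hΛ => by rw [sub_smul, h ⟨Λ, hΛ⟩, sub_self])
  have hadd : ∀ X Y, θ (X + Y) = θ X + θ Y := fun X Y => huniq fun Λ => by
    rw [add_smul, ← hθ, ← hθ, ← hθ]
    simp only [map_add, LinearMap.add_apply, Submodule.coe_add, add_mul]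
    abel
  have hsmul : ∀ (f : K) X, θ (f • X) = f * θ X := fun f X => huniq fun Λ => by
    rw [mul_smul, ← hθ, ← hθ, hs, map_smul, smul_mul_assoc, Submodule.coe_smul, smul_sub, smul_neg]
  let Θ : L →ₗ[K] K := ⟨⟨θ, hadd⟩, hsmul⟩
  let δ' : A.Divergence := ⟨δ.div + Θ.restrictScalars ℝ, fun f X => by
    have : Θ (f • X) = f * Θ X := hsmul f X
    simp only [LinearMap.add_apply, LinearMap.restrictScalars_apply, this, δ.div_smul]
    ring⟩
  refine ⟨δ', fun X Λ => ?_⟩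
  have h2 := (S.genBracket_isSchouten δ).ofL_top S δ X Λ.2
  rw [(S.genBracket_isSchouten δ).ofL_top S δ' X Λ.2] at h2
  have h3 : δ'.div X = δ.div X + θ X := rfl
  rw [h3, add_smul, ← hθ, sub_eq_add_neg, sub_eq_add_neg] at h2
  have h4 : -(S.ofL X * S.divOp δ' Λ) - nabla X Λ = 0 := by
    rw [← sub_eq_zero] at h2
    rw [← h2]
    abel
  exact (sub_eq_zero.1 h4).symm

/-- The curvature of the connection defined by a divergence. -/
theorem curvature_eq_mul_divOp_divOp (X Y : L) {Λ : Ω'} (hΛ : Λ ∈ S.vec.gr n) :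
    S.ofL X * S.divOp δ (S.ofL Y * S.divOp δ Λ) - S.ofL Y * S.divOp δ (S.ofL X * S.divOp δ Λ)
      + S.ofL (A.bracket X Y) * S.divOp δ Λ =
      -(S.ofL X * S.ofL Y * S.divOp δ (S.divOp δ Λ)) := by
  rcases n with _ | n
  · simp [S.divOp_zero δ hΛ]
  · have hW := S.divOp_mem δ hΛ
    rw [← S.genBracket_sections δ, S.genBracket_apply _ (S.ofL_mem X)]
    have h := S.divOp_mul_mul δ (S.ofL_mem X) (S.ofL_mem Y) hW
    rw [S.vec.eq_zero_of_lt (by omega : n + 1 < 1 + 1 + n)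
      (S.vec.mul_mem (S.vec.mul_mem (S.ofL_mem X) (S.ofL_mem Y)) hW), map_zero] at h
    simp only [pow_one, neg_smul, one_smul, mul_one, Nat.reduceAdd, neg_one_sq] at h ⊢
    rw [← sub_eq_zero, ← sub_eq_zero.2 h]
    simp only [sub_mul, neg_mul]
    abel

/-- The connection on the top degree defined by a divergence, `∇_X Λ = -X ∧ DΛ`. -/
noncomputable def connection : L →ₗ[ℝ] S.vec.gr n →ₗ[ℝ] S.vec.gr n :=
  LinearMap.mk₂ ℝ (fun X Λ => ⟨-(S.ofL X * S.divOp δ Λ), S.ofL_mul_divOp_mem δ X Λ.2⟩)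
    (fun X Y Λ => Subtype.ext (by
      rw [Submodule.coe_add]
      simp only [map_add, add_mul, neg_add]))
    (fun r X Λ => Subtype.ext (by
      rw [Submodule.coe_smul_of_tower]
      simp only [LinearMap.map_smul_of_tower, smul_mul_assoc, smul_neg]))
    (fun X Λ Λ' => Subtype.ext (by
      simp only [Submodule.coe_add, map_add, mul_add, neg_add]))
    (fun r X Λ => Subtype.ext (by
      simp only [Submodule.coe_smul_of_tower, map_smul, mul_smul_comm, smul_neg]))

theorem connection_apply (X : L) (Λ : S.vec.gr n) :
    (S.connection δ X Λ : Ω') = -(S.ofL X * S.divOp δ Λ) := rfl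

theorem connection_smul_left (f : K) (X : L) (Λ : S.vec.gr n) :
    S.connection δ (f • X) Λ = f • S.connection δ X Λ :=
  Subtype.ext (by rw [Submodule.coe_smul, connection_apply, connection_apply, map_smul,
    smul_mul_assoc, smul_neg])

theorem connection_smul (f : K) (X : L) (Λ : S.vec.gr n) :
    S.connection δ X (f • Λ) = A.act X f • Λ + f • S.connection δ X Λ :=
  Subtype.ext (S.ofL_mul_divOp_smul δ f X Λ.2)

theorem connection_curvature (X Y : L) (Λ : S.vec.gr n) :
    (S.connection δ X (S.connection δ Y Λ) - S.connection δ Y (S.connection δ X Λ) -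
      S.connection δ (A.bracket X Y) Λ : S.vec.gr n) =
      -(S.ofL X * S.ofL Y * S.divOp δ (S.divOp δ Λ)) := by
  rw [← S.curvature_eq_mul_divOp_divOp δ X Y Λ.2, Submodule.coe_sub, Submodule.coe_sub]
  simp only [connection_apply, map_neg, mul_neg, neg_neg, sub_neg_eq_add]

/-- The curvature of the connection is the two-form which represents the square of the operator. -/
theorem connection_curvature_eq_smul {R : Ω} (hR : R ∈ S.form.gr 2)
    (hDD : ∀ U, S.divOp δ (S.divOp δ U) = -S.I R U) (X Y : L) (Λ : S.vec.gr n) :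
    S.connection δ X (S.connection δ Y Λ) - S.connection δ Y (S.connection δ X Λ) -
      S.connection δ (A.bracket X Y) Λ = S.vec.aug (S.I R (S.ofL X * S.ofL Y)) • Λ :=
  Subtype.ext (by
    rw [S.connection_curvature, hDD, mul_neg, neg_neg, S.mul_I_top hR
      (S.vec.mul_mem (S.ofL_mem X) (S.ofL_mem Y)) Λ.2, S.I_ofL_mul_ofL hR, S.vec.aug_algebraMap,
      Submodule.coe_smul, Algebra.smul_def])

omit [Module ℝ L] [IsScalarTower ℝ K L] in
/-- Two-forms are determined by their action on the top degree. -/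
theorem eq_of_smul_top {R R' : Ω} (hR : R ∈ S.form.gr 2) (hR' : R' ∈ S.form.gr 2)
    (h : ∀ X Y, ∀ Λ : S.vec.gr n, S.vec.aug (S.I R (S.ofL X * S.ofL Y)) • Λ =
      S.vec.aug (S.I R' (S.ofL X * S.ofL Y)) • Λ) : R = R' := by
  refine S.form.eq_of_con_con hR hR' fun X Y => sub_eq_zero.1 (S.eq_zero_of_smul_top fun Λ hΛ => ?_)
  have h1 := congrArg Subtype.val (h X Y ⟨Λ, hΛ⟩)
  rw [S.I_ofL_mul_ofL hR, S.I_ofL_mul_ofL hR', S.vec.aug_algebraMap, S.vec.aug_algebraMap] at h1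
  rw [sub_smul]
  exact sub_eq_zero.2 h1

/-- The connection is flat if and only if the operator has square zero. -/
theorem connection_flat_iff :
    (∀ X Y (Λ : S.vec.gr n), S.connection δ X (S.connection δ Y Λ) -
      S.connection δ Y (S.connection δ X Λ) - S.connection δ (A.bracket X Y) Λ = 0) ↔
      ∀ U, S.divOp δ (S.divOp δ U) = 0 := by
  refine ⟨fun h U => ?_, fun h X Y Λ => Subtype.ext ?_⟩
  · obtain ⟨R, hR, hDD⟩ := S.exists_divOp_divOp_eq δ
    have h0 : R = 0 := S.eq_of_smul_top hR (Submodule.zero_mem _) fun X Y Λ => by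
      rw [← S.connection_curvature_eq_smul δ hR hDD, h, map_zero, LinearMap.zero_apply, map_zero,
        zero_smul]
    rw [hDD, h0, map_zero, LinearMap.zero_apply, neg_zero]
  · rw [S.connection_curvature, h, mul_zero, neg_zero, Submodule.coe_zero]

end ContractionPair

/-! ### The Cartan formula for the differential -/

namespace ContractionPair

variable {n : ℕ} {M K L Ω Ω' : Type*} [CommRing K] [Algebra ℝ K]
    [AddCommGroup L] [Module K L] [Module ℝ L]
    [Ring Ω] [Algebra ℝ Ω] [Algebra K Ω] [Ring Ω'] [Algebra ℝ Ω'] [Algebra K Ω']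
    [IsScalarTower ℝ K Ω] [IsScalarTower ℝ K Ω']
    (S : ContractionPair n M K L Ω Ω') (A : LieRinehart K L)

/-- The product, in increasing order, of those sections `X i` with `i ∉ s`. -/
def wedge {m : ℕ} (X : Fin m → L) (s : Finset (Fin m)) : Ω' :=
  (((List.finRange m).filter (fun i => i ∉ s)).map (fun i => S.ofL (X i))).prod

omit [Module ℝ L] [IsScalarTower ℝ K Ω] [IsScalarTower ℝ K Ω'] in
theorem wedge_succ {m : ℕ} (X : Fin (m + 1) → L) {s : Finset (Fin (m + 1))} {t : Finset (Fin m)}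
    (h : ∀ i, i.succ ∈ s ↔ i ∈ t) :
    S.wedge X s = (if 0 ∈ s then 1 else S.ofL (X 0)) * S.wedge (fun i => X i.succ) t := by
  have h' : (((List.finRange m).map Fin.succ).filter fun i => i ∉ s) =
      ((List.finRange m).filter fun i => i ∉ t).map Fin.succ := by
    rw [List.filter_map]
    congr 1
    refine List.filter_congr fun i _ => ?_
    simp [h]
  rw [wedge, wedge, List.finRange_succ, List.filter_cons, h']
  split_ifs with h1 h2 h2 <;> simp_all [Function.comp_def]

/-- The value of a form on a multivector. -/
def pair (η : Ω) (U : Ω') : K := S.vec.aug (S.I η U)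

omit [Module ℝ L] [IsScalarTower ℝ K Ω] [IsScalarTower ℝ K Ω'] in
theorem aug_ofL_mul (X : L) (U : Ω') : S.vec.aug (S.ofL X * U) = 0 := by
  refine S.vec.induction_gr (Q := fun U => S.vec.aug (S.ofL X * U) = 0) (fun a b ha hb => ?_) ?_
    (fun k a ha => ?_) U
  · rw [mul_add, map_add, ha, hb, add_zero]
  · rw [mul_zero, map_zero]
  · have h := S.vec.mul_mem (S.ofL_mem X) ha
    rw [add_comm 1 k] at h
    exact S.vec.aug_of_pos h

omit [Module ℝ L] in
theorem pair_ofL_mul {k : ℕ} {η : Ω} (hη : η ∈ S.form.gr k) (X : L) (U : Ω') :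
    S.pair η (S.ofL X * U) = S.pair (S.form.con X η) U := by
  rw [pair, S.I_ofL_mul X hη, map_add, LinearMap.map_smul_of_tower, S.aug_ofL_mul, smul_zero,
    add_zero, pair]

omit [Module ℝ L] [IsScalarTower ℝ K Ω] [IsScalarTower ℝ K Ω'] in
theorem pair_ofL_mul_ofL_mul (η : Ω) (X Y : L) (U : Ω') :
    S.pair η (S.ofL X * (S.ofL Y * U)) = -S.pair η (S.ofL Y * (S.ofL X * U)) := by
  rw [← mul_assoc, S.vec.mul_comm' (S.ofL_mem X) (S.ofL_mem Y), mul_one, pow_one, neg_smul,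
    one_smul, neg_mul, mul_assoc, pair, map_neg, map_neg, pair]

theorem pair_lie (X : L) {k : ℕ} {η : Ω} (hη : η ∈ S.form.gr k) (Y : Fin k → L) :
    S.pair (A.lie S.form X η) (S.wedge Y ∅) = A.act X (S.pair η (S.wedge Y ∅)) -
      ∑ j : Fin k, (-1 : ℝ) ^ (j : ℕ) • S.pair η (S.ofL (A.bracket X (Y j)) * S.wedge Y {j}) := by
  induction k generalizing η with
  | zero =>
    have h1 : ∀ f : K, S.pair (algebraMap K Ω f) (S.wedge Y ∅) = f := fun f => by
      have : S.vec.aug 1 = 1 := by rw [← map_one (algebraMap K Ω'), S.vec.aug_algebraMap]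
      simp [wedge, pair, I_algebraMap, this]
    rw [A.lie_of_mem_zero S.form X hη, h1]
    conv_rhs => rw [← S.form.algebraMap_aug hη]
    rw [h1]
    simp
  | succ k ih =>
    have hη' := S.form.con_mem (Y 0) hη
    rw [S.wedge_succ Y (t := ∅) (by simp), if_neg (by simp), S.pair_ofL_mul (A.lie_mem _ X hη),
      A.con_lie, S.pair_ofL_mul hη]
    have h1 : ∀ a b U, S.pair (a - b) U = S.pair a U - S.pair b U := fun a b U => by
      rw [pair, map_sub, LinearMap.sub_apply, map_sub, pair, pair]
    rw [h1, ih hη', Fin.sum_univ_succ, S.wedge_succ Y (s := {0}) (t := ∅) (by simp),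
      if_pos (by simp), ← S.pair_ofL_mul hη (A.bracket X (Y 0))]
    have h2 : ∀ j : Fin k, S.pair η (S.ofL (A.bracket X (Y j.succ)) * S.wedge Y {j.succ}) =
        -S.pair (S.form.con (Y 0) η) (S.ofL (A.bracket X (Y j.succ)) *
          S.wedge (fun i => Y i.succ) {j}) := fun j => by
      rw [S.wedge_succ Y (t := {j}) (by simp), if_neg (by simp [eq_comm]),
        S.pair_ofL_mul_ofL_mul, S.pair_ofL_mul hη]
    simp only [h2, Fin.val_zero, pow_zero, one_smul, one_mul, Fin.val_succ, pow_succ, mul_neg,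
      mul_one, neg_smul, smul_neg, neg_neg]
    abel

/-- Cartan's formula for the values of `dη`, by induction from `i_X d + d i_X = L_X`. -/
theorem pair_d {k : ℕ} {η : Ω} (hη : η ∈ S.form.gr k) (X : Fin (k + 1) → L) :
    S.pair (A.d S.form η) (S.wedge X ∅) =
      ∑ i : Fin (k + 1), (-1 : ℝ) ^ (i : ℕ) • A.act (X i) (S.pair η (S.wedge X {i})) +
      ∑ i : Fin (k + 1), ∑ j : Fin (k + 1), if i < j then (-1 : ℝ) ^ ((i : ℕ) + (j : ℕ)) •
        S.pair η (S.ofL (A.bracket (X i) (X j)) * S.wedge X {i, j}) else 0 := by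
  induction k using Nat.strong_induction_on generalizing η with
  | _ k ih =>
  have h1 : ∀ a b U, S.pair (a - b) U = S.pair a U - S.pair b U := fun a b U => by
    rw [pair, map_sub, LinearMap.sub_apply, map_sub, pair, pair]
  have hw1 : ∀ i : Fin k, S.wedge X {i.succ} =
      S.ofL (X 0) * S.wedge (fun i => X i.succ) {i} := fun i => by
    rw [S.wedge_succ X (t := {i}) (by simp), if_neg (by simp [eq_comm])]
  have hw2 : ∀ i : Fin k, S.wedge X {0, i.succ} = S.wedge (fun i => X i.succ) {i} := fun i => by
    rw [S.wedge_succ X (t := {i}) (by simp), if_pos (by simp), one_mul]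
  have hw3 : ∀ i j : Fin k, S.wedge X {i.succ, j.succ} =
      S.ofL (X 0) * S.wedge (fun i => X i.succ) {i, j} := fun i j => by
    rw [S.wedge_succ X (t := {i, j}) (by simp), if_neg (by simp [eq_comm])]
  have hd : S.pair (A.d S.form (S.form.con (X 0) η)) (S.wedge (fun i => X i.succ) ∅) =
      ∑ i : Fin k, (-1 : ℝ) ^ (i : ℕ) • A.act (X i.succ) (S.pair η (S.wedge X {i.succ})) -
      ∑ i : Fin k, ∑ j : Fin k, if i < j then (-1 : ℝ) ^ ((i : ℕ) + (j : ℕ)) •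
        S.pair η (S.ofL (A.bracket (X i.succ) (X j.succ)) * S.wedge X {i.succ, j.succ}) else 0 := by
    rcases k with _ | k
    · rw [S.form.con_zero _ hη, map_zero]
      simp [pair]
    · rw [ih k (Nat.lt_succ_self k) (S.form.con_mem (X 0) hη), sub_eq_add_neg, ← Finset.sum_neg_distrib]
      simp only [hw1, hw3, S.pair_ofL_mul_ofL_mul _ (A.bracket _ _) (X 0), S.pair_ofL_mul hη (X 0),
        ← Finset.sum_neg_distrib]
      congr 1
      refine Finset.sum_congr rfl fun i _ => Finset.sum_congr rfl fun j _ => ?_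
      split_ifs
      · rw [smul_neg, neg_neg]
      · rw [neg_zero]
  have hl := S.pair_lie A (X 0) hη (fun i => X i.succ)
  rw [S.wedge_succ X (t := ∅) (by simp), if_neg (by simp), S.pair_ofL_mul (A.d_mem _ hη), A.con_d,
    h1, hl, hd, Fin.sum_univ_succ, S.wedge_succ X (s := {0}) (t := ∅) (by simp), if_pos (by simp),
    Fin.sum_univ_succ (fun i => ∑ j, _), Fin.sum_univ_succ]
  simp only [Fin.sum_univ_succ (fun j : Fin (k + 1) => ite _ _ _), hw2, Fin.val_zero, pow_zero,
    one_smul, one_mul, Fin.val_succ, lt_irrefl, if_false, Fin.succ_pos, if_true, Fin.succ_lt_succ_iff,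
    Fin.not_lt_zero, zero_add, pow_succ, mul_neg, mul_one, neg_smul, Finset.sum_neg_distrib]
  have hs : ∀ i j : Fin k, (-1 : ℝ) ^ ((i : ℕ) + 1 + ((j : ℕ) + 1)) = (-1) ^ ((i : ℕ) + (j : ℕ)) :=
    fun i j => by rw [show (i : ℕ) + 1 + ((j : ℕ) + 1) = i + j + 2 by ring, pow_add]; simp
  simp only [hs]
  abel

omit [Module ℝ L] in
/-- A form is determined by its values on sections. -/
theorem eq_zero_of_pair_wedge {k : ℕ} {η : Ω} (hη : η ∈ S.form.gr k)
    (h : ∀ X : Fin k → L, S.pair η (S.wedge X ∅) = 0) : η = 0 := by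
  induction k generalizing η with
  | zero =>
    have h1 := h Fin.elim0
    rw [← S.form.algebraMap_aug hη] at h1 ⊢
    have : S.vec.aug 1 = 1 := by rw [← map_one (algebraMap K Ω'), S.vec.aug_algebraMap]
    simp only [wedge, pair, I_algebraMap, List.finRange_zero, List.filter_nil, List.map_nil,
      List.prod_nil, map_smul, this, smul_eq_mul, mul_one] at h1
    rw [h1, map_zero]
  | succ k ih =>
    refine S.form.eq_zero_of_con hη fun X => ih (S.form.con_mem X hη) fun Y => ?_
    have h1 := h (Fin.cons X Y)
    rw [S.wedge_succ _ (t := ∅) (by simp), if_neg (by simp), S.pair_ofL_mul hη] at h1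
    simpa using h1

end ContractionPair

namespace ContractionPair

variable {n : ℕ} {M K L Ω Ω' : Type*} [CommRing K] [Algebra ℝ K]
    [AddCommGroup L] [Module K L]
    [Ring Ω] [Algebra ℝ Ω] [Algebra K Ω] [Ring Ω'] [Algebra ℝ Ω'] [Algebra K Ω']
    [IsScalarTower ℝ K Ω] [IsScalarTower ℝ K Ω']
    (S : ContractionPair n M K L Ω Ω')

/-! ### Multivectors as contractions of top degree elements -/

/-- Every multivector of degree `n - j` is locally of the form `η ⌟ Λ`. -/
theorem exists_I_top_eq (m : M) : ∃ Λ ∈ S.vec.gr n, ∀ j k, k + j = n → ∀ U ∈ S.vec.gr k,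
    ∃ η ∈ S.form.gr j, S.I η Λ = S.vec.cut m ^ (n + j) • U := by
  obtain ⟨Λ, hΛ, μ, hμ, hμΛ⟩ := S.exists_top m
  refine ⟨Λ, hΛ, fun j => ?_⟩
  induction j with
  | zero =>
    rintro k rfl U hU
    refine ⟨_, S.form.algebraMap_mem (S.vec.aug (S.I μ U)), ?_⟩
    rw [S.I_algebraMap, ← S.aug_smul_top hμ hΛ hU, hμΛ, S.vec.aug_algebraMap]
  | succ j ih =>
    intro k hk U hU
    obtain ⟨e, p, he, hep, -, hE⟩ := S.vec.frame m
    have h1 : ∀ i, ∃ η ∈ S.form.gr j, S.I η Λ = S.vec.cut m ^ (n + j) • (e i * U) := fun i =>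
      ih (1 + k) (by omega) _ (S.vec.mul_mem (he i) hU)
    choose η hη hηΛ using h1
    refine ⟨((j : ℝ) + 1)⁻¹ • ∑ i, η i * p i, Submodule.smul_of_tower_mem _ _
      (Submodule.sum_mem _ fun i _ => S.form.mul_mem (hη i) (p i).2), ?_⟩
    have h2 : ∑ i, S.vec.con (p i) (e i * U) = ((j : ℝ) + 1) • S.vec.cut m • U := by
      simp only [S.vec.con_mul_one (he _), hep, if_true, Finset.sum_sub_distrib, hE k U hU,
        ← Algebra.smul_def, Finset.sum_const, Finset.card_univ, Fintype.card_fin]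
      rw [← Nat.cast_smul_eq_nsmul ℝ, ← sub_smul]
      congr 1
      rw [← hk]
      push_cast
      ring
    simp only [S.I_real_smul, map_sum, LinearMap.sum_apply, S.I_mul, hηΛ, map_smul, S.I_one_form,
      ← Finset.smul_sum, h2]
    rw [smul_comm (S.vec.cut m ^ _), smul_smul, inv_mul_cancel₀ (by positivity), one_smul, smul_smul,
      ← pow_succ, add_assoc]

end ContractionPair

/-! ### Exterior algebra of a vector space -/

section ExteriorAlgebra

variable {W : Type*} [AddCommGroup W] [Module ℝ W] {W' : Type*} [AddCommGroup W'] [Module ℝ W']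

/-- The interior product of a multivector with a covector. -/
def intProd : Module.Dual ℝ W →ₗ[ℝ] ExteriorAlgebra ℝ W →ₗ[ℝ] ExteriorAlgebra ℝ W :=
  CliffordAlgebra.contractLeft (Q := (0 : QuadraticForm ℝ W))

theorem intProd_ι_mul (α : Module.Dual ℝ W) (w : W) (v : ExteriorAlgebra ℝ W) :
    intProd α (ExteriorAlgebra.ι ℝ w * v) = α w • v - ExteriorAlgebra.ι ℝ w * intProd α v :=
  CliffordAlgebra.contractLeft_ι_mul (Q := (0 : QuadraticForm ℝ W)) α w v

theorem intProd_algebraMap (α : Module.Dual ℝ W) (r : ℝ) :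
    intProd α (algebraMap ℝ (ExteriorAlgebra ℝ W) r) = 0 :=
  CliffordAlgebra.contractLeft_algebraMap (Q := (0 : QuadraticForm ℝ W)) α r

theorem intProd_ι (α : Module.Dual ℝ W) (w : W) :
    intProd α (ExteriorAlgebra.ι ℝ w) = algebraMap ℝ _ (α w) :=
  CliffordAlgebra.contractLeft_ι (Q := (0 : QuadraticForm ℝ W)) α w

theorem intProd_intProd (α : Module.Dual ℝ W) (v : ExteriorAlgebra ℝ W) :
    intProd α (intProd α v) = 0 :=
  CliffordAlgebra.contractLeft_contractLeft (Q := (0 : QuadraticForm ℝ W)) (d := α) v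

/-- Induction principle for homogeneous multivectors. -/
theorem exteriorPower_induction {C : ℕ → ExteriorAlgebra ℝ W → Prop}
    (h0 : ∀ r, C 0 (algebraMap ℝ _ r)) (hadd : ∀ k x y, C k x → C k y → C k (x + y))
    (hmul : ∀ k w, ∀ x ∈ ⋀[ℝ]^k W, C k x → C (k + 1) (ExteriorAlgebra.ι ℝ w * x)) {k : ℕ}
    {x : ExteriorAlgebra ℝ W} (hx : x ∈ ⋀[ℝ]^k W) : C k x := by
  refine Submodule.pow_induction_on_left' (M := LinearMap.range (ExteriorAlgebra.ι ℝ (M := W)))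
    (C := fun k x _ => C k x) h0 (fun x y k _ _ => hadd k x y) ?_ hx
  rintro _ ⟨w, rfl⟩ k x hx
  exact hmul k w x hx

theorem algebraMap_mem_exteriorPower (r : ℝ) : algebraMap ℝ _ r ∈ ⋀[ℝ]^0 W := by
  rw [ExteriorAlgebra.exteriorPower, pow_zero]
  exact Submodule.algebraMap_mem r

theorem ι_mem_exteriorPower (w : W) : ExteriorAlgebra.ι ℝ w ∈ ⋀[ℝ]^1 W := by
  rw [ExteriorAlgebra.exteriorPower, pow_one]
  exact LinearMap.mem_range_self _ _

theorem mul_mem_exteriorPower {j k : ℕ} {x y : ExteriorAlgebra ℝ W} (hx : x ∈ ⋀[ℝ]^j W)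
    (hy : y ∈ ⋀[ℝ]^k W) : x * y ∈ ⋀[ℝ]^(j + k) W := by
  rw [ExteriorAlgebra.exteriorPower, pow_add]
  exact Submodule.mul_mem_mul hx hy

theorem ι_mul_mem_exteriorPower (w : W) {k : ℕ} {x : ExteriorAlgebra ℝ W} (hx : x ∈ ⋀[ℝ]^k W) :
    ExteriorAlgebra.ι ℝ w * x ∈ ⋀[ℝ]^(k + 1) W := by
  rw [add_comm]
  exact mul_mem_exteriorPower (ι_mem_exteriorPower w) hx

theorem ιInv_of_mem {x : ExteriorAlgebra ℝ W} (hx : x ∈ ⋀[ℝ]^1 W) :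
    ExteriorAlgebra.ι ℝ (ExteriorAlgebra.ιInv x) = x := by
  rw [ExteriorAlgebra.exteriorPower, pow_one] at hx
  obtain ⟨w, rfl⟩ := hx
  rw [ExteriorAlgebra.ι_leftInverse]

theorem algebraMapInv_of_mem {x : ExteriorAlgebra ℝ W} (hx : x ∈ ⋀[ℝ]^0 W) :
    algebraMap ℝ _ (ExteriorAlgebra.algebraMapInv x) = x := by
  rw [ExteriorAlgebra.exteriorPower, pow_zero, Submodule.mem_one] at hx
  obtain ⟨r, rfl⟩ := hx
  rw [ExteriorAlgebra.algebraMap_leftInverse]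

theorem algebraMapInv_ι (w : W) : ExteriorAlgebra.algebraMapInv (ExteriorAlgebra.ι ℝ w) = 0 := by
  simp [ExteriorAlgebra.algebraMapInv]

theorem algebraMapInv_of_pos {k : ℕ} {x : ExteriorAlgebra ℝ W} (hx : x ∈ ⋀[ℝ]^(k + 1) W) :
    ExteriorAlgebra.algebraMapInv x = 0 := by
  refine exteriorPower_induction (C := fun k x => 0 < k → ExteriorAlgebra.algebraMapInv x = 0)
    (fun r h => absurd h (lt_irrefl 0)) (fun k x y hx hy h => ?_) (fun k w x _ _ _ => ?_) hx
    (Nat.succ_pos k)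
  · rw [map_add, hx h, hy h, add_zero]
  · rw [map_mul, algebraMapInv_ι, zero_mul]

theorem intProd_of_mem_zero (α : Module.Dual ℝ W) {x : ExteriorAlgebra ℝ W}
    (hx : x ∈ ⋀[ℝ]^0 W) : intProd α x = 0 := by
  rw [← algebraMapInv_of_mem hx, intProd_algebraMap]

theorem intProd_mem (α : Module.Dual ℝ W) {k : ℕ} {x : ExteriorAlgebra ℝ W}
    (hx : x ∈ ⋀[ℝ]^(k + 1) W) : intProd α x ∈ ⋀[ℝ]^k W := by
  refine exteriorPower_induction (C := fun k x => ∀ j, k = j + 1 → intProd α x ∈ ⋀[ℝ]^j W)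
    (fun r j h => ?_) (fun k x y hx hy j h => ?_) (fun k w x hx ih j h => ?_) hx k rfl
  · omega
  · rw [map_add]
    exact Submodule.add_mem _ (hx j h) (hy j h)
  · obtain rfl : k = j := by omega
    rw [intProd_ι_mul]
    refine Submodule.sub_mem _ (Submodule.smul_mem _ _ hx) ?_
    rcases k with _ | k
    · rw [intProd_of_mem_zero α hx, mul_zero]
      exact Submodule.zero_mem _
    · exact ι_mul_mem_exteriorPower w (ih k rfl)

theorem intProd_mul (α : Module.Dual ℝ W) {k : ℕ} {x : ExteriorAlgebra ℝ W}
    (hx : x ∈ ⋀[ℝ]^k W) (y : ExteriorAlgebra ℝ W) :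
    intProd α (x * y) = intProd α x * y + (-1 : ℝ) ^ k • (x * intProd α y) := by
  refine exteriorPower_induction (C := fun k x => intProd α (x * y) =
    intProd α x * y + (-1 : ℝ) ^ k • (x * intProd α y)) (fun r => ?_) (fun k x x' hx hx' => ?_)
    (fun k w x hx ih => ?_) hx
  · rw [intProd_algebraMap, ← Algebra.smul_def, ← Algebra.smul_def, map_smul]
    simp
  · rw [add_mul, map_add, map_add, hx, hx']
    simp only [add_mul, smul_add]
    abel
  · rw [mul_assoc, intProd_ι_mul, ih, intProd_ι_mul]
    simp only [mul_add, sub_mul, smul_mul_assoc, mul_smul_comm, mul_assoc, pow_succ, mul_neg_one,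
      neg_smul]
    abel

theorem ι_mul_comm (w : W) {k : ℕ} {x : ExteriorAlgebra ℝ W} (hx : x ∈ ⋀[ℝ]^k W) :
    ExteriorAlgebra.ι ℝ w * x = (-1 : ℝ) ^ k • (x * ExteriorAlgebra.ι ℝ w) := by
  refine exteriorPower_induction (C := fun k x => ExteriorAlgebra.ι ℝ w * x =
    (-1 : ℝ) ^ k • (x * ExteriorAlgebra.ι ℝ w)) (fun r => ?_) (fun k x x' hx hx' => ?_)
    (fun k w' x hx ih => ?_) hx
  · rw [pow_zero, one_smul, Algebra.commutes]
  · rw [mul_add, hx, hx', add_mul, smul_add]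
  · rw [← mul_assoc, eq_neg_of_add_eq_zero_left (ExteriorAlgebra.ι_add_mul_swap w w'), neg_mul,
      mul_assoc, ih, mul_smul_comm, pow_succ, mul_neg_one, neg_smul, mul_assoc]

theorem exteriorPower_mul_comm {j k : ℕ} {x y : ExteriorAlgebra ℝ W} (hx : x ∈ ⋀[ℝ]^j W)
    (hy : y ∈ ⋀[ℝ]^k W) : x * y = (-1 : ℝ) ^ (j * k) • (y * x) := by
  refine exteriorPower_induction (C := fun j x => x * y = (-1 : ℝ) ^ (j * k) • (y * x))
    (fun r => ?_) (fun k x x' hx hx' => ?_) (fun j w x hx ih => ?_) hx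
  · rw [zero_mul, pow_zero, one_smul, Algebra.commutes]
  · rw [add_mul, hx, hx', mul_add, smul_add]
  · rw [mul_assoc, ih, mul_smul_comm, ← mul_assoc, ι_mul_comm w hy, smul_mul_assoc, smul_smul,
      ← pow_add, mul_assoc, show j * k + k = (j + 1) * k by ring]

/-- The Euler identity `∑ eᵢ ∧ (pᵢ ⌟ x) = k x` for dual bases, here scaled by a factor `c`. -/
theorem sum_ι_mul_intProd {n : ℕ} {e : Fin n → W} {p : Fin n → Module.Dual ℝ W} {c : ℝ}
    (h : ∀ w, ∑ i, p i w • e i = c • w) {k : ℕ} {x : ExteriorAlgebra ℝ W} (hx : x ∈ ⋀[ℝ]^k W) :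
    ∑ i, ExteriorAlgebra.ι ℝ (e i) * intProd (p i) x = ((k : ℝ) * c) • x := by
  refine exteriorPower_induction (C := fun k x =>
    ∑ i, ExteriorAlgebra.ι ℝ (e i) * intProd (p i) x = ((k : ℝ) * c) • x) (fun r => ?_)
    (fun k x x' hx hx' => ?_) (fun k w x hx ih => ?_) hx
  · simp [intProd_algebraMap]
  · simp only [map_add, mul_add, Finset.sum_add_distrib, hx, hx', smul_add]
  · have h1 : ∀ i, ExteriorAlgebra.ι ℝ (e i) * intProd (p i) (ExteriorAlgebra.ι ℝ w * x) =
        ExteriorAlgebra.ι ℝ (p i w • e i) * x +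
          ExteriorAlgebra.ι ℝ w * (ExteriorAlgebra.ι ℝ (e i) * intProd (p i) x) := fun i => by
      rw [intProd_ι_mul, mul_sub, ← mul_assoc,
        eq_neg_of_add_eq_zero_left (ExteriorAlgebra.ι_add_mul_swap (e i) w), map_smul,
        mul_smul_comm, smul_mul_assoc, neg_mul, mul_assoc, sub_neg_eq_add]
    rw [Finset.sum_congr rfl fun i _ => h1 i, Finset.sum_add_distrib, ← Finset.sum_mul, ← map_sum, h,
      ← Finset.mul_sum, ih, map_smul, smul_mul_assoc, mul_smul_comm, ← add_smul]
    congr 1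
    push_cast
    ring

theorem exteriorPower_eq_bot [FiniteDimensional ℝ W] {k : ℕ} (hk : Module.finrank ℝ W < k) :
    (⋀[ℝ]^k W) = ⊥ := by
  have h : Module.finrank ℝ (⋀[ℝ]^k W) = _ := exteriorPower.finrank_eq ..
  rw [Nat.choose_eq_zero_of_lt hk] at h
  exact Submodule.finrank_eq_zero.1 h

/-- The homogeneous component of degree `k` of a multivector. -/
noncomputable def extProj (k : ℕ) : ExteriorAlgebra ℝ W →ₗ[ℝ] ExteriorAlgebra ℝ W :=
  GradedAlgebra.proj (fun i => ⋀[ℝ]^i W) k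

theorem extProj_mem (k : ℕ) (x : ExteriorAlgebra ℝ W) : extProj k x ∈ ⋀[ℝ]^k W :=
  (DirectSum.decompose (fun i => ⋀[ℝ]^i W) x k).2

theorem extProj_of_mem {k : ℕ} {x : ExteriorAlgebra ℝ W} (hx : x ∈ ⋀[ℝ]^k W) :
    extProj k x = x :=
  DirectSum.decompose_of_mem_same (fun i => ⋀[ℝ]^i W) hx

theorem extProj_of_ne {k j : ℕ} {x : ExteriorAlgebra ℝ W} (hx : x ∈ ⋀[ℝ]^k W) (h : j ≠ k) :
    extProj j x = 0 :=
  DirectSum.decompose_of_mem_ne (fun i => ⋀[ℝ]^i W) hx h.symm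

theorem sum_extProj [FiniteDimensional ℝ W] {n : ℕ} (hn : Module.finrank ℝ W = n)
    (x : ExteriorAlgebra ℝ W) : ∑ k ∈ Finset.range (n + 1), extProj k x = x := by
  classical
  conv_rhs => rw [← DirectSum.sum_support_decompose (fun i => ⋀[ℝ]^i W) x]
  refine (Finset.sum_subset (fun k hk => ?_) fun k _ hk => ?_).symm
  · by_contra h
    rw [Finset.mem_range, not_lt] at h
    refine (DFinsupp.mem_support_iff.1 hk) (Subtype.ext ?_)
    have := extProj_mem k x
    rwa [exteriorPower_eq_bot (by omega), Submodule.mem_bot] at this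
  · rw [DFinsupp.notMem_support_iff] at hk
    exact congrArg Subtype.val hk

theorem map_mem_exteriorPower (f : W →ₗ[ℝ] W') {k : ℕ} {x : ExteriorAlgebra ℝ W}
    (hx : x ∈ ⋀[ℝ]^k W) : ExteriorAlgebra.map f x ∈ ⋀[ℝ]^k W' := by
  refine exteriorPower_induction (C := fun k x => ExteriorAlgebra.map f x ∈ ⋀[ℝ]^k W')
    (fun r => ?_) (fun k x x' hx hx' => ?_) (fun k w x hx ih => ?_) hx
  · rw [AlgHom.commutes]
    exact algebraMap_mem_exteriorPower r
  · rw [map_add]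
    exact Submodule.add_mem _ hx hx'
  · rw [map_mul, ExteriorAlgebra.map_apply_ι]
    exact ι_mul_mem_exteriorPower _ ih

theorem extProj_map (f : W →ₗ[ℝ] W') (k : ℕ) (x : ExteriorAlgebra ℝ W) :
    extProj k (ExteriorAlgebra.map f x) = ExteriorAlgebra.map f (extProj k x) := by
  induction x using DirectSum.Decomposition.inductionOn (fun i => ⋀[ℝ]^i W) with
  | zero => simp
  | @homogeneous i x =>
    rcases eq_or_ne k i with rfl | h
    · rw [extProj_of_mem x.2, extProj_of_mem (map_mem_exteriorPower f x.2)]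
    · rw [extProj_of_ne x.2 h, extProj_of_ne (map_mem_exteriorPower f x.2) h, map_zero]
  | add x y hx hy => rw [map_add, map_add, hx, hy, map_add, map_add]

theorem algebraMapInv_map (f : W →ₗ[ℝ] W') (x : ExteriorAlgebra ℝ W) :
    ExteriorAlgebra.algebraMapInv (ExteriorAlgebra.map f x) = ExteriorAlgebra.algebraMapInv x := by
  have : (ExteriorAlgebra.algebraMapInv (R := ℝ) (M := W')).comp (ExteriorAlgebra.map f) =
      ExteriorAlgebra.algebraMapInv := ExteriorAlgebra.hom_ext (by ext w; simp [algebraMapInv_ι])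
  exact DFunLike.congr_fun this x

/-- The exterior algebra is spanned by products of vectors. -/
theorem exteriorAlgebra_induction {C : ExteriorAlgebra ℝ W → Prop} (h0 : ∀ r, C (algebraMap ℝ _ r))
    (hadd : ∀ x y, C x → C y → C (x + y))
    (hmul : ∀ w x, C x → C (ExteriorAlgebra.ι ℝ w * x)) (x : ExteriorAlgebra ℝ W) : C x := by
  induction x using DirectSum.Decomposition.inductionOn (fun i => ⋀[ℝ]^i W) with
  | zero => simpa using h0 0
  | @homogeneous i x =>
    exact exteriorPower_induction (C := fun _ x => C x) h0 (fun _ => hadd)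
      (fun _ w x _ => hmul w x) x.2
  | add x y hx hy => exact hadd x y hx hy

theorem map_intProd (f : W →ₗ[ℝ] W') (α : Module.Dual ℝ W') (x : ExteriorAlgebra ℝ W) :
    ExteriorAlgebra.map f (intProd (α ∘ₗ f) x) = intProd α (ExteriorAlgebra.map f x) := by
  refine exteriorAlgebra_induction (C := fun x => ExteriorAlgebra.map f (intProd (α ∘ₗ f) x) =
    intProd α (ExteriorAlgebra.map f x)) (fun r => ?_) (fun x y hx hy => ?_) (fun w x hx => ?_) x
  · rw [intProd_algebraMap, AlgHom.commutes, intProd_algebraMap, map_zero]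
  · simp only [map_add, hx, hy]
  · rw [intProd_ι_mul, map_sub, map_mul, map_mul, ExteriorAlgebra.map_apply_ι, intProd_ι_mul, hx,
      map_smul, LinearMap.comp_apply]

/-! ### Contractions with forms -/

/-- The contraction as a bilinear map. -/
def contractₗ (W : Type*) [AddCommGroup W] [Module ℝ W] :
    ExteriorAlgebra ℝ (Module.Dual ℝ W) →ₗ[ℝ] ExteriorAlgebra ℝ W →ₗ[ℝ] ExteriorAlgebra ℝ W :=
  (MulOpposite.opLinearEquiv ℝ).symm.toLinearMap ∘ₗ (contractHom W).toLinearMap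

theorem contractₗ_apply (θ : ExteriorAlgebra ℝ (Module.Dual ℝ W)) (v : ExteriorAlgebra ℝ W) :
    contractₗ W θ v = contract θ v := rfl

theorem contract_ι_eq (α : Module.Dual ℝ W) (v : ExteriorAlgebra ℝ W) :
    contract (ExteriorAlgebra.ι ℝ α) v = intProd α v := contract_ι α v

theorem contract_algebraMap (r : ℝ) (v : ExteriorAlgebra ℝ W) :
    contract (algebraMap ℝ _ r) v = r • v := by
  simp [contract, Module.algebraMap_end_apply]

theorem map_contract (f : W →ₗ[ℝ] W') (θ : ExteriorAlgebra ℝ (Module.Dual ℝ W'))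
    (v : ExteriorAlgebra ℝ W) :
    ExteriorAlgebra.map f (contract (ExteriorAlgebra.map f.dualMap θ) v) =
      contract θ (ExteriorAlgebra.map f v) := by
  refine exteriorAlgebra_induction (C := fun θ => ∀ v,
    ExteriorAlgebra.map f (contract (ExteriorAlgebra.map f.dualMap θ) v) =
      contract θ (ExteriorAlgebra.map f v)) (fun r v => ?_) (fun x y hx hy v => ?_)
      (fun α x hx v => ?_) θ v
  · rw [AlgHom.commutes, contract_algebraMap, contract_algebraMap, map_smul]
  · simp only [map_add, ← contractₗ_apply, LinearMap.add_apply] at hx hy ⊢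
    rw [hx, hy]
  · rw [map_mul, contract_mul, contract_mul, hx, ExteriorAlgebra.map_apply_ι, contract_ι_eq,
      contract_ι_eq, LinearMap.dualMap_apply', map_intProd]

end ExteriorAlgebra

/-! ### Graded algebras of smooth sections -/

section SmoothVector

variable {E : Type*} [NormedAddCommGroup E] [NormedSpace ℝ E]
  {M : Type*} [TopologicalSpace M] [ChartedSpace E M]
  {P Q R : Type*} [AddCommGroup P] [Module ℝ P] [AddCommGroup Q] [Module ℝ Q]
  [AddCommGroup R] [Module ℝ R]

/-- A map to a vector space (without a topology) all of whose components are smooth at `x₀`. -/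
def CoordSmoothAt (E : Type*) [NormedAddCommGroup E] [NormedSpace ℝ E] {M : Type*}
    [TopologicalSpace M] [ChartedSpace E M] {P : Type*} [AddCommGroup P] [Module ℝ P]
    (p : M → P) (x₀ : M) : Prop :=
  ∀ φ : P →ₗ[ℝ] ℝ, ContMDiffAt 𝓘(ℝ, E) 𝓘(ℝ, ℝ) ∞ (fun x => φ (p x)) x₀

theorem CoordSmoothAt.map {p : M → P} {x₀ : M} (h : CoordSmoothAt E p x₀) (f : P →ₗ[ℝ] Q) :
    CoordSmoothAt E (fun x => f (p x)) x₀ := fun φ => h (φ ∘ₗ f)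

theorem CoordSmoothAt.congr {p q : M → P} {x₀ : M} (h : CoordSmoothAt E p x₀)
    (hpq : q =ᶠ[𝓝 x₀] p) : CoordSmoothAt E q x₀ := fun φ =>
  (h φ).congr_of_eventuallyEq (hpq.mono fun _ hx => congrArg φ hx)

theorem CoordSmoothAt.bilin [FiniteDimensional ℝ P] [FiniteDimensional ℝ Q] {p : M → P} {q : M → Q}
    {x₀ : M} (hp : CoordSmoothAt E p x₀) (hq : CoordSmoothAt E q x₀) (f : P →ₗ[ℝ] Q →ₗ[ℝ] R) :
    CoordSmoothAt E (fun x => f (p x) (q x)) x₀ := fun φ => by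
  let b := Module.finBasis ℝ P
  let b' := Module.finBasis ℝ Q
  have h : ∀ x, φ (f (p x) (q x)) =
      ∑ i, ∑ j, b.coord i (p x) * b'.coord j (q x) * φ (f (b i) (b' j)) := fun x => by
    conv_lhs => rw [← b.sum_repr (p x), ← b'.sum_repr (q x)]
    simp only [map_sum, LinearMap.sum_apply, map_smul, LinearMap.smul_apply, smul_eq_mul,
      Module.Basis.coord_apply, Finset.mul_sum, mul_assoc]
    exact Finset.sum_comm.trans (Finset.sum_congr rfl fun i _ => Finset.sum_congr rfl fun j _ =>
      mul_left_comm _ _ _)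
  simp only [h]
  exact contMDiffAt_finsetSum fun i _ => contMDiffAt_finsetSum fun j _ =>
    ((hp (b.coord i)).mul (hq (b'.coord j))).mul contMDiffAt_const

theorem coordSmoothAt_iff {P : Type*} [NormedAddCommGroup P] [NormedSpace ℝ P]
    [FiniteDimensional ℝ P] {p : M → P} {x₀ : M} :
    CoordSmoothAt E p x₀ ↔ ContMDiffAt 𝓘(ℝ, E) 𝓘(ℝ, P) ∞ p x₀ := by
  refine ⟨fun h => ?_, fun h φ => ?_⟩
  · let b := Module.finBasis ℝ P
    have e : p = fun x => ∑ i, b.coord i (p x) • b i := funext fun x => (b.sum_repr (p x)).symm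
    rw [e]
    exact contMDiffAt_finsetSum fun i _ => (h (b.coord i)).smul contMDiffAt_const
  · exact (ContinuousLinearMap.contMDiff φ.toContinuousLinearMap _).comp x₀ h

instance finiteDimensional_exteriorAlgebra [FiniteDimensional ℝ P] :
    FiniteDimensional ℝ (ExteriorAlgebra ℝ P) := by
  classical
  exact Module.Finite.of_basis (Module.finBasis ℝ P).ExteriorAlgebra

end SmoothVector

section SmoothExterior

variable (E : Type*) [NormedAddCommGroup E] [NormedSpace ℝ E]
  {M : Type*} [TopologicalSpace M] [ChartedSpace E M]
  {G : Type*} [AddCommGroup G] [Module ℝ G] [FiniteDimensional ℝ G]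
  {W : M → Type*} [∀ x, AddCommGroup (W x)] [∀ x, Module ℝ (W x)]

/-- A `K`-module `P` of smooth sections of the dual of the bundle `W` of rank `n`, with dual frames
for `W` and `P` around each point, scaled by a bump function so that they are defined globally. -/
structure DualFrames (n : ℕ) (c : M → ∀ x, W x →ₗ[ℝ] G) (P : Type*) [AddCommGroup P]
    [Module C^∞⟮𝓘(ℝ, E), M; ℝ⟯ P] where
  /-- the value of a dual section at a point -/
  ev : P → ∀ x, Module.Dual ℝ (W x)
  /-- bump functions -/
  cut : M → C^∞⟮𝓘(ℝ, E), M; ℝ⟯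
  ev_add : ∀ p q x, ev (p + q) x = ev p x + ev q x
  ev_smul : ∀ (f : C^∞⟮𝓘(ℝ, E), M; ℝ⟯) p x, ev (f • p) x = f x • ev p x
  finiteDimensional : ∀ x, FiniteDimensional ℝ (W x)
  finrank_eq : ∀ x, Module.finrank ℝ (W x) = n
  smooth : ∀ p, ∀ σ ∈ smoothExterior E c, (fun x => intProd (ev p x) (σ x)) ∈ smoothExterior E c
  cut_eq_one : ∀ m, ∀ᶠ x in 𝓝 m, cut m x = 1
  frame : ∀ m, ∃ (e : Fin n → ∀ x, W x) (p : Fin n → P),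
    (∀ i, (fun x => ExteriorAlgebra.ι ℝ (e i x)) ∈ smoothExterior E c) ∧
    (∀ i j x, ev (p i) x (e j x) = if i = j then cut m x else 0) ∧
    (∀ q (f : Fin n → C^∞⟮𝓘(ℝ, E), M; ℝ⟯), (∀ i x, f i x = ev q x (e i x)) →
      cut m • q = ∑ i, f i • p i) ∧
    ∀ x w, ∑ i, ev (p i) x w • e i x = cut m x • w

variable {E} {c : M → ∀ x, W x →ₗ[ℝ] G}

theorem smoothExterior_ext {σ τ : smoothExterior E c} (h : ∀ x, σ.1 x = τ.1 x) : σ = τ :=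
  Subtype.ext (funext h)

theorem sum_smoothExterior_apply {ι : Type*} (s : Finset ι) (σ : ι → smoothExterior E c) (x : M) :
    (∑ i ∈ s, σ i).1 x = ∑ i ∈ s, (σ i).1 x := by
  rw [AddSubmonoidClass.coe_finsetSum, Finset.sum_apply]

theorem pow_smul_smoothExterior_apply (f : C^∞⟮𝓘(ℝ, E), M; ℝ⟯) (r : ℕ) (σ : smoothExterior E c)
    (x : M) : (f ^ r • σ).1 x = f x ^ r • σ.1 x := by
  rw [smoothExterior_smul_apply]
  rfl

/-- Smooth sections which agree where they are defined can be glued. -/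
theorem exists_glue (cut : M → C^∞⟮𝓘(ℝ, E), M; ℝ⟯) (hcut : ∀ m, ∀ᶠ x in 𝓝 m, cut m x = 1)
    (r : ℕ) (ζ : M → smoothExterior E c) (h : ∀ m m', cut m' ^ r • ζ m = cut m ^ r • ζ m') :
    ∃ a : smoothExterior E c, ∀ m, ζ m = cut m ^ r • a := by
  have h' : ∀ m x, (ζ m).1 x = cut m x ^ r • (ζ x).1 x := fun m x => by
    have := congrFun (congrArg Subtype.val (h m x)) x
    rw [pow_smul_smoothExterior_apply, pow_smul_smoothExterior_apply, (hcut x).self_of_nhds,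
      one_pow, one_smul] at this
    exact this
  refine ⟨⟨fun x => (ζ x).1 x, fun x₀ => CoordSmoothAt.congr ((ζ x₀).2 x₀) ?_⟩, fun m =>
    smoothExterior_ext fun x => ?_⟩
  · filter_upwards [hcut x₀] with x hx
    rw [h' x₀ x, hx, one_pow, one_smul]
  · rw [pow_smul_smoothExterior_apply, h' m x]

variable {n : ℕ} {P : Type*} [AddCommGroup P] [Module C^∞⟮𝓘(ℝ, E), M; ℝ⟯ P]

/-- The sections of the exterior algebra bundle of `W`, contracted with sections of the dual
bundle. -/
noncomputable def DualFrames.toContractionAlgebra (S : DualFrames E n c P) :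
    ContractionAlgebra n M C^∞⟮𝓘(ℝ, E), M; ℝ⟯ (smoothExterior E c) P where
  gr := homogeneous c
  proj k :=
    { toFun := fun σ => ⟨fun x => extProj k (σ.1 x), fun x₀ => by
        simp only [← extProj_map]
        exact CoordSmoothAt.map (σ.2 x₀) (extProj k)⟩
      map_add' := fun σ τ => smoothExterior_ext fun x => map_add _ _ _
      map_smul' := fun f σ => smoothExterior_ext fun x => by
        rw [RingHom.id_apply, smoothExterior_smul_apply]
        change extProj k ((f • σ).1 x) = f x • extProj k (σ.1 x)
        rw [smoothExterior_smul_apply, map_smul] }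
  aug :=
    { toFun := fun σ => ⟨fun x => ExteriorAlgebra.algebraMapInv (σ.1 x), fun x₀ => by
        simp only [← algebraMapInv_map (c x₀ _)]
        exact (σ.2 x₀) ExteriorAlgebra.algebraMapInv.toLinearMap⟩
      map_add' := fun σ τ => by
        ext x
        exact map_add ExteriorAlgebra.algebraMapInv (σ.1 x) (τ.1 x)
      map_smul' := fun f σ => by
        ext x
        change ExteriorAlgebra.algebraMapInv ((f • σ).1 x) =
          f x * ExteriorAlgebra.algebraMapInv (σ.1 x)
        rw [smoothExterior_smul_apply, map_smul, smul_eq_mul] }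
  con := LinearMap.mk₂ _ (fun p σ => ⟨fun x => intProd (S.ev p x) (σ.1 x), S.smooth p σ.1 σ.2⟩)
    (fun p q σ => smoothExterior_ext fun x => by
      change intProd (S.ev (p + q) x) (σ.1 x) = intProd (S.ev p x) (σ.1 x) + intProd (S.ev q x) (σ.1 x)
      rw [S.ev_add, map_add, LinearMap.add_apply])
    (fun f p σ => smoothExterior_ext fun x => by
      rw [smoothExterior_smul_apply]
      change intProd (S.ev (f • p) x) (σ.1 x) = f x • intProd (S.ev p x) (σ.1 x)
      rw [S.ev_smul, map_smul, LinearMap.smul_apply])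
    (fun p σ τ => smoothExterior_ext fun x => map_add _ _ _)
    (fun f p σ => smoothExterior_ext fun x => by
      rw [smoothExterior_smul_apply]
      change intProd (S.ev p x) ((f • σ).1 x) = f x • intProd (S.ev p x) (σ.1 x)
      rw [smoothExterior_smul_apply, map_smul])
  cut := S.cut
  proj_mem k σ x := extProj_mem k _
  proj_of_mem h := smoothExterior_ext fun x => extProj_of_mem (h x)
  proj_of_ne h hj := smoothExterior_ext fun x => extProj_of_ne (h x) hj
  sum_proj σ := smoothExterior_ext fun x => by
    have := S.finiteDimensional x
    rw [sum_smoothExterior_apply]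
    exact sum_extProj (S.finrank_eq x) (σ.1 x)
  mul_mem h h' x := mul_mem_exteriorPower (h x) (h' x)
  mul_comm' h h' := smoothExterior_ext fun x => exteriorPower_mul_comm (h x) (h' x)
  algebraMap_mem f x := algebraMap_mem_exteriorPower (f x)
  algebraMap_aug h := smoothExterior_ext fun x => algebraMapInv_of_mem (h x)
  aug_algebraMap f := by
    ext x
    exact ExteriorAlgebra.algebraMap_leftInverse _ (f x)
  aug_of_pos h := by
    ext x
    exact algebraMapInv_of_pos (h x)
  con_mem p h x := intProd_mem _ (h x)
  con_zero p h := smoothExterior_ext fun x => intProd_of_mem_zero _ (h x)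
  con_con p σ := smoothExterior_ext fun x => intProd_intProd _ _
  con_mul p σ h := smoothExterior_ext fun x => intProd_mul _ (h x) _
  frame m := by
    obtain ⟨e, p, he, h1, h2, h3⟩ := S.frame m
    refine ⟨fun i => ⟨_, he i⟩, p, fun i x => ι_mem_exteriorPower _, fun i j => ?_, fun q => ?_,
      fun k σ h => smoothExterior_ext fun x => ?_⟩
    · refine smoothExterior_ext fun x => ?_
      change intProd _ (ExteriorAlgebra.ι ℝ (e j x)) = _
      rw [intProd_ι, h1]
      split_ifs
      · rfl
      · exact map_zero _
    · refine h2 q _ fun i x => ?_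
      change ExteriorAlgebra.algebraMapInv (intProd (S.ev q x) (ExteriorAlgebra.ι ℝ (e i x))) = _
      rw [intProd_ι, ExteriorAlgebra.algebraMap_leftInverse]
    · rw [sum_smoothExterior_apply]
      change ∑ i, ExteriorAlgebra.ι ℝ (e i x) * intProd (S.ev (p i) x) (σ.1 x) =
        (k : ℝ) • (S.cut m • σ).1 x
      rw [sum_ι_mul_intProd (h3 x) (h x), smoothExterior_smul_apply, smul_smul]
  faithful_pow r σ h := smoothExterior_ext fun x => by
    have := congrFun (congrArg Subtype.val (h x)) x
    rw [pow_smul_smoothExterior_apply, (S.cut_eq_one x).self_of_nhds, one_pow, one_smul] at this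
    exact this
  glue_pow := exists_glue S.cut S.cut_eq_one

end SmoothExterior

/-! ### Local frames and contractions of a smooth vector bundle -/

section VectorBundle

variable {E : Type*} [NormedAddCommGroup E] [NormedSpace ℝ E]
  {M : Type*} [TopologicalSpace M] [ChartedSpace E M]
  {F : Type*} [NormedAddCommGroup F] [NormedSpace ℝ F] [FiniteDimensional ℝ F]
  {V : M → Type*} [TopologicalSpace (TotalSpace F V)]
  [∀ x, AddCommGroup (V x)] [∀ x, Module ℝ (V x)] [∀ x, TopologicalSpace (V x)]
  [FiberBundle F V] [VectorBundle ℝ F V]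

theorem eventually_mem_baseSet (F : Type*) [NormedAddCommGroup F] [NormedSpace ℝ F]
    (V : M → Type*) [TopologicalSpace (TotalSpace F V)]
    [∀ x, AddCommGroup (V x)] [∀ x, Module ℝ (V x)] [∀ x, TopologicalSpace (V x)]
    [FiberBundle F V] [VectorBundle ℝ F V] (x₀ : M) :
    ∀ᶠ x in 𝓝 x₀, x ∈ (trivializationAt F V x₀).baseSet :=
  (trivializationAt F V x₀).open_baseSet.mem_nhds (mem_baseSet_trivializationAt F V x₀)

omit [FiniteDimensional ℝ F] in
theorem symmₗ_vecCoord {x₀ x : M} (hx : x ∈ (trivializationAt F V x₀).baseSet) (v : V x) :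
    (trivializationAt F V x₀).symmₗ ℝ x (vecCoord F V x₀ x v) = v :=
  (trivializationAt F V x₀).symmₗ_linearMapAt hx v

omit [FiniteDimensional ℝ F] in
theorem map_vecCoord_dualMap {x₀ x : M} (hx : x ∈ (trivializationAt F V x₀).baseSet)
    (η : ExteriorAlgebra ℝ (Module.Dual ℝ (V x))) :
    ExteriorAlgebra.map (vecCoord F V x₀ x).dualMap
      (ExteriorAlgebra.map (covecCoord F V x₀ x) η) = η := by
  have h : (vecCoord F V x₀ x).dualMap ∘ₗ covecCoord F V x₀ x = LinearMap.id := by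
    ext α v
    exact congrArg α (symmₗ_vecCoord hx v)
  rw [← AlgHom.comp_apply, ExteriorAlgebra.map_comp_map, h, ExteriorAlgebra.map_id]
  rfl

/-- The contraction of a smooth multivector with a smooth form is smooth. -/
theorem contract_mem (η : Forms E F V) (U : Multivectors E F V) :
    (fun x => contract (η.1 x) (U.1 x)) ∈ Multivectors E F V := fun x₀ => by
  have h : CoordSmoothAt E (fun x => contractₗ F (ExteriorAlgebra.map (covecCoord F V x₀ x) (η.1 x))
      (ExteriorAlgebra.map (vecCoord F V x₀ x) (U.1 x))) x₀ :=
    CoordSmoothAt.bilin (η.2 x₀) (U.2 x₀) _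
  refine h.congr ?_
  filter_upwards [eventually_mem_baseSet F V x₀] with x hx
  rw [contractₗ_apply, ← map_contract, map_vecCoord_dualMap hx]

theorem coordSmoothAt_section (X : Cₛ^∞⟮𝓘(ℝ, E); F, V⟯) (x₀ : M) :
    CoordSmoothAt E (fun x => vecCoord F V x₀ x (X x)) x₀ := by
  refine CoordSmoothAt.congr (coordSmoothAt_iff.2 ((contMDiffAt_section x₀).1 (X.contMDiff x₀))) ?_
  filter_upwards [eventually_mem_baseSet F V x₀] with x hx
  exact congrFun ((trivializationAt F V x₀).coe_linearMapAt_of_mem hx) (X x)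

/-- The contraction of a smooth form with a smooth section is smooth. -/
theorem intProd_eval_mem (X : Cₛ^∞⟮𝓘(ℝ, E); F, V⟯) (η : Forms E F V) :
    (fun x => intProd (Module.Dual.eval ℝ (V x) (X x)) (η.1 x)) ∈ Forms E F V := fun x₀ => by
  have h : CoordSmoothAt E (fun x => (intProd ∘ₗ Module.Dual.eval ℝ F) (vecCoord F V x₀ x (X x))
      (ExteriorAlgebra.map (covecCoord F V x₀ x) (η.1 x))) x₀ :=
    CoordSmoothAt.bilin (coordSmoothAt_section X x₀) (η.2 x₀) _
  refine h.congr ?_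
  filter_upwards [eventually_mem_baseSet F V x₀] with x hx
  rw [LinearMap.comp_apply, ← map_intProd]
  congr 3
  ext α
  exact (congrArg α (symmₗ_vecCoord hx (X x))).symm

/-- A multivector of degree one as a section. -/
def toSec (U : Multivectors E F V) : Cₛ^∞⟮𝓘(ℝ, E); F, V⟯ where
  toFun x := ExteriorAlgebra.ιInv (U.1 x)
  contMDiff_toFun x₀ := by
    refine (contMDiffAt_section x₀).2 (coordSmoothAt_iff.1 ?_)
    refine CoordSmoothAt.congr (CoordSmoothAt.map (U.2 x₀) ExteriorAlgebra.ιInv) ?_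
    filter_upwards [eventually_mem_baseSet F V x₀] with x hx
    have h := LinearMap.congr_fun (ExteriorAlgebra.ιInv_comp_map (vecCoord F V x₀ x)) (U.1 x)
    refine Eq.trans ?_ h.symm
    exact (congrFun ((trivializationAt F V x₀).coe_linearMapAt_of_mem hx) _).symm

instance sectionTower : IsScalarTower ℝ C^∞⟮𝓘(ℝ, E), M; ℝ⟯ Cₛ^∞⟮𝓘(ℝ, E); F, V⟯ where
  smul_assoc r f X := by
    ext x
    exact smul_assoc r (f x) (X x)

theorem exists_bump [FiniteDimensional ℝ E] [IsManifold 𝓘(ℝ, E) ∞ M] [T2Space M] (m : M)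
    {U : Set M} (hU : U ∈ 𝓝 m) :
    ∃ ψ : C^∞⟮𝓘(ℝ, E), M; ℝ⟯, (∀ᶠ x in 𝓝 m, ψ x = 1) ∧ tsupport ψ ⊆ U := by
  obtain ⟨f, -, hf⟩ := (SmoothBumpFunction.nhds_basis_tsupport (I := 𝓘(ℝ, E)) m).mem_iff.1 hU
  exact ⟨⟨f, f.contMDiff⟩, f.eventuallyEq_one, hf⟩

variable [ContMDiffVectorBundle ∞ F V 𝓘(ℝ, E)]

/-- A covector which is constant in one trivialization is smooth in every other one. -/
theorem coordSmoothAt_coordChange {m x₀ : M} (hx₀ : x₀ ∈ (trivializationAt F V m).baseSet)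
    (β : Module.Dual ℝ F) : CoordSmoothAt E (fun x =>
      covecCoord F V x₀ x (β ∘ₗ (trivializationAt F V m).linearMapAt ℝ x)) x₀ := by
  set T := trivializationAt F V m
  set T₀ := trivializationAt F V x₀
  have hmem : T₀.baseSet ∩ T.baseSet ∈ 𝓝 x₀ :=
    inter_mem (eventually_mem_baseSet F V x₀) (T.open_baseSet.mem_nhds hx₀)
  have h1 : CoordSmoothAt E (fun x => (T₀.coordChangeL ℝ T x : F →L[ℝ] F)) x₀ :=
    coordSmoothAt_iff.2 ((contMDiffOn_coordChangeL T₀ T).contMDiffAt hmem)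
  let Φ : (F →L[ℝ] F) →ₗ[ℝ] Module.Dual ℝ F :=
    { toFun := fun g => β ∘ₗ (g : F →ₗ[ℝ] F)
      map_add' := fun g g' => by ext v; simp
      map_smul' := fun r g => by ext v; simp }
  refine (h1.map Φ).congr ?_
  filter_upwards [hmem] with x hx
  ext v
  have h2 : T₀.coordChangeL ℝ T x v = T.linearMapAt ℝ x (T₀.symmₗ ℝ x v) := by
    rw [T₀.coe_coordChangeL T hx, T₀.symmₗ_apply hx.1, T.coe_linearMapAt_of_mem hx.2]
    rfl
  exact congrArg β h2.symm

/-- Dual frames around a point, multiplied by a bump function. -/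
theorem exists_frame [FiniteDimensional ℝ E] [IsManifold 𝓘(ℝ, E) ∞ M] [T2Space M] {n : ℕ}
    (hn : Module.finrank ℝ F = n) (m : M) :
    ∃ (cut : C^∞⟮𝓘(ℝ, E), M; ℝ⟯) (X : Fin n → Cₛ^∞⟮𝓘(ℝ, E); F, V⟯)
      (α : Fin n → ∀ x, Module.Dual ℝ (V x)), (∀ᶠ x in 𝓝 m, cut x = 1) ∧
      (∀ i, (fun x => ExteriorAlgebra.ι ℝ (α i x)) ∈ Forms E F V) ∧
      (∀ i j x, α i x (X j x) = if i = j then cut x else 0) ∧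
      ∀ x w, ∑ i, α i x w • X i x = cut x • w := by
  set T := trivializationAt F V m with hT
  obtain ⟨ψ, hψ1, hψ⟩ := exists_bump (E := E) m (eventually_mem_baseSet F V m)
  let b := Module.finBasisOfFinrankEq ℝ F hn
  have hzero : ∀ x ∉ T.baseSet, ψ x = 0 := fun x hx =>
    image_eq_zero_of_notMem_tsupport fun h => hx (hψ h)
  let X : Fin n → Cₛ^∞⟮𝓘(ℝ, E); F, V⟯ := fun i => ⟨fun x => ψ x • T.localFrame b i x,
    (ContMDiffOn.smul_section_of_tsupport ψ.contMDiff.contMDiffOn T.open_baseSet hψ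
      (T.contMDiffOn_localFrame_baseSet (I := 𝓘(ℝ, E)) (n := ∞) b i) :)⟩
  have hX : ∀ i x, X i x = ψ x • T.symmₗ ℝ x (b i) := fun i x => by
    change ψ x • T.localFrame b i x = _
    by_cases hx : x ∈ T.baseSet
    · rw [T.localFrame_apply_of_mem_baseSet b hx, T.symmₗ_apply hx]
      rfl
    · rw [hzero x hx, zero_smul, zero_smul]
  refine ⟨ψ * ψ, X, fun i x => ψ x • (b.coord i ∘ₗ T.linearMapAt ℝ x), ?_, fun i x₀ => ?_,
    fun i j x => ?_, fun x w => ?_⟩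
  · filter_upwards [hψ1] with x hx
    change ψ x * ψ x = 1
    rw [hx, one_mul]
  · by_cases hx₀ : x₀ ∈ T.baseSet
    · have h : CoordSmoothAt E (fun x => ((LinearMap.lsmul ℝ _).flip.flip (ψ x)
          (covecCoord F V x₀ x (b.coord i ∘ₗ T.linearMapAt ℝ x)))) x₀ :=
        CoordSmoothAt.bilin (coordSmoothAt_iff.2 (ψ.contMDiff x₀))
          (coordSmoothAt_coordChange hx₀ (b.coord i)) _
      refine (h.map (ExteriorAlgebra.ι ℝ)).congr (Eventually.of_forall fun x => ?_)
      change ExteriorAlgebra.map _ (ExteriorAlgebra.ι ℝ _) = _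
      rw [ExteriorAlgebra.map_apply_ι, map_smul]
      rfl
    · have h : ∀ᶠ x in 𝓝 x₀, ψ x = 0 := by
        have : (tsupport ψ)ᶜ ∈ 𝓝 x₀ :=
          (isClosed_tsupport ψ).isOpen_compl.mem_nhds fun h => hx₀ (hψ h)
        filter_upwards [this] with x hx using image_eq_zero_of_notMem_tsupport hx
      have h0 : CoordSmoothAt E (fun _ : M => (0 : ExteriorAlgebra ℝ (Module.Dual ℝ F))) x₀ :=
        fun φ => contMDiffAt_const
      refine h0.congr ?_
      filter_upwards [h] with x hx
      rw [hx, zero_smul, map_zero, map_zero]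
  · rw [hX]
    change ψ x * b.coord i (T.linearMapAt ℝ x (ψ x • T.symmₗ ℝ x (b j))) = _
    by_cases hx : x ∈ T.baseSet
    · rw [map_smul, T.linearMapAt_symmₗ hx, map_smul, b.coord_apply, b.repr_self,
        Finsupp.single_apply]
      simp only [eq_comm (a := j), smul_eq_mul, mul_ite, mul_one, mul_zero]
      rfl
    · have : (ψ * ψ : C^∞⟮𝓘(ℝ, E), M; ℝ⟯) x = 0 := by
        change ψ x * ψ x = 0
        rw [hzero x hx, zero_mul]
      rw [this, hzero x hx, zero_mul, ite_self]
  · simp only [hX]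
    change ∑ i, (ψ x * b.coord i (T.linearMapAt ℝ x w)) • ψ x • T.symmₗ ℝ x (b i) = (ψ x * ψ x) • w
    by_cases hx : x ∈ T.baseSet
    · have h1 : ∑ i, b.coord i (T.linearMapAt ℝ x w) • T.symmₗ ℝ x (b i) = w := by
        simp only [← map_smul, ← map_sum, b.coord_apply, b.sum_repr]
        exact T.symmₗ_linearMapAt hx w
      simp only [mul_smul, smul_comm _ (ψ x) (T.symmₗ ℝ x _), ← Finset.smul_sum, h1]
    · simp [hzero x hx]

end VectorBundle

/-! ### The contraction pair of a vector bundle -/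

section VectorBundle

variable {E : Type*} [NormedAddCommGroup E] [NormedSpace ℝ E]
  {M : Type*} [TopologicalSpace M] [ChartedSpace E M]
  {F : Type*} [NormedAddCommGroup F] [NormedSpace ℝ F] [FiniteDimensional ℝ F]
  {V : M → Type*} [TopologicalSpace (TotalSpace F V)]
  [∀ x, AddCommGroup (V x)] [∀ x, Module ℝ (V x)] [∀ x, TopologicalSpace (V x)]
  [FiberBundle F V] [VectorBundle ℝ F V] {n : ℕ}

/-- A choice, for each point, of dual frames of `V` near that point. They are multiplied by bump
functions, so that they are defined globally. -/
structure LocalFrames (E : Type*) [NormedAddCommGroup E] [NormedSpace ℝ E]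
    {M : Type*} [TopologicalSpace M] [ChartedSpace E M]
    (F : Type*) [NormedAddCommGroup F] [NormedSpace ℝ F] [FiniteDimensional ℝ F]
    (V : M → Type*) [TopologicalSpace (TotalSpace F V)]
    [∀ x, AddCommGroup (V x)] [∀ x, Module ℝ (V x)] [∀ x, TopologicalSpace (V x)]
    [FiberBundle F V] [VectorBundle ℝ F V] (n : ℕ) where
  /-- bump functions -/
  cut : M → C^∞⟮𝓘(ℝ, E), M; ℝ⟯
  /-- the scaled frames -/
  frame : M → Fin n → Cₛ^∞⟮𝓘(ℝ, E); F, V⟯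
  /-- the scaled dual frames -/
  coframe : M → Fin n → ∀ x, Module.Dual ℝ (V x)
  cut_eq_one : ∀ m, ∀ᶠ x in 𝓝 m, cut m x = 1
  smooth_coframe : ∀ m i, (fun x => ExteriorAlgebra.ι ℝ (coframe m i x)) ∈ Forms E F V
  coframe_frame : ∀ m i j x, coframe m i x (frame m j x) = if i = j then cut m x else 0
  sum_coframe_smul_frame : ∀ m x w, ∑ i, coframe m i x w • frame m i x = cut m x • w
  finrank_eq : Module.finrank ℝ F = n

theorem nonempty_localFrames [FiniteDimensional ℝ E] [IsManifold 𝓘(ℝ, E) ∞ M] [T2Space M]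
    [ContMDiffVectorBundle ∞ F V 𝓘(ℝ, E)] (hn : Module.finrank ℝ F = n) :
    Nonempty (LocalFrames E F V n) := by
  choose cut X α h1 h2 h3 h4 using exists_frame (E := E) (V := V) hn
  exact ⟨⟨cut, X, α, h1, h2, h3, h4, hn⟩⟩

omit [FiniteDimensional ℝ F] in
theorem finrank_fibre (F : Type*) [NormedAddCommGroup F] [NormedSpace ℝ F]
    (V : M → Type*) [TopologicalSpace (TotalSpace F V)]
    [∀ x, AddCommGroup (V x)] [∀ x, Module ℝ (V x)] [∀ x, TopologicalSpace (V x)]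
    [FiberBundle F V] [VectorBundle ℝ F V] (x : M) :
    Module.finrank ℝ (V x) = Module.finrank ℝ F :=
  ((trivializationAt F V x).linearEquivAt ℝ x
    (mem_baseSet_trivializationAt F V x)).finrank_eq

theorem finiteDimensional_fibre (F : Type*) [NormedAddCommGroup F] [NormedSpace ℝ F]
    [FiniteDimensional ℝ F] (V : M → Type*) [TopologicalSpace (TotalSpace F V)]
    [∀ x, AddCommGroup (V x)] [∀ x, Module ℝ (V x)] [∀ x, TopologicalSpace (V x)]
    [FiberBundle F V] [VectorBundle ℝ F V] (x : M) : FiniteDimensional ℝ (V x) :=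
  ((trivializationAt F V x).linearEquivAt ℝ x
    (mem_baseSet_trivializationAt F V x)).symm.finiteDimensional

omit [FiniteDimensional ℝ F] in
theorem sum_section_apply {ι : Type*} (s : Finset ι) (X : ι → Cₛ^∞⟮𝓘(ℝ, E); F, V⟯) (x : M) :
    (∑ i ∈ s, X i) x = ∑ i ∈ s, X i x := by
  have h := map_sum (ContMDiffSection.coeAddHom 𝓘(ℝ, E) F ∞ V) X s
  exact (congrFun h x).trans (Finset.sum_apply _ _ _)

namespace LocalFrames

variable (T : LocalFrames E F V n)

/-- Sections of `V` as sections of the dual of the dual bundle. -/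
noncomputable def formFrames : DualFrames E n (covecCoord F V) Cₛ^∞⟮𝓘(ℝ, E); F, V⟯ where
  ev X x := Module.Dual.eval ℝ (V x) (X x)
  cut := T.cut
  ev_add X Y x := map_add _ _ _
  ev_smul f X x := map_smul _ _ _
  finiteDimensional x := by
    have := finiteDimensional_fibre F V x
    infer_instance
  finrank_eq x := by
    rw [Subspace.dual_finrank_eq, finrank_fibre F V x, T.finrank_eq]
  smooth X σ hσ := intProd_eval_mem X ⟨σ, hσ⟩
  cut_eq_one := T.cut_eq_one
  frame m := by
    refine ⟨T.coframe m, T.frame m, T.smooth_coframe m, fun i j x => ?_, fun q f hf => ?_,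
      fun x β => ?_⟩
    · rw [Module.Dual.eval_apply, T.coframe_frame]
      simp only [eq_comm]
    · ext x
      rw [sum_section_apply]
      change T.cut m x • q x = ∑ i, f i x • T.frame m i x
      rw [← T.sum_coframe_smul_frame]
      exact Finset.sum_congr rfl fun i _ => by rw [hf]; rfl
    · ext w
      rw [LinearMap.smul_apply, ← map_smul, ← T.sum_coframe_smul_frame, map_sum,
        LinearMap.sum_apply]
      exact Finset.sum_congr rfl fun i _ => by
        rw [map_smul, LinearMap.smul_apply, Module.Dual.eval_apply, smul_eq_mul, smul_eq_mul,
          mul_comm]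

theorem ι_ιInv_form (α : FormsDeg E F V 1) (x : M) :
    ExteriorAlgebra.ι ℝ (ExteriorAlgebra.ιInv (α.1.1 x)) = α.1.1 x := ιInv_of_mem (α.2 x)

/-- Forms of degree one as sections of the dual bundle. -/
noncomputable def vecFrames : DualFrames E n (vecCoord F V) (FormsDeg E F V 1) where
  ev α x := ExteriorAlgebra.ιInv (α.1.1 x)
  cut := T.cut
  ev_add α β x := map_add _ _ _
  ev_smul f α x := by
    change ExteriorAlgebra.ιInv ((f • α.1).1 x) = _
    rw [smoothExterior_smul_apply, map_smul]
  finiteDimensional x := finiteDimensional_fibre F V x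
  finrank_eq x := by rw [finrank_fibre F V x, T.finrank_eq]
  smooth α σ hσ := by
    simp only [← contract_ι_eq, ι_ιInv_form]
    exact contract_mem α.1 ⟨σ, hσ⟩
  cut_eq_one := T.cut_eq_one
  frame m := by
    refine ⟨fun i x => T.frame m i x, fun i => ⟨⟨_, T.smooth_coframe m i⟩, fun x =>
      ι_mem_exteriorPower _⟩, fun i => (ofSec (T.frame m i)).2, fun i j x => ?_, fun q f hf => ?_,
      fun x w => ?_⟩
    · change ExteriorAlgebra.ιInv (ExteriorAlgebra.ι ℝ (T.coframe m i x)) _ = _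
      rw [ExteriorAlgebra.ι_leftInverse, T.coframe_frame]
    · refine Subtype.ext (smoothExterior_ext fun x => ?_)
      rw [AddSubmonoidClass.coe_finsetSum, sum_smoothExterior_apply]
      change (T.cut m • q.1).1 x = ∑ i, (f i • (_ : Forms E F V)).1 x
      simp only [smoothExterior_smul_apply]
      change T.cut m x • q.1.1 x = ∑ i, f i x • ExteriorAlgebra.ι ℝ (T.coframe m i x)
      have hf' : ∀ i, f i x = ExteriorAlgebra.ιInv (q.1.1 x) (T.frame m i x) := fun i => hf i x
      have hq := ι_ιInv_form q x
      generalize ExteriorAlgebra.ιInv (q.1.1 x) = a at hf' hq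
      rw [← hq]
      simp only [← map_smul, ← map_sum]
      congr 1
      ext w
      rw [LinearMap.smul_apply, ← map_smul, ← T.sum_coframe_smul_frame, map_sum,
        LinearMap.sum_apply]
      exact Finset.sum_congr rfl fun i _ => by
        rw [map_smul, LinearMap.smul_apply, hf', smul_eq_mul, smul_eq_mul, mul_comm]
    · change ∑ i, ExteriorAlgebra.ιInv (ExteriorAlgebra.ι ℝ (T.coframe m i x)) w • _ = _
      refine Eq.trans (Finset.sum_congr rfl fun i _ => ?_) (T.sum_coframe_smul_frame m x w)
      rw [ExteriorAlgebra.ι_leftInverse]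

/-- Forms and multivectors of a vector bundle, with their contractions. -/
noncomputable def toContractionPair : ContractionPair n M C^∞⟮𝓘(ℝ, E), M; ℝ⟯ Cₛ^∞⟮𝓘(ℝ, E); F, V⟯
    (Forms E F V) (Multivectors E F V) where
  form := T.formFrames.toContractionAlgebra
  vec := T.vecFrames.toContractionAlgebra
  cut_eq := rfl
  I := LinearMap.mk₂ _ (fun η U => ⟨fun x => contract (η.1 x) (U.1 x), contract_mem η U⟩)
    (fun η ξ U => smoothExterior_ext fun x => by
      change contract (η.1 x + ξ.1 x) _ = contract _ _ + contract _ _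
      simp only [← contractₗ_apply, map_add, LinearMap.add_apply])
    (fun f η U => smoothExterior_ext fun x => by
      rw [smoothExterior_smul_apply]
      change contract ((f • η).1 x) (U.1 x) = f x • contract _ _
      rw [smoothExterior_smul_apply]
      simp only [← contractₗ_apply, map_smul, LinearMap.smul_apply])
    (fun η U U' => smoothExterior_ext fun x => by
      change contract _ (U.1 x + U'.1 x) = contract _ _ + contract _ _
      simp only [← contractₗ_apply, map_add])
    (fun f η U => smoothExterior_ext fun x => by
      rw [smoothExterior_smul_apply]
      change contract (η.1 x) ((f • U).1 x) = f x • contract _ _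
      rw [smoothExterior_smul_apply]
      simp only [← contractₗ_apply, map_smul])
  I_one U := smoothExterior_ext fun x => by
    change contract 1 (U.1 x) = U.1 x
    rw [← map_one (algebraMap ℝ _), contract_algebraMap, one_smul]
  I_mul η ξ U := smoothExterior_ext fun x => contract_mul _ _ _
  I_one_form α U := smoothExterior_ext fun x => by
    change contract (α.1.1 x) (U.1 x) = intProd (ExteriorAlgebra.ιInv (α.1.1 x)) (U.1 x)
    rw [← contract_ι_eq]
    exact congrArg (contract · (U.1 x)) (ι_ιInv_form α x).symm
  ofL :=
    { toFun := ofSec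
      map_add' := map_add _
      map_smul' := fun f X => smoothExterior_ext fun x => by
        rw [RingHom.id_apply, smoothExterior_smul_apply]
        exact map_smul (ExteriorAlgebra.ι ℝ) (f x) (X x) }
  toL :=
    { toFun := toSec
      map_add' := fun U U' => by
        ext x
        exact map_add ExteriorAlgebra.ιInv (U.1 x) (U'.1 x)
      map_smul' := fun f U => by
        ext x
        change ExteriorAlgebra.ιInv ((f • U).1 x) = f x • ExteriorAlgebra.ιInv (U.1 x)
        rw [smoothExterior_smul_apply, map_smul] }
  ofL_mem X x := ι_mem_exteriorPower _
  toL_ofL X := by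
    ext x
    exact ExteriorAlgebra.ι_leftInverse (R := ℝ) (X x)
  ofL_toL h := smoothExterior_ext fun x => ιInv_of_mem (h x)
  I_ofL α hα X := smoothExterior_ext fun x => by
    change contract (α.1 x) (ExteriorAlgebra.ι ℝ (X x)) = algebraMap ℝ _
      (ExteriorAlgebra.algebraMapInv (intProd (Module.Dual.eval ℝ (V x) (X x)) (α.1 x)))
    rw [← ι_ιInv_form ⟨α, hα⟩ x, contract_ι_eq, intProd_ι, intProd_ι,
      ExteriorAlgebra.algebraMap_leftInverse, Module.Dual.eval_apply]

end LocalFrames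

end VectorBundle

/-! ### The Lie-Rinehart algebra of a Lie algebroid -/

section LieAlgebroid

variable {E : Type*} [NormedAddCommGroup E] [NormedSpace ℝ E]
  {M : Type*} [TopologicalSpace M] [ChartedSpace E M] [IsManifold 𝓘(ℝ, E) ∞ M]
  {F : Type*} [NormedAddCommGroup F] [NormedSpace ℝ F] [FiniteDimensional ℝ F]
  {V : M → Type*} [TopologicalSpace (TotalSpace F V)]
  [∀ x, AddCommGroup (V x)] [∀ x, Module ℝ (V x)] [∀ x, TopologicalSpace (V x)]
  [FiberBundle F V] [VectorBundle ℝ F V] 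
theorem mdifferentiableAt_function {E : Type*} [NormedAddCommGroup E] [NormedSpace ℝ E]
    {M : Type*} [TopologicalSpace M] [ChartedSpace E M] (f : C^∞⟮𝓘(ℝ, E), M; ℝ⟯) (x : M) :
    MDifferentiableAt 𝓘(ℝ, E) 𝓘(ℝ, ℝ) f x :=
  (f.contMDiff x).mdifferentiableAt (by simp)

namespace LieAlgebroid

variable (A : LieAlgebroid E F V)

theorem act_apply (X : Cₛ^∞⟮𝓘(ℝ, E); F, V⟯) (f : C^∞⟮𝓘(ℝ, E), M; ℝ⟯) (x : M) :
    A.act X f x = mvfderiv 𝓘(ℝ, E) f x (A.anchor x (X x)) := rfl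

theorem act_mul (X : Cₛ^∞⟮𝓘(ℝ, E); F, V⟯) (f g : C^∞⟮𝓘(ℝ, E), M; ℝ⟯) :
    A.act X (f * g) = A.act X f * g + f * A.act X g := by
  ext x
  change mvfderiv 𝓘(ℝ, E) (⇑f * ⇑g) x _ = mvfderiv 𝓘(ℝ, E) f x _ * g x + f x * mvfderiv 𝓘(ℝ, E) g x _
  rw [mvfderiv_mul (mdifferentiableAt_function f x) (mdifferentiableAt_function g x)]
  simp only [add_apply, smul_apply, smul_eq_mul]
  ring

theorem act_add_function (X : Cₛ^∞⟮𝓘(ℝ, E); F, V⟯) (f g : C^∞⟮𝓘(ℝ, E), M; ℝ⟯) :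
    A.act X (f + g) = A.act X f + A.act X g := by
  ext x
  change mvfderiv 𝓘(ℝ, E) (⇑f + ⇑g) x _ = mvfderiv 𝓘(ℝ, E) f x _ + mvfderiv 𝓘(ℝ, E) g x _
  rw [mvfderiv_add (mdifferentiableAt_function f x) (mdifferentiableAt_function g x)]
  rfl

theorem act_const (X : Cₛ^∞⟮𝓘(ℝ, E); F, V⟯) (r : ℝ) :
    A.act X (algebraMap ℝ C^∞⟮𝓘(ℝ, E), M; ℝ⟯ r) = 0 := by
  ext x
  change mvfderiv 𝓘(ℝ, E) (fun _ => r) x _ = 0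
  rw [mvfderiv_const]
  rfl

theorem bracket_smul (X Y : Cₛ^∞⟮𝓘(ℝ, E); F, V⟯) (f : C^∞⟮𝓘(ℝ, E), M; ℝ⟯) :
    A.bracket X (f • Y) = f • A.bracket X Y + A.act X f • Y := by
  ext x
  exact A.leibniz X Y f x

/-- The Jacobi identity for `X`, `Y` and `f Z`, expanded by the Leibniz rule. -/
theorem act_bracket_smul (X Y Z : Cₛ^∞⟮𝓘(ℝ, E); F, V⟯) (f : C^∞⟮𝓘(ℝ, E), M; ℝ⟯) :
    (A.act (A.bracket X Y) f - (A.act X (A.act Y f) - A.act Y (A.act X f))) • Z = 0 := by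
  have h := A.jacobi X Y (f • Z)
  simp only [bracket_smul, map_add, A.jacobi X Y Z, smul_add] at h
  rw [sub_smul, sub_smul, ← sub_eq_zero.2 h.symm]
  abel

theorem act_bracket (X Y : Cₛ^∞⟮𝓘(ℝ, E); F, V⟯) (f : C^∞⟮𝓘(ℝ, E), M; ℝ⟯) :
    A.act (A.bracket X Y) f = A.act X (A.act Y f) - A.act Y (A.act X f) := by
  rw [← sub_eq_zero]
  ext x
  by_contra h0
  have hZ : ∀ Z : Cₛ^∞⟮𝓘(ℝ, E); F, V⟯, Z x = 0 := fun Z => by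
    have h := congrArg (fun s : Cₛ^∞⟮𝓘(ℝ, E); F, V⟯ => s x) (A.act_bracket_smul X Y Z f)
    exact (smul_eq_zero.1 h).resolve_left h0
  -- all sections vanish at `x`, so the function vanishes as well
  refine h0 ?_
  have hact : ∀ Z g, A.act Z g x = 0 := fun Z g => by
    rw [act_apply, hZ, map_zero, map_zero]
  change A.act (A.bracket X Y) f x - (A.act X (A.act Y f) x - A.act Y (A.act X f) x) = 0
  simp only [hact, sub_self]

/-- The sections of a Lie algebroid form a Lie-Rinehart algebra over the smooth functions. -/
noncomputable def toLieRinehart :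
    LieRinehart C^∞⟮𝓘(ℝ, E), M; ℝ⟯ Cₛ^∞⟮𝓘(ℝ, E); F, V⟯ where
  bracket := A.bracket
  act X :=
    { toFun := A.act X
      map_add' := A.act_add_function X
      map_smul' := fun r f => by
        rw [Algebra.smul_def, act_mul, act_const, zero_mul, zero_add, RingHom.id_apply,
          ← Algebra.smul_def] }
  bracket_self := A.bracket_self
  jacobi := A.jacobi
  bracket_smul X f Y := A.bracket_smul X Y f
  act_add X Y f := by
    ext x
    change mvfderiv 𝓘(ℝ, E) f x (A.anchor x (X x + Y x)) = mvfderiv 𝓘(ℝ, E) f x (A.anchor x (X x)) +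
      mvfderiv 𝓘(ℝ, E) f x (A.anchor x (Y x))
    rw [map_add, map_add]
  act_smul f X g := by
    ext x
    change mvfderiv 𝓘(ℝ, E) g x (A.anchor x (f x • X x)) =
      f x * mvfderiv 𝓘(ℝ, E) g x (A.anchor x (X x))
    rw [map_smul, map_smul, smul_eq_mul]
  act_mul := A.act_mul
  act_bracket := A.act_bracket

omit [IsManifold 𝓘(ℝ, E) ∞ M] in
/-- The scaled coefficients of a section with respect to a scaled local frame. -/
noncomputable def _root_.LocalFrames.coeff {n : ℕ} (T : LocalFrames E F V n) (m : M) (i : Fin n) :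
    Cₛ^∞⟮𝓘(ℝ, E); F, V⟯ →ₗ[C^∞⟮𝓘(ℝ, E), M; ℝ⟯] C^∞⟮𝓘(ℝ, E), M; ℝ⟯ :=
  T.toContractionPair.form.aug ∘ₗ T.toContractionPair.form.con.flip ⟨_, T.smooth_coframe m i⟩

omit [IsManifold 𝓘(ℝ, E) ∞ M] in
theorem _root_.LocalFrames.coeff_apply {n : ℕ} (T : LocalFrames E F V n) (m : M) (i : Fin n)
    (X : Cₛ^∞⟮𝓘(ℝ, E); F, V⟯) (x : M) : T.coeff m i X x = T.coframe m i x (X x) := by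
  change ExteriorAlgebra.algebraMapInv (intProd (Module.Dual.eval ℝ (V x) (X x))
    (ExteriorAlgebra.ι ℝ (T.coframe m i x))) = _
  rw [intProd_ι, ExteriorAlgebra.algebraMap_leftInverse, Module.Dual.eval_apply]

omit [IsManifold 𝓘(ℝ, E) ∞ M] in
theorem _root_.LocalFrames.cut_smul {n : ℕ} (T : LocalFrames E F V n) (m : M)
    (X : Cₛ^∞⟮𝓘(ℝ, E); F, V⟯) : T.cut m • X = ∑ i, T.coeff m i X • T.frame m i := by
  ext x
  rw [sum_section_apply]
  change T.cut m x • X x = ∑ i, T.coeff m i X x • T.frame m i x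
  simp only [T.coeff_apply, T.sum_coframe_smul_frame]

/-- The divergence of sections with respect to a local frame, cut off by a bump function. -/
noncomputable def localDivergence {n : ℕ} (T : LocalFrames E F V n) (m : M) :
    Cₛ^∞⟮𝓘(ℝ, E); F, V⟯ →ₗ[ℝ] C^∞⟮𝓘(ℝ, E), M; ℝ⟯ :=
  -∑ i, A.toLieRinehart.act (T.frame m i) ∘ₗ (T.coeff m i).restrictScalars ℝ

theorem localDivergence_apply {n : ℕ} (T : LocalFrames E F V n) (m : M)
    (X : Cₛ^∞⟮𝓘(ℝ, E); F, V⟯) :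
    A.localDivergence T m X = -∑ i, A.toLieRinehart.act (T.frame m i) (T.coeff m i X) := by
  simp only [localDivergence, LinearMap.neg_apply, LinearMap.sum_apply, LinearMap.comp_apply,
    LinearMap.restrictScalars_apply]

theorem localDivergence_smul {n : ℕ} (T : LocalFrames E F V n) (m : M)
    (f : C^∞⟮𝓘(ℝ, E), M; ℝ⟯) (X : Cₛ^∞⟮𝓘(ℝ, E); F, V⟯) :
    A.localDivergence T m (f • X) =
      f * A.localDivergence T m X - T.cut m * A.toLieRinehart.act X f := by
  have h : T.cut m * A.toLieRinehart.act X f =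
      ∑ i, T.coeff m i X * A.toLieRinehart.act (T.frame m i) f := by
    let φ : Cₛ^∞⟮𝓘(ℝ, E); F, V⟯ →+ C^∞⟮𝓘(ℝ, E), M; ℝ⟯ :=
      AddMonoidHom.mk' (fun Y => A.toLieRinehart.act Y f) fun Y Z => A.toLieRinehart.act_add Y Z f
    refine (A.toLieRinehart.act_smul (T.cut m) X f).symm.trans ((congrArg φ (T.cut_smul m X)).trans
      ((map_sum φ _ _).trans (Finset.sum_congr rfl fun i _ => A.toLieRinehart.act_smul _ _ _)))
  simp only [localDivergence_apply, h, map_smul, smul_eq_mul, A.toLieRinehart.act_mul]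
  rw [Finset.sum_add_distrib, mul_neg, Finset.mul_sum, neg_add_rev, sub_eq_add_neg]
  congr 2
  exact Finset.sum_congr rfl fun i _ => mul_comm _ _

/-- Divergences exist: local ones are glued by a partition of unity. -/
theorem nonempty_divergence [FiniteDimensional ℝ E] [T2Space M] [SigmaCompactSpace M] {n : ℕ}
    (T : LocalFrames E F V n) : Nonempty A.toLieRinehart.Divergence := by
  obtain ⟨ρ, hρ⟩ := SmoothPartitionOfUnity.exists_isSubordinate 𝓘(ℝ, E) (isClosed_univ (X := M))
    (fun m => interior {x | T.cut m x = 1}) (fun m => isOpen_interior) fun m _ =>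
      mem_iUnion.2 ⟨m, mem_interior_iff_mem_nhds.2 (T.cut_eq_one m)⟩
  have hcut : ∀ m x, ρ m x ≠ 0 → T.cut m x = 1 := fun m x h =>
    interior_subset (s := {x | T.cut m x = 1}) (hρ m (subset_tsupport _ h))
  have hfin : ∀ x (g : M → ℝ), (Function.support fun m => ρ m x * g m).Finite := fun x g =>
    (ρ.locallyFinite.point_finite x).subset fun m hm => left_ne_zero_of_mul hm
  refine ⟨⟨{ toFun := fun X => ⟨fun x => ∑ᶠ m, ρ m x • A.localDivergence T m X x,
              ρ.contMDiff_finsum_smul fun m x _ => (A.localDivergence T m X).contMDiff x⟩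
             map_add' := fun X Y => ?_
             map_smul' := fun r X => ?_ }, fun f X => ?_⟩⟩
  · ext x
    change ∑ᶠ m, ρ m x * A.localDivergence T m (X + Y) x =
      (∑ᶠ m, ρ m x * A.localDivergence T m X x) + ∑ᶠ m, ρ m x * A.localDivergence T m Y x
    rw [← finsum_add_distrib (hfin x _) (hfin x _)]
    refine finsum_congr fun m => ?_
    rw [map_add, ← mul_add]
    rfl
  · ext x
    change ∑ᶠ m, ρ m x * A.localDivergence T m (r • X) x =
      r * ∑ᶠ m, ρ m x * A.localDivergence T m X x
    rw [mul_finsum]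
    refine finsum_congr fun m => ?_
    rw [map_smul, mul_left_comm]
    rfl
  · ext x
    change ∑ᶠ m, ρ m x * A.localDivergence T m (f • X) x =
      f x * (∑ᶠ m, ρ m x * A.localDivergence T m X x) - A.toLieRinehart.act X f x
    have h1 : A.toLieRinehart.act X f x = ∑ᶠ m, ρ m x * A.toLieRinehart.act X f x := by
      rw [← finsum_mul, ρ.sum_eq_one (mem_univ x), one_mul]
    rw [h1, mul_finsum, ← finsum_sub_distrib _ (hfin x _)]
    · refine finsum_congr fun m => ?_
      rw [localDivergence_smul]
      change ρ m x * (f x * A.localDivergence T m X x - T.cut m x * A.toLieRinehart.act X f x) = _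
      rcases eq_or_ne (ρ m x) 0 with h | h
      · simp only [h, zero_mul, mul_zero, sub_zero]
      · rw [hcut m x h]
        ring
    · refine (hfin x fun m => f x * A.localDivergence T m X x).subset fun m hm => ?_
      rw [Function.mem_support, mul_left_comm]
      exact hm

end LieAlgebroid
end LieAlgebroid

/-! ### Connections on the top exterior power -/

section LieAlgebroid

variable {E : Type*} [NormedAddCommGroup E] [NormedSpace ℝ E]
  {M : Type*} [TopologicalSpace M] [ChartedSpace E M] [IsManifold 𝓘(ℝ, E) ∞ M]
  {F : Type*} [NormedAddCommGroup F] [NormedSpace ℝ F] [FiniteDimensional ℝ F]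
  {V : M → Type*} [TopologicalSpace (TotalSpace F V)]
  [∀ x, AddCommGroup (V x)] [∀ x, Module ℝ (V x)] [∀ x, TopologicalSpace (V x)]
  [FiberBundle F V] [VectorBundle ℝ F V] {n : ℕ} (T : LocalFrames E F V n)

namespace LocalFrames

omit [IsManifold 𝓘(ℝ, E) ∞ M] in
/-- A local frame is a basis of the fibre at its base point. -/
noncomputable def basis (m : M) : Module.Basis (Fin n) ℝ (V m) :=
  .ofEquivFun
    { toFun := fun w i => T.coframe m i m w
      map_add' := fun w w' => funext fun i => map_add _ _ _
      map_smul' := fun r w => funext fun i => map_smul _ _ _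
      invFun := fun c => ∑ i, c i • T.frame m i m
      left_inv := fun w => by
        change ∑ i, T.coframe m i m w • T.frame m i m = w
        rw [T.sum_coframe_smul_frame, (T.cut_eq_one m).self_of_nhds, one_smul]
      right_inv := fun c => funext fun i => by
        simp [T.coframe_frame, (T.cut_eq_one m).self_of_nhds] }

omit [IsManifold 𝓘(ℝ, E) ∞ M] in
theorem frame_apply_self (m : M) (i : Fin n) : T.frame m i m = T.basis m i := by
  rw [basis, Module.Basis.coe_ofEquivFun]
  change _ = ∑ j, (Pi.single i 1 : Fin n → ℝ) j • T.frame m j m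
  simp [Pi.single_apply]

end LocalFrames

/-- The contraction and the exterior product with dual bases cancel on multivectors of the degree
just below the top. -/
theorem sum_intProd_ι_mul {W : Type*} [AddCommGroup W] [Module ℝ W]
    (b : Module.Basis (Fin (n + 1)) ℝ W) {w : ExteriorAlgebra ℝ W} (hw : w ∈ ⋀[ℝ]^n W) :
    ∑ i, intProd (b.coord i) (ExteriorAlgebra.ι ℝ (b i) * w) = w := by
  have h := sum_ι_mul_intProd (c := 1) (e := b) (p := b.coord) (fun v => by
    rw [one_smul]; exact b.sum_repr v) hw
  have h1 : ∀ i, b.coord i (b i) = 1 := fun i => by simp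
  simp only [intProd_ι_mul, h1, one_smul, Finset.sum_sub_distrib, h, Finset.sum_const,
    Finset.card_univ, Fintype.card_fin, mul_one]
  rw [← Nat.cast_smul_eq_nsmul ℝ, ← sub_smul]
  simp

namespace LieAlgebroid

variable (A : LieAlgebroid E F V)

/-- Evaluation of functions at a point. -/
noncomputable def evalAt (x : M) : C^∞⟮𝓘(ℝ, E), M; ℝ⟯ →ₗ[ℝ] ℝ where
  toFun f := f x
  map_add' _ _ := rfl
  map_smul' _ _ := rfl

theorem isDifferential_d : A.IsDifferential (A.toLieRinehart.d T.toContractionPair.form) where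
  degree k η hη := A.toLieRinehart.d_mem T.toContractionPair.form hη
  cartan k η hη X x := by
    have h := congrArg (evalAt x) (T.toContractionPair.pair_d A.toLieRinehart hη X)
    have hpair : ∀ U, evalAt x (T.toContractionPair.pair η U) = evalForm η U x := fun U => rfl
    have hact : ∀ Y U, evalAt x (A.toLieRinehart.act Y (T.toContractionPair.pair η U)) =
      A.deriv Y (evalForm η U) x := fun Y U => rfl
    have hd : evalAt x (T.toContractionPair.pair (A.toLieRinehart.d T.toContractionPair.form η)
        (T.toContractionPair.wedge X ∅)) =
      evalForm (A.toLieRinehart.d T.toContractionPair.form η) (wedgeOmit X ∅) x := rfl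
    simp only [map_add, map_sum, apply_ite (evalAt x), map_zero, map_smul, smul_eq_mul, hpair,
      hact] at h
    rw [hd] at h
    exact h

include T in
variable {A} in
theorem IsDifferential.unique {d d' : Forms E F V →ₗ[ℝ] Forms E F V} (h : A.IsDifferential d)
    (h' : A.IsDifferential d') : d = d' := by
  refine LinearMap.ext fun η => sub_eq_zero.1 ?_
  refine T.toContractionPair.form.induction_gr (Q := fun η => d η - d' η = 0)
    (fun a b ha hb => ?_) (by simp) (fun k η hη => ?_) η
  · rw [map_add, map_add, add_sub_add_comm, ha, hb, add_zero]
  · refine T.toContractionPair.eq_zero_of_pair_wedge (k := k + 1)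
      (Submodule.sub_mem _ (h.degree k η hη) (h'.degree k η hη)) fun X => ?_
    ext x
    have h1 := (h.cartan k η hη X x).trans (h'.cartan k η hη X x).symm
    change formPair ((d η).1 x - (d' η).1 x) ((wedgeOmit X ∅ : Multivectors E F V).1 x) = 0
    have h2 : ∀ a b v, formPair (W := V x) (a - b) v = formPair a v - formPair b v :=
      fun a b v => by simp only [formPair, ← contractₗ_apply, map_sub, LinearMap.sub_apply]
    rw [h2]
    exact sub_eq_zero.2 h1

theorem isSchoutenBracket_iff
    (B : Multivectors E F V →ₗ[ℝ] Multivectors E F V →ₗ[ℝ] Multivectors E F V) :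
    A.IsSchoutenBracket B ↔ T.toContractionPair.IsSchouten A.toLieRinehart B :=
  ⟨fun h => ⟨h.degree, h.degree_zero, h.skew, h.jacobi, h.leibniz, h.sections, h.functions⟩,
    fun h => ⟨h.degree, h.degree_zero, h.skew, h.jacobi, h.leibniz, h.sections, h.functions⟩⟩

variable {A} (δ : A.toLieRinehart.Divergence)

/-- The operator of a divergence is local. -/
theorem divOp_congr [FiniteDimensional ℝ E] [T2Space M] {U U' : Multivectors E F V} {m : M}
    (h : ∀ᶠ x in 𝓝 m, U.1 x = U'.1 x) :
    (T.toContractionPair.divOp δ U).1 m = (T.toContractionPair.divOp δ U').1 m := by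
  obtain ⟨ψ, hψ1, hψ⟩ := exists_bump (E := E) m h
  have h0 : ψ • (U - U') = 0 := smoothExterior_ext fun x => by
    rw [smoothExterior_smul_apply]
    change ψ x • (U.1 x - U'.1 x) = 0
    by_cases hx : U.1 x = U'.1 x
    · rw [hx, sub_self, smul_zero]
    · rw [image_eq_zero_of_notMem_tsupport fun hx' => hx (hψ hx'), zero_smul]
  have h1 := T.toContractionPair.divOp_smul δ ψ (U - U')
  rw [h0, map_zero, map_sub] at h1
  have h2 := congrFun (congrArg Subtype.val h1) m
  change 0 = (ψ • (T.toContractionPair.divOp δ U - T.toContractionPair.divOp δ U')).1 m -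
    contract ((A.toLieRinehart.dFun T.toContractionPair.form ψ).1 m) (U.1 m - U'.1 m) at h2
  rw [smoothExterior_smul_apply, hψ1.self_of_nhds, one_smul, h.self_of_nhds, sub_self,
    ← contractₗ_apply, map_zero, sub_zero] at h2
  exact sub_eq_zero.1 h2.symm

/-- The connection of a divergence. -/
noncomputable def connectionOfDivergence : A.Connection (MultivectorsDeg E F V n) where
  nabla := T.toContractionPair.connection δ
  smul_left := T.toContractionPair.connection_smul_left δ
  leibniz := T.toContractionPair.connection_smul δ

theorem connectionOfDivergence_curvature_eq_smul {R : Forms E F V}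
    (hR : R ∈ T.toContractionPair.form.gr 2)
    (hDD : ∀ U, T.toContractionPair.divOp δ (T.toContractionPair.divOp δ U) =
      -T.toContractionPair.I R U) (X Y : Cₛ^∞⟮𝓘(ℝ, E); F, V⟯) (Λ : MultivectorsDeg E F V n) :
    (connectionOfDivergence T δ).curvature X Y Λ =
      T.toContractionPair.pair R (ofSec X * ofSec Y) • Λ :=
  T.toContractionPair.connection_curvature_eq_smul δ hR hDD X Y Λ

theorem connectionOfDivergence_isFlat_iff : (connectionOfDivergence T δ).IsFlat ↔
    ∀ U, T.toContractionPair.divOp δ (T.toContractionPair.divOp δ U) = 0 :=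
  T.toContractionPair.connection_flat_iff δ

theorem connectionOfDivergence_isCurvatureForm {R : Forms E F V}
    (hR : R ∈ T.toContractionPair.form.gr 2)
    (hDD : ∀ U, T.toContractionPair.divOp δ (T.toContractionPair.divOp δ U) =
      -T.toContractionPair.I R U) : (connectionOfDivergence T δ).IsCurvatureForm R := by
  refine ⟨hR, fun X Y Λ x => ?_⟩
  rw [connectionOfDivergence_curvature_eq_smul T δ hR hDD]
  exact smoothExterior_smul_apply _ _ _

include T in
theorem Connection.IsCurvatureForm.unique {C : A.Connection (MultivectorsDeg E F V n)}
    {R R' : Forms E F V} (h : C.IsCurvatureForm R) (h' : C.IsCurvatureForm R') : R = R' := by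
  refine T.toContractionPair.eq_of_smul_top h.1 h'.1 fun X Y Λ =>
    Subtype.ext (smoothExterior_ext fun x => ?_)
  have h1 : ∀ R'' : Forms E F V, ((T.toContractionPair.pair R'' (ofSec X * ofSec Y) •
      (Λ.1 : Multivectors E F V)).1 x) = evalForm R'' (ofSec X * ofSec Y) x • Λ.1.1 x :=
    fun R'' => smoothExterior_smul_apply _ _ _
  exact (h1 R).trans ((h.2 X Y Λ x).symm.trans ((h'.2 X Y Λ x).trans (h1 R').symm))

theorem connectionOfDivergence_bijective [FiniteDimensional ℝ E] [T2Space M]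
    [SigmaCompactSpace M] : Function.Bijective (connectionOfDivergence (A := A) T) := by
  refine ⟨fun δ δ' h => ?_, fun C => ?_⟩
  · refine T.toContractionPair.div_eq_of_connection_eq fun X Λ hΛ => ?_
    have h1 := congrArg (fun C : A.Connection (MultivectorsDeg E F V n) =>
      (C.nabla X ⟨Λ, hΛ⟩ : Multivectors E F V)) h
    exact neg_injective h1
  · obtain ⟨δ₀⟩ := A.nonempty_divergence T
    obtain ⟨δ, hδ⟩ := T.toContractionPair.exists_divergence_of_connection δ₀ C.nabla C.smul_left
      C.leibniz
    refine ⟨δ, ?_⟩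
    have h : (connectionOfDivergence T δ).nabla = C.nabla :=
      LinearMap.ext fun X => LinearMap.ext fun Λ => Subtype.ext (hδ X Λ).symm
    cases C
    cases h
    rfl

/-- The local formula for the operator of a divergence is the formula for `D (η ⌟ Λ)`, in which
`η ⌟ DΛ` is rewritten by means of the connection. -/
theorem connectionOfDivergence_isOperatorOf [FiniteDimensional ℝ E] [T2Space M] :
    (connectionOfDivergence T δ).IsOperatorOf (A.toLieRinehart.d T.toContractionPair.form)
      (T.toContractionPair.divOp δ) := by
  intro p k hpk U hU η hη Λ m hUm X b hX
  have h1 : (T.toContractionPair.divOp δ U).1 m =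
      (T.toContractionPair.divOp δ (T.toContractionPair.I η Λ)).1 m := divOp_congr T δ hUm
  set W := T.toContractionPair.divOp δ Λ with hW
  have h2 : ∑ i, intProd (b.coord i) (ExteriorAlgebra.ι ℝ (b i) * W.1 m) = W.1 m := by
    rcases n with _ | n
    · rw [hW, T.toContractionPair.divOp_zero δ Λ.2, Fin.sum_univ_zero]
      rfl
    · exact sum_intProd_ι_mul b (T.toContractionPair.divOp_mem δ Λ.2 m)
  have h3 : ∀ i, contract (ExteriorAlgebra.ι ℝ (b.coord i) * η.1 m)
      (((connectionOfDivergence T δ).nabla (X i) Λ).1.1 m) =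
      -contract (η.1 m) (intProd (b.coord i) (ExteriorAlgebra.ι ℝ (b i) * W.1 m)) := fun i => by
    rw [contract_mul, contract_ι_eq]
    change contract _ (intProd _ (-(ExteriorAlgebra.ι ℝ (X i m) * W.1 m))) = _
    rw [hX, map_neg]
    simp only [← contractₗ_apply, map_neg]
  simp only [h3, Finset.sum_neg_distrib]
  simp only [← contractₗ_apply, ← map_sum, h2]
  rw [h1, T.toContractionPair.divOp_I δ hη]
  change (-1 : ℝ) ^ p • (contract (η.1 m) (W.1 m) -
    contract ((A.toLieRinehart.d T.toContractionPair.form η).1 m) (Λ.1.1 m)) = _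
  simp only [← contractₗ_apply]
  rw [← smul_neg, neg_add, neg_neg, sub_eq_neg_add]

include T in
/-- The local formula determines the operator, because every multivector is locally of the form
`η ⌟ Λ`. -/
theorem Connection.IsOperatorOf.unique {C : A.Connection (MultivectorsDeg E F V n)}
    {d : Forms E F V →ₗ[ℝ] Forms E F V} {D D' : Multivectors E F V →ₗ[ℝ] Multivectors E F V}
    (h : C.IsOperatorOf d D) (h' : C.IsOperatorOf d D') : D = D' := by
  refine LinearMap.ext fun U => ?_
  refine T.toContractionPair.vec.induction_gr (Q := fun U => D U = D' U)
    (fun a b ha hb => ?_) (by simp) (fun k U hU => ?_) U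
  · rw [map_add, map_add, ha, hb]
  rcases lt_or_ge n k with hk | hk
  · rw [T.toContractionPair.vec.eq_zero_of_lt hk hU, map_zero, map_zero]
  refine smoothExterior_ext fun m => ?_
  obtain ⟨Λ, hΛ, hI⟩ := T.toContractionPair.exists_I_top_eq m
  obtain ⟨η, hη, hηΛ⟩ := hI (n - k) k (by omega) U hU
  have hU' : ∀ᶠ x in 𝓝 m, U.1 x = contract (η.1 x) (Λ.1 x) := by
    filter_upwards [T.cut_eq_one m] with x hx
    have h1 := congrFun (congrArg Subtype.val hηΛ) x
    refine Eq.symm (h1.trans ?_)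
    rw [pow_smul_smoothExterior_apply]
    change T.cut m x ^ _ • U.1 x = U.1 x
    rw [hx, one_pow, one_smul]
  have hn : n - k + k = n := by omega
  rw [h _ k hn U hU η hη ⟨Λ, hΛ⟩ m hU' (T.frame m) (T.basis m) (T.frame_apply_self m),
    h' _ k hn U hU η hη ⟨Λ, hΛ⟩ m hU' (T.frame m) (T.basis m) (T.frame_apply_self m)]

end LieAlgebroid
end LieAlgebroid

/-! ### The correspondence between connections and generating operators -/

section LieAlgebroid

variable {E : Type*} [NormedAddCommGroup E] [NormedSpace ℝ E]
  {M : Type*} [TopologicalSpace M] [ChartedSpace E M] [IsManifold 𝓘(ℝ, E) ∞ M]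
  {F : Type*} [NormedAddCommGroup F] [NormedSpace ℝ F] [FiniteDimensional ℝ F]
  {V : M → Type*} [TopologicalSpace (TotalSpace F V)]
  [∀ x, AddCommGroup (V x)] [∀ x, Module ℝ (V x)] [∀ x, TopologicalSpace (V x)]
  [FiberBundle F V] [VectorBundle ℝ F V] {n : ℕ} (T : LocalFrames E F V n)
  {A : LieAlgebroid E F V}

/-- Divergences correspond to generating operators of the Schouten bracket. -/
theorem LieAlgebroid.exists_equiv_generators
    {B : Multivectors E F V →ₗ[ℝ] Multivectors E F V →ₗ[ℝ] Multivectors E F V}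
    (hB : A.IsSchoutenBracket B) :
    ∃ e : A.toLieRinehart.Divergence ≃
        {D : Multivectors E F V →ₗ[ℝ] Multivectors E F V //
          IsDegreeNegOne D ∧ GeneratesBracket B D},
      ∀ δ, (e δ).1 = T.toContractionPair.divOp δ := by
  have hB' := (isSchoutenBracket_iff T A B).1 hB
  have h : ∀ δ, IsDegreeNegOne (T.toContractionPair.divOp δ) ∧
      GeneratesBracket B (T.toContractionPair.divOp δ) := fun δ =>
    have hG := T.toContractionPair.divOp_isGenerator δ hB'
    ⟨⟨hG.zero, hG.succ⟩, hG.generates⟩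
  refine ⟨Equiv.ofBijective (fun δ => ⟨T.toContractionPair.divOp δ, h δ⟩) ⟨fun δ δ' hδ => ?_,
    fun D => ?_⟩, fun δ => rfl⟩
  · have h1 := congrArg Subtype.val hδ
    refine T.toContractionPair.div_eq_of_connection_eq fun X Λ _ => ?_
    exact congrArg (fun D => T.toContractionPair.ofL X * D Λ) h1
  · obtain ⟨δ, hδ⟩ := ContractionPair.IsGenerator.exists_divergence T.toContractionPair hB'
      ⟨D.2.1.1, D.2.1.2, D.2.2⟩
    exact ⟨δ, Subtype.ext hδ.symm⟩

end LieAlgebroid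

theorem theorem3p1
    {E : Type*} [NormedAddCommGroup E] [NormedSpace ℝ E] [FiniteDimensional ℝ E]
    {M : Type*} [TopologicalSpace M] [T2Space M] [SigmaCompactSpace M]
    [ChartedSpace E M] [IsManifold 𝓘(ℝ, E) ∞ M]
    {F : Type*} [NormedAddCommGroup F] [NormedSpace ℝ F] [FiniteDimensional ℝ F]
    {V : M → Type*} [TopologicalSpace (TotalSpace F V)]
    [∀ x, AddCommGroup (V x)] [∀ x, Module ℝ (V x)] [∀ x, TopologicalSpace (V x)]
    [FiberBundle F V] [VectorBundle ℝ F V] [ContMDiffVectorBundle ∞ F V 𝓘(ℝ, E)]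
    (n : ℕ) (hn : Module.finrank ℝ F = n) (A : LieAlgebroid E F V) :
    -- the differential on forms and the Schouten bracket exist and are unique
    ∃ d : Forms E F V →ₗ[ℝ] Forms E F V,
      A.IsDifferential d ∧ (∀ d', A.IsDifferential d' → d' = d) ∧
    ∃ B : Multivectors E F V →ₗ[ℝ] Multivectors E F V →ₗ[ℝ] Multivectors E F V,
      A.IsSchoutenBracket B ∧ (∀ B', A.IsSchoutenBracket B' → B' = B) ∧
    -- the bijection between connections and generating operators
    ∃ Φ : A.Connection (MultivectorsDeg E F V n) ≃
        {D : Multivectors E F V →ₗ[ℝ] Multivectors E F V //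
          IsDegreeNegOne D ∧ GeneratesBracket B D},
      -- the operator of a connection is well defined by the local formula
      (∀ C, C.IsOperatorOf d (Φ C).1 ∧ ∀ D', C.IsOperatorOf d D' → D' = (Φ C).1) ∧
      -- the connection of an operator is `∇_X Λ = - X ∧ DΛ`
      (∀ D (X : Cₛ^∞⟮𝓘(ℝ, E); F, V⟯) (Λ : MultivectorsDeg E F V n),
        (((Φ.symm D).nabla X Λ : MultivectorsDeg E F V n) : Multivectors E F V) =
          -(ofSec X * D.1 Λ)) ∧
      -- `D² U = - R ⌟ U`, with `R` the curvature form
      (∀ C, ∃ R : Forms E F V, C.IsCurvatureForm R ∧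
        (∀ R', C.IsCurvatureForm R' → R' = R) ∧
        ∀ (U : Multivectors E F V) (x : M),
          ((Φ C).1 ((Φ C).1 U)).1 x = -contract (R.1 x) (U.1 x)) ∧
      -- flat connections correspond to operators of square zero
      (∀ C, C.IsFlat ↔ ∀ U : Multivectors E F V, (Φ C).1 ((Φ C).1 U) = 0) := by

  obtain ⟨T⟩ := nonempty_localFrames (E := E) (V := V) hn
  obtain ⟨δ₀⟩ := A.nonempty_divergence T
  have hd := A.isDifferential_d T
  have hB := (A.isSchoutenBracket_iff T _).2 (T.toContractionPair.genBracket_isSchouten δ₀)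
  refine ⟨_, hd, fun d' hd' => hd'.unique T hd, _, hB, fun B' hB' =>
    ((A.isSchoutenBracket_iff T _).1 hB').unique ((A.isSchoutenBracket_iff T _).1 hB), ?_⟩
  obtain ⟨e, he⟩ := LieAlgebroid.exists_equiv_generators T hB
  let e' := Equiv.ofBijective _ (LieAlgebroid.connectionOfDivergence_bijective (A := A) T)
  have hΦ : ∀ C, ∃ δ, C = LieAlgebroid.connectionOfDivergence T δ ∧
      ((e'.symm.trans e) C).1 = T.toContractionPair.divOp δ := fun C =>
    ⟨e'.symm C, (e'.apply_symm_apply C).symm, he _⟩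
  refine ⟨e'.symm.trans e, fun C => ?_, fun D X Λ => ?_, fun C => ?_, fun C => ?_⟩
  · obtain ⟨δ, rfl, h⟩ := hΦ C
    rw [h]
    have hD := LieAlgebroid.connectionOfDivergence_isOperatorOf T δ
    exact ⟨hD, fun D' hD' => hD'.unique T hD⟩
  · have h := he (e.symm D)
    rw [e.apply_symm_apply] at h
    rw [h]
    rfl
  · obtain ⟨δ, rfl, h⟩ := hΦ C
    rw [h]
    obtain ⟨R, hR, hDD⟩ := T.toContractionPair.exists_divOp_divOp_eq δ
    have hC := LieAlgebroid.connectionOfDivergence_isCurvatureForm T δ hR hDD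
    exact ⟨R, hC, fun R' hR' => hR'.unique T hC, fun U x =>
      congrFun (congrArg Subtype.val (hDD U)) x⟩
  · obtain ⟨δ, rfl, h⟩ := hΦ C
    rw [h]
    exact LieAlgebroid.connectionOfDivergence_isFlat_iff T δ
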